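/- Let $d\ge 2$ and let $\omega_d=2\pi^{(d+1)/2}/\Gamma(\tfrac{d+1}{2})$ be the surface measure of the unit sphere in $\mathbb{R}^{d+1}$. For $t>0$ and $x\in\mathbb{R}^d$ let $\mathbb{P}_t(x)$ be the $(d+1)\times(d+1)$ matrix (the modified Poisson-type kernel) $$\mathbb{P}_t(x)=\frac{2(d+1)}{\omega_d}\,\frac{t}{(|x|^2+t^2)^{\frac{d+3}{2}}}\begin{bmatrix} x\otimes x & t\,x\\ t\,x^{T} & t^2\end{bmatrix}.$$ For a vector field $f=(f_1,\dots,f_d)\in L^p(\mathbb{R}^d;\mathbb{R}^d)$, regarded as the $\mathbb{R}^{d+1}$-valued field $(f_1,\dots,f_d,0)$, put $U(x,t)=(\mathbb{P}_t*f)(x)\in\mathbb{R}^{d+1}$, i.e. $U_i=\sum_{j=1}^{d+1}(\mathbb{P}_t)_{ij}*f_j$, and $$\mathring{\mathfrak g}_1(f)(x)=\Big(\int_0^\infty t\,|\partial_tU(x,t)|^2\,dt\Big)^{1/2}.$$ Theorem. Suppose that $1<p<\infty$. Then there are constants $C_1,C_2>0$, depending only on $d$ and $p$, such that for every $f\in L^p(\mathbb{R}^d;\mathbb{R}^d)$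 the convolution defining $U(x,t)$ converges absolutely and $U(x,\cdot)$ is differentiable at $t$ for all $x\in\mathbb{R}^d$ and $t>0$, the function $\mathring{\mathfrak g}_1(f)$ belongs to $L^p(\mathbb{R}^d)$, and $$C_1\,\|\mathring{\mathfrak g}_1(f)\|_{L^p(\mathbb{R}^d)}\le\|f\|_{L^p(\mathbb{R}^d)}\le C_2\,\|\mathring{\mathfrak g}_1(f)\|_{L^p(\mathbb{R}^d)}.$$ -/

import Mathlib

open MeasureTheory
open scoped ENNReal NNReal Convolution

noncomputable section

/-- The surface measure `ω_d = 2 π^((d+1)/2) / Γ((d+1)/2)` of the unit sphere of `ℝ^(d+1)`. -/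
def sphereArea (d : ℕ) : ℝ :=
  2 * Real.pi ^ (((d : ℝ) + 1) / 2) / Real.Gamma (((d : ℝ) + 1) / 2)

/-- The modified matrix Poisson-type kernel `ℙ_t(x)`, `x ∈ ℝ^d`, a `(d+1) × (d+1)` matrix in block
form; the index `Sum.inr ()` is the last, `(d+1)`-st, one. -/
def matrixPoissonKernel {d : ℕ} (t : ℝ) (x : EuclideanSpace ℝ (Fin d)) :
    Matrix (Fin d ⊕ Unit) (Fin d ⊕ Unit) ℝ :=
  (2 * ((d : ℝ) + 1) / sphereArea d * (t / (‖x‖ ^ 2 + t ^ 2) ^ (((d : ℝ) + 3) / 2))) •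
    Matrix.fromBlocks
      (Matrix.of fun i j => x i * x j) (Matrix.of fun i _ => t * x i)
      (Matrix.of fun _ j => t * x j) (Matrix.of fun _ _ => t ^ 2)

/-- A vector field `f = (f_1, …, f_d)` viewed as `(f_1, …, f_d, 0)`. -/
def extendByZero {d : ℕ} (f : EuclideanSpace ℝ (Fin d) → EuclideanSpace ℝ (Fin d))
    (x : EuclideanSpace ℝ (Fin d)) : Fin d ⊕ Unit → ℝ :=
  Sum.elim (fun k => f x k) (fun _ => 0)

/-- The Poisson-type integral `U(x, t) = (ℙ_t * f)(x) ∈ ℝ^(d+1)`, with components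
`U_i = ∑ j, 𝔭_t^{ij} * f_j`. -/
def poissonTypeIntegral {d : ℕ} (f : EuclideanSpace ℝ (Fin d) → EuclideanSpace ℝ (Fin d))
    (x : EuclideanSpace ℝ (Fin d)) (t : ℝ) : EuclideanSpace ℝ (Fin d ⊕ Unit) :=
  WithLp.toLp 2 fun i => ∑ j,
    ((fun y => matrixPoissonKernel t y i j) ⋆[ContinuousLinearMap.mul ℝ ℝ, volume]
      (fun y => extendByZero f y j)) x

/-- The Littlewood–Paley-type function `(∫_0^∞ t |∂_t U(x,t)|² dt)^(1/2)`, with values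
in `[0, ∞]`. -/
def littlewoodPaleyG {d : ℕ} (f : EuclideanSpace ℝ (Fin d) → EuclideanSpace ℝ (Fin d))
    (x : EuclideanSpace ℝ (Fin d)) : ℝ≥0∞ :=
  (∫⁻ t in Set.Ioi (0 : ℝ),
    ENNReal.ofReal t * ‖deriv (fun s => poissonTypeIntegral f x s) t‖ₑ ^ 2) ^ (1 / 2 : ℝ)

end

/-! Write `ρ = 2π|ξ|`. The scalar Poisson kernel has Fourier transform `e^(-ρt)`. The last row of
the matrix kernel consists of the functions `-t ∂_j` of it, and the tangential entries arise from
the last row by multiplication by a coordinate, after division by `t`. Hence the tangential entries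
have transform `(δ_ij - ρt ξ_i ξ_j/|ξ|²) e^(-ρt)`, those of the last row `-2πi ξ_j t e^(-ρt)`, and
all `t`-derivatives are at most `ρ(2 + ρt) e^(-ρt)` in modulus.

Upper bound. Each entry of `∂_t ℙ_t` is a function of `(x, t)`, `C¹` off the origin and homogeneous
of degree `-(d+1)`. The multiplier bound and Plancherel give the `L²` estimate of its square
function, because `∫ t ρ² e^(-ρt) dt = 1` for every `ρ` (`lintegral_squareFn_sq_le`). Homogeneity
gives Hörmander's condition for the kernel with values in `L²(t dt)`, with a constant that does not
depend on a truncation to `a ≤ t ≤ b` (`exists_isSingularKernel_vecKernel`). The Calderón–Zygmund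
theorem for operator valued kernels, `eLpNorm_kernelOp_le`, then yields every `1 < p < ∞`, and
monotone convergence removes the truncation.

The Calderón–Zygmund theorem is proved from dyadic cubes. The estimate of `|{|TF| > t}|` keeps the
truncated second moment of `|F|` over `{M|F| ≤ t}` next to `|{M|F| > t}|`. In this form it can be
integrated against `t^(p-1)` directly, without separate interpolation
(`lintegral_rpow_le_of_distribution_le`). The range `p > 2` follows by duality.

Lower bound. Let `V` be the scalar Poisson extension of a test function `g`, and pair the `i`-th
component of `∂_t U` with `∂_t V` in `t dx dt`. By Parseval the contribution of `f_j` has the weight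
`ρ²(δ_ij + (1 - ρt) ξ_i ξ_j/|ξ|²) e^(-2ρt)`. Integrated against `t dt`, its part with `ξ_i ξ_j/|ξ|²`
vanishes and `δ_ij/4` remains (`integral_pairing_weight`). So the pairing equals `¼ ∫ f_i g`.
Cauchy–Schwarz in `t`, Hölder in `x` and the `L^q` bound for the square function of `g` control it
by the `L^p` norm of `littlewoodPaleyG f`, and duality recovers the norm of `f_i`. -/

noncomputable section

/-- The Euclidean space `ℝ^d`. -/
abbrev Eucl (d : ℕ) : Type := EuclideanSpace ℝ (Fin d)

/-! ### Dyadic cubes -/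

/-- The integer coordinates of the dyadic cube of side `2^(-n)` that contains `x`. -/
def dyadicIndex {d : ℕ} (n : ℤ) (x : Eucl d) : Fin d → ℤ := fun i => ⌊x i * 2 ^ n⌋

/-- The half-open dyadic cube of side `2^(-q.1)` with integer coordinates `q.2`. -/
def dyadicCube {d : ℕ} (q : ℤ × (Fin d → ℤ)) : Set (Eucl d) := {y | dyadicIndex q.1 y = q.2}

section Dyadic

variable {d : ℕ}

theorem measurable_dyadicIndex (n : ℤ) : Measurable (dyadicIndex n : Eucl d → Fin d → ℤ) := by
  refine measurable_pi_lambda _ fun i => Int.measurable_floor.comp ?_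
  have : Measurable fun x : Eucl d => x i := (EuclideanSpace.proj i).continuous.measurable
  exact this.mul_const _

theorem measurableSet_dyadicCube (q : ℤ × (Fin d → ℤ)) : MeasurableSet (dyadicCube q) :=
  measurable_dyadicIndex q.1 (measurableSet_singleton q.2)

theorem mem_dyadicCube_self (n : ℤ) (x : Eucl d) : x ∈ dyadicCube (n, dyadicIndex n x) := rfl

/-- Since `⌊a / m⌋ = ⌊a⌋ / m` with integer division on the right, a fine index determines every
coarser one. This is the nesting of dyadic cubes. -/
theorem dyadicIndex_eq_of_le {m n : ℤ} (hmn : m ≤ n) {x y : Eucl d}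
    (h : dyadicIndex n x = dyadicIndex n y) : dyadicIndex m x = dyadicIndex m y := by
  obtain ⟨k, rfl⟩ := Int.le.dest hmn
  have key : ∀ z : Eucl d, ∀ i, dyadicIndex m z i = dyadicIndex (m + k) z i / ((2 ^ k : ℕ) : ℤ) := by
    intro z i
    have h2 : ((2 ^ k : ℕ) : ℝ) ≠ 0 := by positivity
    unfold dyadicIndex
    rw [← Int.floor_div_natCast]
    congr 1
    rw [zpow_add₀ two_ne_zero]
    push_cast
    rw [zpow_natCast]
    field_simp
  funext i
  rw [key, key, h]

theorem volume_dyadicCube (q : ℤ × (Fin d → ℤ)) :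
    volume (dyadicCube q) = ENNReal.ofReal ((2 ^ (-q.1)) ^ d) := by
  have hpos : (0 : ℝ) < 2 ^ q.1 := by positivity
  have h1 : dyadicCube q = (@WithLp.ofLp 2 (Fin d → ℝ)) ⁻¹'
      (Set.univ.pi fun i => Set.Ico ((q.2 i : ℝ) * 2 ^ (-q.1)) (((q.2 i : ℝ) + 1) * 2 ^ (-q.1))) := by
    ext y
    simp only [dyadicCube, Set.mem_ofPred_eq, Set.mem_preimage, Set.mem_pi, Set.mem_univ,
      true_imp_iff, Set.mem_Ico, funext_iff, dyadicIndex, Int.floor_eq_iff, zpow_neg]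
    refine forall_congr' fun i => ?_
    rw [← div_eq_mul_inv, ← div_eq_mul_inv, div_le_iff₀ hpos, lt_div_iff₀ hpos]
  rw [h1, (PiLp.volume_preserving_ofLp (Fin d)).measure_preimage
    (MeasurableSet.univ_pi fun i => measurableSet_Ico).nullMeasurableSet, Real.volume_pi_Ico]
  have : ∀ i, ((q.2 i : ℝ) + 1) * 2 ^ (-q.1) - (q.2 i : ℝ) * 2 ^ (-q.1) = 2 ^ (-q.1) := by
    intro i; ring
  simp only [this, Finset.prod_const, Finset.card_univ, Fintype.card_fin]
  rw [ENNReal.ofReal_pow (by positivity)]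

theorem volume_dyadicCube_pos (q : ℤ × (Fin d → ℤ)) : volume (dyadicCube q) ≠ 0 := by
  rw [volume_dyadicCube]
  have : (0 : ℝ) < (2 ^ (-q.1)) ^ d := by positivity
  simpa using this

theorem volume_dyadicCube_ne_top (q : ℤ × (Fin d → ℤ)) : volume (dyadicCube q) ≠ ∞ := by
  rw [volume_dyadicCube]; exact ENNReal.ofReal_ne_top

/-- The Euclidean norm is at most the sum of the coordinates, hence the crude factor `d`. The same
length is later the scale in Hörmander's condition. -/
theorem norm_sub_le_of_mem_dyadicCube {q : ℤ × (Fin d → ℤ)} {x y : Eucl d}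
    (hx : x ∈ dyadicCube q) (hy : y ∈ dyadicCube q) : ‖x - y‖ ≤ d * 2 ^ (-q.1) := by
  have hpos : (0 : ℝ) < 2 ^ q.1 := by positivity
  have hc : ∀ i, |x i - y i| ≤ 2 ^ (-q.1) := by
    intro i
    have h1 : ⌊x i * 2 ^ q.1⌋ = ⌊y i * 2 ^ q.1⌋ := congrFun (hx.trans hy.symm) i
    have h2 := Int.abs_sub_lt_one_of_floor_eq_floor h1
    rw [← sub_mul, abs_mul, abs_of_pos hpos] at h2
    rw [zpow_neg, ← one_div, le_div_iff₀ hpos]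
    exact h2.le
  calc ‖x - y‖ ≤ ∑ i, |x i - y i| := by
        rw [EuclideanSpace.norm_eq]
        refine Real.sqrt_le_iff.2 ⟨Finset.sum_nonneg fun i _ => abs_nonneg _, ?_⟩
        have := Finset.sum_sq_le_sq_sum_of_nonneg (s := Finset.univ)
          (f := fun i => |x i - y i|) (fun i _ => abs_nonneg _)
        simpa using this
    _ ≤ ∑ _i : Fin d, (2 : ℝ) ^ (-q.1) := Finset.sum_le_sum fun i _ => hc i
    _ = d * 2 ^ (-q.1) := by simp

/-- The average of `φ` over the dyadic cube of generation `n` containing `x`. -/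
def dyadicAverage (φ : Eucl d → ℝ≥0∞) (n : ℤ) (x : Eucl d) : ℝ≥0∞ :=
  (∫⁻ y in dyadicCube (n, dyadicIndex n x), φ y) / volume (dyadicCube (n, dyadicIndex n x))

/-- The dyadic maximal function. -/
def dyadicMaximal (φ : Eucl d → ℝ≥0∞) (x : Eucl d) : ℝ≥0∞ := ⨆ n, dyadicAverage φ n x

theorem measurable_dyadicAverage (φ : Eucl d → ℝ≥0∞) (n : ℤ) :
    Measurable (dyadicAverage φ n) := by
  have : Measurable (fun k : Fin d → ℤ =>
    (∫⁻ y in dyadicCube (n, k), φ y) / volume (dyadicCube (n, k))) := measurable_of_countable _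
  exact this.comp (measurable_dyadicIndex n)

theorem measurable_dyadicMaximal (φ : Eucl d → ℝ≥0∞) : Measurable (dyadicMaximal φ) :=
  Measurable.iSup fun n => measurable_dyadicAverage φ n

theorem dyadicAverage_eq_of_mem {φ : Eucl d → ℝ≥0∞} {n : ℤ} {k : Fin d → ℤ} {x : Eucl d}
    (hx : x ∈ dyadicCube (n, k)) :
    dyadicAverage φ n x = (∫⁻ y in dyadicCube (n, k), φ y) / volume (dyadicCube (n, k)) := by
  have : dyadicIndex n x = k := hx
  rw [dyadicAverage, this]

/-- The index of a cube on which the average of `φ` exceeds `t` for the first time, going from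
large cubes to small ones. -/
def selectedCubes (φ : Eucl d → ℝ≥0∞) (t : ℝ≥0∞) : Set (ℤ × (Fin d → ℤ)) :=
  {q | ∃ x ∈ dyadicCube q, t < dyadicAverage φ q.1 x ∧ ∀ m < q.1, dyadicAverage φ m x ≤ t}

/-- By nesting, averages of generation at most `q.1` are constant on the cube, so the stopping
condition passes from one of its points to all. -/
theorem selectedCubes_mem_iff {φ : Eucl d → ℝ≥0∞} {t : ℝ≥0∞} {q : ℤ × (Fin d → ℤ)}
    (hq : q ∈ selectedCubes φ t) {y : Eucl d} (hy : y ∈ dyadicCube q) :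
    t < dyadicAverage φ q.1 y ∧ ∀ m < q.1, dyadicAverage φ m y ≤ t := by
  obtain ⟨x, hx, h1, h2⟩ := hq
  have hxy : dyadicIndex q.1 y = dyadicIndex q.1 x := hy.trans hx.symm
  refine ⟨by rwa [dyadicAverage, hxy], fun m hm => ?_⟩
  have := h2 m hm
  rwa [dyadicAverage, dyadicIndex_eq_of_le hm.le hxy]

theorem dyadicAverage_le {φ : Eucl d → ℝ≥0∞} (n : ℤ) (x : Eucl d) :
    dyadicAverage φ n x ≤ (∫⁻ y, φ y) * ENNReal.ofReal ((2 ^ n) ^ d) := by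
  have hpos : (0 : ℝ) < 2 ^ n := by positivity
  rw [dyadicAverage, volume_dyadicCube, ENNReal.div_eq_inv_mul, mul_comm,
    ← ENNReal.ofReal_inv_of_pos (by positivity)]
  refine mul_le_mul' (setLIntegral_le_lintegral _ _) (ENNReal.ofReal_le_ofReal (le_of_eq ?_))
  simp

/-- As `m → -∞` the volume of the cubes tends to infinity, the dimension being positive, while the
integral of `φ` stays bounded. -/
theorem exists_forall_dyadicAverage_le (hd : d ≠ 0) {φ : Eucl d → ℝ≥0∞} (hφ : ∫⁻ y, φ y ≠ ∞)
    {t : ℝ≥0∞} (ht : t ≠ 0) (x : Eucl d) : ∃ m₀ : ℤ, ∀ m ≤ m₀, dyadicAverage φ m x ≤ t := by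
  have h1 : Filter.Tendsto (fun k : ℕ => (∫⁻ y, φ y) * ENNReal.ofReal ((1 / 2 : ℝ) ^ k))
      Filter.atTop (nhds ((∫⁻ y, φ y) * ENNReal.ofReal 0)) :=
    ENNReal.Tendsto.const_mul (ENNReal.tendsto_ofReal
      (tendsto_pow_atTop_nhds_zero_of_lt_one (by norm_num) (by norm_num))) (Or.inr hφ)
  simp only [ENNReal.ofReal_zero, mul_zero] at h1
  obtain ⟨k, hk⟩ := (h1.eventually_le_const (pos_iff_ne_zero.2 ht)).exists
  refine ⟨-k, fun m hm => (dyadicAverage_le m x).trans (le_trans ?_ hk)⟩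
  gcongr
  have h2 : (2 : ℝ) ^ m ≤ (1 / 2) ^ k := by
    calc (2 : ℝ) ^ m ≤ 2 ^ (-k : ℤ) := zpow_le_zpow_right₀ (by norm_num) hm
      _ = (1 / 2) ^ k := by simp
  calc ((2 : ℝ) ^ m) ^ d ≤ ((2 : ℝ) ^ m) ^ 1 := by
        refine pow_le_pow_of_le_one (by positivity) ?_ (Nat.one_le_iff_ne_zero.2 hd)
        exact h2.trans (pow_le_one₀ (by norm_num) (by norm_num))
    _ ≤ (1 / 2) ^ k := by rwa [pow_one]

/-- Large cubes around `x` have average at most `t`, so if some average exceeds `t` there is a least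
generation at which this happens, and its cube is selected. -/
theorem setOf_lt_dyadicMaximal (hd : d ≠ 0) {φ : Eucl d → ℝ≥0∞} (hφ : ∫⁻ y, φ y ≠ ∞)
    {t : ℝ≥0∞} (ht : t ≠ 0) :
    {x | t < dyadicMaximal φ x} = ⋃ q : selectedCubes φ t, dyadicCube q.1 := by
  ext x
  simp only [Set.mem_ofPred_eq, Set.mem_iUnion, dyadicMaximal, lt_iSup_iff]
  constructor
  · rintro ⟨n, hn⟩
    obtain ⟨m₀, hm₀⟩ := exists_forall_dyadicAverage_le hd hφ ht x
    obtain ⟨N, hN, hmin⟩ := Int.exists_least_of_bdd (P := fun n => t < dyadicAverage φ n x)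
      ⟨m₀, fun z hz => by
        by_contra hlt
        exact absurd hz (not_lt.2 (hm₀ z (by omega)))⟩ ⟨n, hn⟩
    refine ⟨⟨(N, dyadicIndex N x), x, mem_dyadicCube_self N x, hN, fun m hm => ?_⟩,
      mem_dyadicCube_self N x⟩
    by_contra hlt
    exact absurd (hmin m (not_le.1 hlt)) (not_le.2 hm)
  · rintro ⟨q, hq⟩
    exact ⟨_, (selectedCubes_mem_iff q.2 hq).1⟩

/-- If two selected cubes share a point, the one of smaller generation would contradict the
minimality of the other; so the generations agree, and then the cubes do. -/
theorem pairwise_disjoint_selectedCubes (φ : Eucl d → ℝ≥0∞) (t : ℝ≥0∞) :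
    Pairwise (Function.onFun Disjoint fun q : selectedCubes φ t => dyadicCube q.1) := by
  intro q r hqr
  rw [Function.onFun, Set.disjoint_left]
  intro x hxq hxr
  apply hqr
  have h1 := selectedCubes_mem_iff q.2 hxq
  have h2 := selectedCubes_mem_iff r.2 hxr
  have hn : q.1.1 = r.1.1 := by
    rcases lt_trichotomy q.1.1 r.1.1 with h | h | h
    · exact absurd h1.1 (not_lt.2 (h2.2 _ h))
    · exact h
    · exact absurd h2.1 (not_lt.2 (h1.2 _ h))
  have hk : q.1.2 = r.1.2 := by
    have a : dyadicIndex q.1.1 x = q.1.2 := hxq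
    have b : dyadicIndex r.1.1 x = r.1.2 := hxr
    rw [← a, ← b, hn]
  exact Subtype.ext (Prod.ext hn hk)

theorem nonempty_of_mem_selectedCubes {φ : Eucl d → ℝ≥0∞} {t : ℝ≥0∞} {q : ℤ × (Fin d → ℤ)}
    (hq : q ∈ selectedCubes φ t) : (dyadicCube q).Nonempty := by
  obtain ⟨x, hx, -⟩ := hq
  exact ⟨x, hx⟩

theorem mul_volume_le_of_mem_selectedCubes {φ : Eucl d → ℝ≥0∞} {t : ℝ≥0∞}
    {q : ℤ × (Fin d → ℤ)} (hq : q ∈ selectedCubes φ t) :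
    t * volume (dyadicCube q) ≤ ∫⁻ y in dyadicCube q, φ y := by
  obtain ⟨x, hx⟩ := nonempty_of_mem_selectedCubes hq
  have h1 := (selectedCubes_mem_iff hq hx).1
  rw [dyadicAverage_eq_of_mem (k := q.2) hx,
    ENNReal.lt_div_iff_mul_lt (Or.inl (volume_dyadicCube_pos _))
      (Or.inl (volume_dyadicCube_ne_top _))] at h1
  exact h1.le

/-- The parent cube, of generation `q.1 - 1`, has average at most `t` and `2 ^ d` times the volume.
-/
theorem setLIntegral_le_of_mem_selectedCubes {φ : Eucl d → ℝ≥0∞} {t : ℝ≥0∞}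
    {q : ℤ × (Fin d → ℤ)} (hq : q ∈ selectedCubes φ t) :
    ∫⁻ y in dyadicCube q, φ y ≤ 2 ^ d * t * volume (dyadicCube q) := by
  obtain ⟨x, hx⟩ := nonempty_of_mem_selectedCubes hq
  have h1 := (selectedCubes_mem_iff hq hx).2 (q.1 - 1) (by omega)
  rw [dyadicAverage, ENNReal.div_le_iff_le_mul (Or.inl (volume_dyadicCube_pos _))
    (Or.inl (volume_dyadicCube_ne_top _)), volume_dyadicCube] at h1
  have hsub : dyadicCube q ⊆ dyadicCube (q.1 - 1, dyadicIndex (q.1 - 1) x) := by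
    intro y hy
    exact dyadicIndex_eq_of_le (by omega) (hy.trans hx.symm)
  refine (lintegral_mono_set hsub).trans (h1.trans (le_of_eq ?_))
  rw [volume_dyadicCube, mul_comm (2 ^ d) t, mul_assoc]
  congr 1
  have : (2 : ℝ) ^ (-(q.1 - 1)) = 2 * 2 ^ (-q.1) := by
    rw [neg_sub, sub_eq_add_neg, zpow_add₀ two_ne_zero, zpow_one]
  simp only [this, mul_pow]
  rw [ENNReal.ofReal_mul (by positivity), ENNReal.ofReal_pow (by norm_num)]
  simp

theorem setLIntegral_setOf_lt_dyadicMaximal_eq_tsum (hd : d ≠ 0) {φ : Eucl d → ℝ≥0∞}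
    (hφ : ∫⁻ y, φ y ≠ ∞) {t : ℝ≥0∞} (ht : t ≠ 0) (g : Eucl d → ℝ≥0∞) :
    ∫⁻ x in {x | t < dyadicMaximal φ x}, g x =
      ∑' q : selectedCubes φ t, ∫⁻ x in dyadicCube q.1, g x := by
  rw [setOf_lt_dyadicMaximal hd hφ ht]
  exact lintegral_iUnion (fun q => measurableSet_dyadicCube _)
    (pairwise_disjoint_selectedCubes φ t) _

theorem volume_setOf_lt_dyadicMaximal_eq_tsum (hd : d ≠ 0) {φ : Eucl d → ℝ≥0∞}
    (hφ : ∫⁻ y, φ y ≠ ∞) {t : ℝ≥0∞} (ht : t ≠ 0) :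
    volume {x | t < dyadicMaximal φ x} =
      ∑' q : selectedCubes φ t, volume (dyadicCube q.1) := by
  rw [setOf_lt_dyadicMaximal hd hφ ht]
  exact measure_iUnion (pairwise_disjoint_selectedCubes φ t) (fun q => measurableSet_dyadicCube _)

/-- The weak type `(1,1)` inequality for the dyadic maximal function. -/
theorem mul_volume_setOf_lt_dyadicMaximal_le (hd : d ≠ 0) {φ : Eucl d → ℝ≥0∞}
    (hφ : ∫⁻ y, φ y ≠ ∞) {t : ℝ≥0∞} (ht : t ≠ 0) :
    t * volume {x | t < dyadicMaximal φ x} ≤ ∫⁻ y, φ y := by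
  rw [volume_setOf_lt_dyadicMaximal_eq_tsum hd hφ ht, ← ENNReal.tsum_mul_left]
  calc ∑' q : selectedCubes φ t, t * volume (dyadicCube q.1)
      ≤ ∑' q : selectedCubes φ t, ∫⁻ x in dyadicCube q.1, φ x :=
        ENNReal.tsum_le_tsum fun q => mul_volume_le_of_mem_selectedCubes q.2
    _ = ∫⁻ x in {x | t < dyadicMaximal φ x}, φ x :=
        (setLIntegral_setOf_lt_dyadicMaximal_eq_tsum hd hφ ht φ).symm
    _ ≤ ∫⁻ y, φ y := setLIntegral_le_lintegral _ _

/-- Summed over the selected cubes, the parent bound controls the mass of `φ` on the superlevel set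
by its measure. The bad part is thereby estimated through the distribution function of the maximal
function alone. -/
theorem setLIntegral_setOf_lt_dyadicMaximal_le (hd : d ≠ 0) {φ : Eucl d → ℝ≥0∞}
    (hφ : ∫⁻ y, φ y ≠ ∞) {t : ℝ≥0∞} (ht : t ≠ 0) :
    ∫⁻ x in {x | t < dyadicMaximal φ x}, φ x ≤
      2 ^ d * t * volume {x | t < dyadicMaximal φ x} := by
  rw [volume_setOf_lt_dyadicMaximal_eq_tsum hd hφ ht, ← ENNReal.tsum_mul_left,
    setLIntegral_setOf_lt_dyadicMaximal_eq_tsum hd hφ ht φ]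
  exact ENNReal.tsum_le_tsum fun q => setLIntegral_le_of_mem_selectedCubes q.2

theorem dyadicMaximal_le {φ : Eucl d → ℝ≥0∞} {c : ℝ≥0∞} (h : ∀ y, φ y ≤ c) (x : Eucl d) :
    dyadicMaximal φ x ≤ c := by
  refine iSup_le fun n => ?_
  rw [dyadicAverage, ENNReal.div_le_iff_le_mul (Or.inl (volume_dyadicCube_pos _))
    (Or.inl (volume_dyadicCube_ne_top _))]
  calc ∫⁻ y in dyadicCube (n, dyadicIndex n x), φ y
      ≤ ∫⁻ _y in dyadicCube (n, dyadicIndex n x), c := lintegral_mono fun y => h y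
    _ = _ := by simp

theorem dyadicMaximal_add_le {φ ψ : Eucl d → ℝ≥0∞} (hφ : Measurable φ) (x : Eucl d) :
    dyadicMaximal (fun y => φ y + ψ y) x ≤ dyadicMaximal φ x + dyadicMaximal ψ x := by
  refine iSup_le fun n => ?_
  rw [dyadicAverage, lintegral_add_left hφ, ENNReal.add_div]
  exact add_le_add (le_iSup (fun n => dyadicAverage φ n x) n)
    (le_iSup (fun n => dyadicAverage ψ n x) n)

/-- The dyadic maximal function dominates a continuous function. -/
theorem le_dyadicMaximal {φ : Eucl d → ℝ≥0∞} (hφ : Continuous φ) (x : Eucl d) :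
    φ x ≤ dyadicMaximal φ x := by
  refine le_of_forall_lt fun c hc => ?_
  obtain ⟨c', hcc', hc'⟩ := exists_between hc
  -- By continuity `φ > c'` on a ball around `x`, and that ball contains every sufficiently small
  -- dyadic cube through `x`.
  obtain ⟨ε, hε, hball⟩ := Metric.eventually_nhds_iff.1 (hφ.continuousAt.eventually_const_lt hc')
  have h1 : Filter.Tendsto (fun k : ℕ => (d : ℝ) * (1 / 2 : ℝ) ^ k)
      Filter.atTop (nhds (d * 0)) :=
    (tendsto_pow_atTop_nhds_zero_of_lt_one (by norm_num) (by norm_num)).const_mul _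
  rw [mul_zero] at h1
  obtain ⟨k, hk⟩ := (h1.eventually_lt_const hε).exists
  refine hcc'.trans_le (le_trans ?_ (le_iSup (fun n => dyadicAverage φ n x) (k : ℤ)))
  rw [dyadicAverage, ENNReal.le_div_iff_mul_le (Or.inl (volume_dyadicCube_pos _))
    (Or.inl (volume_dyadicCube_ne_top _)), ← setLIntegral_const]
  refine setLIntegral_mono' (measurableSet_dyadicCube _) fun y hy => (hball ?_).le
  rw [dist_eq_norm]
  refine (norm_sub_le_of_mem_dyadicCube hy (mem_dyadicCube_self _ x)).trans_lt ?_
  simpa using hk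

end Dyadic

/-! ### Layer cake formulas -/

theorem lintegral_rpow_eq_layercake {α : Type*} [MeasurableSpace α] (μ : Measure α)
    {f : α → ℝ≥0∞} (hf : Measurable f) (hfin : ∀ x, f x ≠ ∞) {q : ℝ} (hq : 0 < q) :
    ∫⁻ x, f x ^ q ∂μ = ENNReal.ofReal q *
      ∫⁻ t in Set.Ioi (0 : ℝ), μ {x | ENNReal.ofReal t < f x} * ENNReal.ofReal (t ^ (q - 1)) := by
  have h := lintegral_rpow_eq_lintegral_meas_lt_mul μ (f := fun x => (f x).toReal)
    (ae_of_all _ fun x => ENNReal.toReal_nonneg) hf.ennreal_toReal.aemeasurable hq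
  have h1 : ∀ x, ENNReal.ofReal ((f x).toReal ^ q) = f x ^ q := fun x => by
    rw [← ENNReal.ofReal_rpow_of_nonneg ENNReal.toReal_nonneg hq.le, ENNReal.ofReal_toReal (hfin x)]
  simp only [h1] at h
  rw [h]
  congr 1
  refine setLIntegral_congr_fun measurableSet_Ioi fun t ht => ?_
  congr 2
  ext x
  simp only [Set.mem_ofPred_eq]
  rw [ENNReal.ofReal_lt_iff_lt_toReal (le_of_lt ht) (hfin x)]

theorem setLIntegral_Ici_rpow_neg {a s : ℝ} (ha : 0 < a) (hs : 0 < s) :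
    ∫⁻ t in Set.Ioi a, ENNReal.ofReal (t ^ (-s - 1)) = ENNReal.ofReal (a ^ (-s) / s) := by
  rw [← ofReal_integral_eq_lintegral_ofReal (integrableOn_Ioi_rpow_of_lt (by linarith) ha),
    integral_Ioi_rpow_of_lt (by linarith) ha]
  · congr 1
    rw [show -s - 1 + 1 = -s by ring]
    field_simp
  · filter_upwards [ae_restrict_mem measurableSet_Ioi] with t ht
    exact Real.rpow_nonneg (ha.trans ht).le _

/-- By Tonelli the inner integral is that of `t ^ (-s - 1)` over `t ≥ f x`, which equals `f x ^ (-s)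
/ s`. It is the layer cake formula for a negative power. Where `f x = 0` the right side is infinite,
and where `f x = ∞` the left side vanishes. -/
theorem lintegral_meas_le_mul_rpow_neg_le {α : Type*} [MeasurableSpace α] (μ : Measure α)
    [SFinite μ] {f : α → ℝ≥0∞} (hf : Measurable f) {s : ℝ} (hs : 0 < s) :
    ∫⁻ t in Set.Ioi (0 : ℝ), μ {x | f x ≤ ENNReal.ofReal t} * ENNReal.ofReal (t ^ (-s - 1)) ≤
      (ENNReal.ofReal s)⁻¹ * ∫⁻ x, f x ^ (-s) ∂μ := by
  have hmeas : MeasurableSet {z : ℝ × α | f z.2 ≤ ENNReal.ofReal z.1} :=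
    measurableSet_le (hf.comp measurable_snd) (ENNReal.measurable_ofReal.comp measurable_fst)
  have hpow : Measurable fun t : ℝ => ENNReal.ofReal (t ^ (-s - 1)) := by fun_prop
  have h1 : ∀ t : ℝ, μ {x | f x ≤ ENNReal.ofReal t} * ENNReal.ofReal (t ^ (-s - 1)) =
      ∫⁻ x, {z : ℝ × α | f z.2 ≤ ENNReal.ofReal z.1}.indicator
        (fun z => ENNReal.ofReal (z.1 ^ (-s - 1))) (t, x) ∂μ := by
    intro t
    have h2 : MeasurableSet {x | f x ≤ ENNReal.ofReal t} := measurableSet_le hf measurable_const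
    have h3 : ∀ x, {z : ℝ × α | f z.2 ≤ ENNReal.ofReal z.1}.indicator
        (fun z => ENNReal.ofReal (z.1 ^ (-s - 1))) (t, x) =
        {x | f x ≤ ENNReal.ofReal t}.indicator (fun _ => ENNReal.ofReal (t ^ (-s - 1))) x := by
      intro x; simp [Set.indicator]
    simp only [h3]
    rw [lintegral_indicator_const h2, mul_comm]
  simp only [h1]
  have hae : Measurable fun z : ℝ × α => {z : ℝ × α | f z.2 ≤ ENNReal.ofReal z.1}.indicator
      (fun z => ENNReal.ofReal (z.1 ^ (-s - 1))) (z.1, z.2) :=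
    (hpow.comp measurable_fst).indicator hmeas
  rw [lintegral_lintegral_swap (f := fun t x => {z : ℝ × α | f z.2 ≤ ENNReal.ofReal z.1}.indicator
      (fun z => ENNReal.ofReal (z.1 ^ (-s - 1))) (t, x)) hae.aemeasurable,
    ← lintegral_const_mul' _ _ (by simpa using hs)]
  refine lintegral_mono fun x => ?_
  rcases eq_or_ne (f x) 0 with h0 | h0
  · rw [h0, ENNReal.zero_rpow_of_neg (by linarith)]
    simp [ENNReal.mul_top]
  rcases eq_or_ne (f x) ∞ with htop | htop
  · simp [Set.indicator, htop]
  set a := (f x).toReal with ha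
  have hapos : 0 < a := ENNReal.toReal_pos h0 htop
  have hfa : f x = ENNReal.ofReal a := (ENNReal.ofReal_toReal htop).symm
  calc ∫⁻ t in Set.Ioi (0 : ℝ), {z : ℝ × α | f z.2 ≤ ENNReal.ofReal z.1}.indicator
        (fun z => ENNReal.ofReal (z.1 ^ (-s - 1))) (t, x)
      ≤ ∫⁻ t, (Set.Ici a).indicator (fun t => ENNReal.ofReal (t ^ (-s - 1))) t := by
        rw [← lintegral_indicator measurableSet_Ioi]
        refine lintegral_mono fun t => ?_
        by_cases ht : 0 < t
        · simp only [Set.indicator, Set.mem_Ioi, ht, if_true, Set.mem_ofPred_eq, hfa,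
            ENNReal.ofReal_le_ofReal_iff ht.le, Set.mem_Ici, le_refl]
        · simp [Set.indicator, ht]
    _ = ENNReal.ofReal (a ^ (-s) / s) := by
        rw [lintegral_indicator measurableSet_Ici, ← setLIntegral_Ici_rpow_neg hapos hs]
        exact setLIntegral_congr Ioi_ae_eq_Ici.symm
    _ = (ENNReal.ofReal s)⁻¹ * f x ^ (-s) := by
        rw [div_eq_inv_mul, ENNReal.ofReal_mul (by positivity), ENNReal.ofReal_inv_of_pos hs, hfa,
          ENNReal.ofReal_rpow_of_pos hapos]
    _ ≤ _ := le_rfl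

/-! ### The maximal theorem -/

section Maximal

variable {d : ℕ}

/-- Cut `φ` at height `t / 2`. The lower part has maximal function at most `t / 2`, so the upper
part must have maximal function above `t / 2`, and the weak type inequality applies to it. The mass
of the upper part is written as the measure of a superlevel set of `2 * φ` for `φ dx`, ready for a
second layer cake formula. -/
theorem volume_setOf_lt_dyadicMaximal_le (hd : d ≠ 0) {φ : Eucl d → ℝ≥0∞} (hm : Measurable φ)
    (hφ : ∫⁻ y, φ y ≠ ∞) {t : ℝ} (ht : 0 < t) :
    volume {x | ENNReal.ofReal t < dyadicMaximal φ x} ≤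
      2 * (ENNReal.ofReal t)⁻¹ * (volume.withDensity φ) {x | ENNReal.ofReal t < 2 * φ x} := by
  set S := {x | ENNReal.ofReal t < 2 * φ x} with hS
  have hSm : MeasurableSet S := measurableSet_lt measurable_const (hm.const_mul 2)
  set φ₁ := S.indicator φ
  set φ₂ := Sᶜ.indicator φ
  have hsum : φ = fun y => φ₁ y + φ₂ y := (Set.indicator_self_add_compl S φ).symm
  have ht2 : ENNReal.ofReal t = ENNReal.ofReal (t / 2) + ENNReal.ofReal (t / 2) := by
    rw [← ENNReal.ofReal_add (by positivity) (by positivity)]; ring_nf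
  have hφ₂ : ∀ y, φ₂ y ≤ ENNReal.ofReal (t / 2) := by
    intro y
    by_cases hy : y ∈ S
    · simp [φ₂, hy]
    · simp only [φ₂, Set.indicator_of_mem (Set.mem_compl hy)]
      have h1 : 2 * φ y ≤ ENNReal.ofReal t := not_lt.1 hy
      rw [ENNReal.ofReal_div_of_pos (by norm_num), ENNReal.le_div_iff_mul_le (by simp) (by simp)]
      simpa [mul_comm] using h1
  have hφ₁ : ∫⁻ y, φ₁ y ≠ ∞ :=
    ne_top_of_le_ne_top hφ (lintegral_mono fun y => Set.indicator_le_self _ _ _)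
  have hpos : ENNReal.ofReal (t / 2) ≠ 0 := by simpa using ht
  have hsub : {x | ENNReal.ofReal t < dyadicMaximal φ x} ⊆
      {x | ENNReal.ofReal (t / 2) < dyadicMaximal φ₁ x} := by
    intro x hx
    simp only [Set.mem_ofPred_eq] at hx ⊢
    by_contra hcon
    refine absurd hx (not_lt.2 ?_)
    rw [hsum, ht2]
    exact (dyadicMaximal_add_le (hm.indicator hSm) x).trans
      (add_le_add (not_lt.1 hcon) (dyadicMaximal_le hφ₂ x))
  have h1 := mul_volume_setOf_lt_dyadicMaximal_le hd hφ₁ hpos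
  rw [lintegral_indicator hSm, ← withDensity_apply _ hSm] at h1
  refine (measure_mono hsub).trans ?_
  have h3 : volume {x | ENNReal.ofReal (t / 2) < dyadicMaximal φ₁ x} ≤
      (ENNReal.ofReal (t / 2))⁻¹ * (volume.withDensity φ) S := by
    rw [mul_comm, ← div_eq_mul_inv, ENNReal.le_div_iff_mul_le (Or.inl hpos) (by simp), mul_comm]
    exact h1
  refine h3.trans (le_of_eq ?_)
  congr 1
  rw [ENNReal.ofReal_div_of_pos (by norm_num), ENNReal.inv_div (by simp) (by simp)]
  simp [div_eq_mul_inv]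

/-- The `L^p` inequality for the dyadic maximal function. -/
theorem lintegral_dyadicMaximal_rpow_le (hd : d ≠ 0) {φ : Eucl d → ℝ≥0∞} (hm : Measurable φ)
    (hφ : ∫⁻ y, φ y ≠ ∞) {B : ℝ≥0∞} (hB : B ≠ ∞) (hφB : ∀ y, φ y ≤ B) {p : ℝ} (hp : 1 < p) :
    ∫⁻ x, dyadicMaximal φ x ^ p ≤
      ENNReal.ofReal p * (2 * ((ENNReal.ofReal (p - 1))⁻¹ * 2 ^ (p - 1))) * ∫⁻ x, φ x ^ p := by
  have hM : ∀ x, dyadicMaximal φ x ≠ ∞ := fun x => ne_top_of_le_ne_top hB (dyadicMaximal_le hφB x)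
  have hfin : ∀ x, φ x ≠ ∞ := fun x => ne_top_of_le_ne_top hB (hφB x)
  rw [lintegral_rpow_eq_layercake volume (measurable_dyadicMaximal φ) hM (by linarith : 0 < p),
    mul_assoc]
  gcongr
  have hp1 : (0 : ℝ) < p - 1 := by linarith
  -- The weak estimate turns the weight `t ^ (p - 1)` into `t ^ (p - 2)`. What remains is the layer
  -- cake integral of `2 * φ` with exponent `p - 1` for the measure `φ dx`, that is, a multiple of
  -- `∫ φ ^ p`.
  have h2 := lintegral_rpow_eq_layercake (volume.withDensity φ) (hm.const_mul 2)
    (fun x => ENNReal.mul_ne_top (by simp) (hfin x)) hp1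
  have h3 : ∫⁻ x, (2 * φ x) ^ (p - 1) ∂(volume.withDensity φ) = 2 ^ (p - 1) * ∫⁻ x, φ x ^ p := by
    rw [lintegral_withDensity_eq_lintegral_mul _ hm ((hm.const_mul 2).pow_const _),
      ← lintegral_const_mul _ (hm.pow_const _)]
    refine lintegral_congr fun x => ?_
    simp only [Pi.mul_apply]
    rw [ENNReal.mul_rpow_of_nonneg _ _ hp1.le, mul_left_comm]
    congr 1
    calc φ x * φ x ^ (p - 1) = φ x ^ (1 : ℝ) * φ x ^ (p - 1) := by rw [ENNReal.rpow_one]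
      _ = φ x ^ p := by
        rw [← ENNReal.rpow_add_of_nonneg _ _ zero_le_one hp1.le]; ring_nf
  calc ∫⁻ t in Set.Ioi (0 : ℝ), volume {x | ENNReal.ofReal t < dyadicMaximal φ x} *
        ENNReal.ofReal (t ^ (p - 1))
      ≤ ∫⁻ t in Set.Ioi (0 : ℝ), 2 * ((volume.withDensity φ) {x | ENNReal.ofReal t < 2 * φ x} *
        ENNReal.ofReal (t ^ (p - 1 - 1))) := by
        refine setLIntegral_mono' measurableSet_Ioi fun t ht => ?_
        have ht' : 0 < t := ht
        refine (mul_le_mul_left (volume_setOf_lt_dyadicMaximal_le hd hm hφ ht') _).trans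
          (le_of_eq ?_)
        rw [Real.rpow_sub_one ht'.ne' (p - 1), div_eq_inv_mul,
          ENNReal.ofReal_mul (by positivity), ENNReal.ofReal_inv_of_pos ht']
        ring
    _ = 2 * ((ENNReal.ofReal (p - 1))⁻¹ * 2 ^ (p - 1)) * ∫⁻ x, φ x ^ p := by
        rw [lintegral_const_mul' _ _ (by simp), mul_assoc, mul_assoc, ← h3, h2, ← mul_assoc _⁻¹,
          ENNReal.inv_mul_cancel (by simpa using hp1) (by simp), one_mul]

/-- A distributional inequality between `f` and `φ` implies an `L^p` inequality, `1 < p < 2`. -/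
theorem lintegral_rpow_le_of_distribution_le (hd : d ≠ 0) {φ f : Eucl d → ℝ≥0∞}
    (hc : Continuous φ) (hφ : ∫⁻ y, φ y ≠ ∞) {B : ℝ≥0∞} (hB : B ≠ ∞) (hφB : ∀ y, φ y ≤ B)
    (hf : Measurable f) (hfin : ∀ x, f x ≠ ∞) {C : ℝ≥0∞} (hC : C ≠ ∞) {p : ℝ} (hp : 1 < p)
    (hp2 : p < 2)
    (h : ∀ t : ℝ, 0 < t → volume {x | ENNReal.ofReal t < f x} ≤
      C * (ENNReal.ofReal (t ^ (-2 : ℝ)) *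
        (∫⁻ x in {x | dyadicMaximal φ x ≤ ENNReal.ofReal t}, φ x ^ (2 : ℝ)) +
        volume {x | ENNReal.ofReal t < dyadicMaximal φ x})) :
    ∫⁻ x, f x ^ p ≤ (C * (ENNReal.ofReal p * (ENNReal.ofReal (2 - p))⁻¹ +
      ENNReal.ofReal p * (2 * ((ENNReal.ofReal (p - 1))⁻¹ * 2 ^ (p - 1))))) * ∫⁻ x, φ x ^ p := by
  have hm := hc.measurable
  have hM : ∀ x, dyadicMaximal φ x ≠ ∞ := fun x => ne_top_of_le_ne_top hB (dyadicMaximal_le hφB x)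
  have hMm := measurable_dyadicMaximal φ
  have hp0 : (0 : ℝ) < p := by linarith
  set ν := (volume : Measure (Eucl d)).withDensity fun x => φ x ^ (2 : ℝ) with hν
  have hν1 : ∀ t : ℝ, ∫⁻ x in {x | dyadicMaximal φ x ≤ ENNReal.ofReal t}, φ x ^ (2 : ℝ) =
      ν {x | dyadicMaximal φ x ≤ ENNReal.ofReal t} := fun t =>
    (withDensity_apply _ (measurableSet_le hMm measurable_const)).symm
  have hmono : Measurable fun t : ℝ => ν {x | dyadicMaximal φ x ≤ ENNReal.ofReal t} := by
    refine Monotone.measurable fun s t hst => measure_mono fun x hx => ?_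
    exact le_trans hx (ENNReal.ofReal_le_ofReal hst)
  -- The truncated second moments are `ν`-measures of sublevel sets, `ν = φ² dx`. Integrated against
  -- `t ^ (p - 3)` they give at most `∫ φ² (Mφ) ^ (p - 2) / (2 - p)`; since `p < 2` and `φ ≤ Mφ`,
  -- this is at most `∫ φ ^ p / (2 - p)`.
  have hA : ∫⁻ t in Set.Ioi (0 : ℝ), ν {x | dyadicMaximal φ x ≤ ENNReal.ofReal t} *
      ENNReal.ofReal (t ^ (-(2 - p) - 1)) ≤ (ENNReal.ofReal (2 - p))⁻¹ * ∫⁻ x, φ x ^ p := by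
    refine (lintegral_meas_le_mul_rpow_neg_le ν hMm (by linarith : 0 < 2 - p)).trans ?_
    refine mul_le_mul' le_rfl ?_
    rw [hν, lintegral_withDensity_eq_lintegral_mul _ (hm.pow_const _) (hMm.pow_const _)]
    refine lintegral_mono fun x => ?_
    simp only [Pi.mul_apply]
    rcases eq_or_ne (φ x) 0 with h0 | h0
    · simp [h0]
    · calc φ x ^ (2 : ℝ) * dyadicMaximal φ x ^ (-(2 - p))
          ≤ φ x ^ (2 : ℝ) * φ x ^ (-(2 - p)) := by
            refine mul_le_mul' le_rfl ?_
            rw [ENNReal.rpow_neg, ENNReal.rpow_neg, ENNReal.inv_le_inv]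
            exact ENNReal.rpow_le_rpow (le_dyadicMaximal hc x) (by linarith)
        _ = φ x ^ p := by
            rw [← ENNReal.rpow_add _ _ h0 (ne_top_of_le_ne_top hB (hφB x))]; ring_nf
  have hmC : Measurable fun t : ℝ => C * (ν {x | dyadicMaximal φ x ≤ ENNReal.ofReal t} *
      ENNReal.ofReal (t ^ (-(2 - p) - 1))) := (hmono.mul (by fun_prop)).const_mul _
  have hBd := lintegral_rpow_eq_layercake volume hMm hM hp0
  have hmax := lintegral_dyadicMaximal_rpow_le hd hm hφ hB hφB hp
  rw [lintegral_rpow_eq_layercake volume hf hfin hp0]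
  calc ENNReal.ofReal p * ∫⁻ t in Set.Ioi (0 : ℝ), volume {x | ENNReal.ofReal t < f x} *
        ENNReal.ofReal (t ^ (p - 1))
      ≤ ENNReal.ofReal p * ∫⁻ t in Set.Ioi (0 : ℝ),
        (C * (ν {x | dyadicMaximal φ x ≤ ENNReal.ofReal t} * ENNReal.ofReal (t ^ (-(2 - p) - 1))) +
        C * (volume {x | ENNReal.ofReal t < dyadicMaximal φ x} * ENNReal.ofReal (t ^ (p - 1)))) := by
        refine mul_le_mul' le_rfl (setLIntegral_mono' measurableSet_Ioi fun t ht => ?_)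
        have ht' : 0 < t := ht
        refine (mul_le_mul_left (h t ht') _).trans (le_of_eq ?_)
        rw [hν1, show -(2 - p) - 1 = -2 + (p - 1) by ring, Real.rpow_add ht',
          ENNReal.ofReal_mul (by positivity)]
        ring
    _ = C * (ENNReal.ofReal p * (∫⁻ t in Set.Ioi (0 : ℝ),
          (ν {x | dyadicMaximal φ x ≤ ENNReal.ofReal t} * ENNReal.ofReal (t ^ (-(2 - p) - 1)))) +
          ∫⁻ x, dyadicMaximal φ x ^ p) := by
        rw [lintegral_add_left hmC, lintegral_const_mul' _ _ hC,
          lintegral_const_mul' _ _ hC, hBd]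
        ring
    _ ≤ C * (ENNReal.ofReal p * ((ENNReal.ofReal (2 - p))⁻¹ * ∫⁻ x, φ x ^ p) +
          ENNReal.ofReal p * (2 * ((ENNReal.ofReal (p - 1))⁻¹ * 2 ^ (p - 1))) * ∫⁻ x, φ x ^ p) := by
        gcongr
    _ = _ := by ring

end Maximal

/-! ### Singular integral operators with operator valued kernels -/

section Kernel

variable {d : ℕ} {H₁ H₂ : Type*} [NormedAddCommGroup H₁] [NormedSpace ℝ H₁]
  [NormedAddCommGroup H₂] [NormedSpace ℝ H₂]

/-- The convolution operator with an operator valued kernel. -/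
def kernelOp (K : Eucl d → H₁ →L[ℝ] H₂) (F : Eucl d → H₁) (x : Eucl d) : H₂ :=
  ∫ y, K (x - y) (F y)

/-- A continuous, qualitatively integrable kernel that satisfies Hörmander's condition with
constant `A`. -/
structure IsSingularKernel (K : Eucl d → H₁ →L[ℝ] H₂) (A : ℝ≥0) : Prop where
  continuous : Continuous K
  bound : ∃ M : ℝ, ∀ x, ‖K x‖ ≤ M * (1 + ‖x‖) ^ (-((d : ℝ) + 1))
  hormander : ∀ ℓ : ℝ, 0 < ℓ → ∀ v : Eucl d, ‖v‖ ≤ ℓ →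
    ∫⁻ w in {w | 2 * ℓ ≤ ‖w‖}, ‖K (w - v) - K w‖ₑ ≤ A

/-- The convolution operator with kernel `K` is bounded on `L^p` with constant `A`, on integrable
bounded functions. -/
def StrongType (K : Eucl d → H₁ →L[ℝ] H₂) (p : ℝ≥0∞) (A : ℝ≥0) : Prop :=
  ∀ F : Eucl d → H₁, Integrable F → MemLp F ∞ →
    eLpNorm (kernelOp K F) p volume ≤ A * eLpNorm F p volume

theorem IsSingularKernel.exists_norm_le {K : Eucl d → H₁ →L[ℝ] H₂} {A : ℝ≥0}
    (hK : IsSingularKernel K A) : ∃ M : ℝ, ∀ x, ‖K x‖ ≤ M := by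
  obtain ⟨M, hM⟩ := hK.bound
  have hM0 : 0 ≤ M := by simpa using (norm_nonneg _).trans (hM 0)
  refine ⟨M, fun x => (hM x).trans (mul_le_of_le_one_right hM0 ?_)⟩
  exact Real.rpow_le_one_of_one_le_of_nonpos (by linarith [norm_nonneg x])
    (by linarith [Nat.cast_nonneg (α := ℝ) d])

theorem aestronglyMeasurable_kernel_apply {K : Eucl d → H₁ →L[ℝ] H₂} (hK : Continuous K)
    {F : Eucl d → H₁} {μ : Measure (Eucl d)} (hF : AEStronglyMeasurable F μ) (x : Eucl d) :
    AEStronglyMeasurable (fun y => K (x - y) (F y)) μ :=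
  (ContinuousLinearMap.id ℝ (H₁ →L[ℝ] H₂)).aestronglyMeasurable_comp₂
    (hK.comp (continuous_const.sub continuous_id)).aestronglyMeasurable hF

theorem integrable_kernel_apply {K : Eucl d → H₁ →L[ℝ] H₂} (hK : Continuous K) {M : ℝ}
    (hM : ∀ x, ‖K x‖ ≤ M) {F : Eucl d → H₁} (hF : Integrable F) (x : Eucl d) :
    Integrable fun y => K (x - y) (F y) := by
  refine (hF.norm.const_mul M).mono' (aestronglyMeasurable_kernel_apply hK hF.1 x)
    (ae_of_all _ fun y => ?_)
  exact (ContinuousLinearMap.le_opNorm _ _).trans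
    (mul_le_mul_of_nonneg_right (hM _) (norm_nonneg _))

theorem continuous_kernelOp {K : Eucl d → H₁ →L[ℝ] H₂} (hK : Continuous K) {M : ℝ}
    (hM : ∀ x, ‖K x‖ ≤ M) {F : Eucl d → H₁} (hF : Integrable F) :
    Continuous (kernelOp K F) := by
  refine continuous_of_dominated (fun x => aestronglyMeasurable_kernel_apply hK hF.1 x)
    (fun x => ae_of_all _ fun y => ?_) (hF.norm.const_mul M) (ae_of_all _ fun y => ?_)
  · exact (ContinuousLinearMap.le_opNorm _ _).trans
      (mul_le_mul_of_nonneg_right (hM _) (norm_nonneg _))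
  · exact (hK.comp (continuous_id.sub continuous_const)).clm_apply continuous_const

theorem lintegral_enorm_rpow_eq_eLpNorm_rpow {α H : Type*} [MeasurableSpace α]
    [NormedAddCommGroup H] (μ : Measure α) (f : α → H) {p : ℝ} (hp : 0 < p) :
    ∫⁻ x, ‖f x‖ₑ ^ p ∂μ = eLpNorm f (ENNReal.ofReal p) μ ^ p := by
  rw [eLpNorm_eq_lintegral_rpow_enorm_toReal (by simpa using hp) (by simp),
    ENNReal.toReal_ofReal hp.le, ← ENNReal.rpow_mul, one_div, inv_mul_cancel₀ hp.ne',
    ENNReal.rpow_one]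

/-! ### The Calderón–Zygmund decomposition -/

/-- The mean of `F` over a dyadic cube. -/
def cubeMean (F : Eucl d → H₁) (q : ℤ × (Fin d → ℤ)) : H₁ := ⨍ y in dyadicCube q, F y

theorem enorm_cubeMean_mul_le (F : Eucl d → H₁) (q : ℤ × (Fin d → ℤ)) :
    ‖cubeMean F q‖ₑ * volume (dyadicCube q) ≤ ∫⁻ y in dyadicCube q, ‖F y‖ₑ := by
  have h0 : volume.real (dyadicCube q) ≠ 0 :=
    (ENNReal.toReal_pos (volume_dyadicCube_pos q) (volume_dyadicCube_ne_top q)).ne'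
  rw [cubeMean, setAverage_eq, enorm_smul, enorm_inv h0, mul_comm, ← mul_assoc]
  have h1 : ‖volume.real (dyadicCube q)‖ₑ = volume (dyadicCube q) := by
    rw [Real.enorm_of_nonneg measureReal_nonneg, ofReal_measureReal (volume_dyadicCube_ne_top q)]
  rw [h1, ENNReal.mul_inv_cancel (volume_dyadicCube_pos q) (volume_dyadicCube_ne_top q), one_mul]
  exact enorm_integral_le_lintegral_enorm _

theorem setIntegral_sub_cubeMean [CompleteSpace H₁] {F : Eucl d → H₁} (hF : Integrable F) (q : ℤ × (Fin d → ℤ)) :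
    ∫ y in dyadicCube q, (F y - cubeMean F q) = 0 := by
  have h0 : volume.real (dyadicCube q) ≠ 0 :=
    (ENNReal.toReal_pos (volume_dyadicCube_pos q) (volume_dyadicCube_ne_top q)).ne'
  rw [integral_sub hF.integrableOn (integrableOn_const (volume_dyadicCube_ne_top q)),
    setIntegral_const, cubeMean, setAverage_eq, smul_smul, mul_inv_cancel₀ h0, one_smul, sub_self]

theorem setLIntegral_enorm_sub_cubeMean_le {F : Eucl d → H₁} (hF : Continuous F)
    (q : ℤ × (Fin d → ℤ)) :
    ∫⁻ y in dyadicCube q, ‖F y - cubeMean F q‖ₑ ≤ 2 * ∫⁻ y in dyadicCube q, ‖F y‖ₑ := by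
  calc ∫⁻ y in dyadicCube q, ‖F y - cubeMean F q‖ₑ
      ≤ ∫⁻ y in dyadicCube q, (‖F y‖ₑ + ‖cubeMean F q‖ₑ) :=
        lintegral_mono fun y => enorm_sub_le
    _ = (∫⁻ y in dyadicCube q, ‖F y‖ₑ) + ‖cubeMean F q‖ₑ * volume (dyadicCube q) := by
        rw [lintegral_add_left hF.enorm.measurable, setLIntegral_const]
    _ ≤ _ := by
        rw [two_mul]; gcongr; exact enorm_cubeMean_mul_le F q

open Classical in
/-- The good part of the Calderón–Zygmund decomposition at height `t`. -/
def goodPart (F : Eucl d → H₁) (t : ℝ≥0∞) (y : Eucl d) : H₁ :=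
  if h : ∃ q : selectedCubes (fun x => ‖F x‖ₑ) t, y ∈ dyadicCube q.1 then cubeMean F h.choose.1
  else F y

theorem goodPart_of_mem (F : Eucl d → H₁) {t : ℝ≥0∞} (q : selectedCubes (fun x => ‖F x‖ₑ) t)
    {y : Eucl d} (hy : y ∈ dyadicCube q.1) : goodPart F t y = cubeMean F q.1 := by
  have h : ∃ q : selectedCubes (fun x => ‖F x‖ₑ) t, y ∈ dyadicCube q.1 := ⟨q, hy⟩
  have hq : h.choose = q := by
    by_contra hne
    exact Set.disjoint_left.1 (pairwise_disjoint_selectedCubes _ t hne) h.choose_spec hy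
  rw [goodPart, dif_pos h, hq]

theorem goodPart_of_notMem (F : Eucl d → H₁) {t : ℝ≥0∞} {y : Eucl d}
    (hy : y ∉ ⋃ q : selectedCubes (fun x => ‖F x‖ₑ) t, dyadicCube q.1) : goodPart F t y = F y := by
  rw [goodPart, dif_neg (by simpa using hy)]

theorem measurableSet_iUnion_selectedCubes (φ : Eucl d → ℝ≥0∞) (t : ℝ≥0∞) :
    MeasurableSet (⋃ q : selectedCubes φ t, dyadicCube q.1) :=
  MeasurableSet.iUnion fun q => measurableSet_dyadicCube q.1

theorem aestronglyMeasurable_goodPart {F : Eucl d → H₁} (hF : Continuous F) (t : ℝ≥0∞) :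
    AEStronglyMeasurable (goodPart F t) volume := by
  set Ω := ⋃ q : selectedCubes (fun x => ‖F x‖ₑ) t, dyadicCube q.1 with hΩ
  have hΩm : MeasurableSet Ω := measurableSet_iUnion_selectedCubes _ t
  rw [← Measure.restrict_univ (μ := volume), ← Set.union_compl_self Ω, aestronglyMeasurable_union_iff]
  refine ⟨aestronglyMeasurable_iUnion_iff.2 fun q => ?_, ?_⟩
  · refine (aestronglyMeasurable_const (b := cubeMean F q.1)).congr ?_
    filter_upwards [ae_restrict_mem (measurableSet_dyadicCube q.1)] with y hy
    exact (goodPart_of_mem F q hy).symm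
  · refine hF.aestronglyMeasurable.congr ?_
    filter_upwards [ae_restrict_mem hΩm.compl] with y hy
    exact (goodPart_of_notMem F hy).symm

theorem enorm_cubeMean_le {F : Eucl d → H₁} {t : ℝ≥0∞} {q : ℤ × (Fin d → ℤ)}
    (hq : q ∈ selectedCubes (fun x => ‖F x‖ₑ) t) : ‖cubeMean F q‖ₑ ≤ 2 ^ d * t :=
  (ENNReal.mul_le_mul_iff_left (volume_dyadicCube_pos q) (volume_dyadicCube_ne_top q)).1
    ((enorm_cubeMean_mul_le F q).trans (setLIntegral_le_of_mem_selectedCubes hq))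

theorem enorm_goodPart_le_of_mem {F : Eucl d → H₁} {t : ℝ≥0∞} {y : Eucl d}
    (hy : y ∈ ⋃ q : selectedCubes (fun x => ‖F x‖ₑ) t, dyadicCube q.1) :
    ‖goodPart F t y‖ₑ ≤ 2 ^ d * t := by
  obtain ⟨q, hq⟩ := Set.mem_iUnion.1 hy
  rw [goodPart_of_mem F q hq]
  exact enorm_cubeMean_le q.2

/-- Off the selected cubes the good part is `F`; on them it is a mean, at most `2 ^ d * t`. The case
`s = 2` feeds the `L²` bound, the case `s = 1` gives integrability. -/
theorem lintegral_goodPart_rpow_le (hd : d ≠ 0) {F : Eucl d → H₁} (hFi : Integrable F)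
    {t : ℝ≥0∞} (ht : t ≠ 0) {s : ℝ} (hs : 0 ≤ s) :
    ∫⁻ y, ‖goodPart F t y‖ₑ ^ s ≤
      (∫⁻ y in {x | dyadicMaximal (fun x => ‖F x‖ₑ) x ≤ t}, ‖F y‖ₑ ^ s) +
      (2 ^ d * t) ^ s * volume {x | t < dyadicMaximal (fun x => ‖F x‖ₑ) x} := by
  set Ω := ⋃ q : selectedCubes (fun x => ‖F x‖ₑ) t, dyadicCube q.1 with hΩ
  have hΩm : MeasurableSet Ω := measurableSet_iUnion_selectedCubes _ t
  have hset : {x | t < dyadicMaximal (fun x => ‖F x‖ₑ) x} = Ω :=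
    setOf_lt_dyadicMaximal hd hFi.2.ne ht
  have hcompl : {x | dyadicMaximal (fun x => ‖F x‖ₑ) x ≤ t} = Ωᶜ := by
    rw [← hset]; ext x; simp
  rw [hset, hcompl, ← lintegral_add_compl _ hΩm, add_comm]
  refine add_le_add (le_of_eq ?_) ?_
  · refine setLIntegral_congr_fun hΩm.compl fun y hy => ?_
    simp only [goodPart_of_notMem F hy]
  · rw [← setLIntegral_const]
    exact setLIntegral_mono' hΩm fun y hy =>
      ENNReal.rpow_le_rpow (enorm_goodPart_le_of_mem hy) hs

theorem memLp_top_goodPart {F : Eucl d → H₁} (hF : Continuous F) {B : ℝ≥0∞} (hB : B ≠ ∞)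
    (hFB : ∀ x, ‖F x‖ₑ ≤ B) {t : ℝ≥0∞} (ht : t ≠ ∞) : MemLp (goodPart F t) ∞ := by
  refine ⟨aestronglyMeasurable_goodPart hF t, ?_⟩
  have hlt : B + 2 ^ d * t < ∞ :=
    ENNReal.add_lt_top.2 ⟨hB.lt_top, ENNReal.mul_lt_top (by simp) ht.lt_top⟩
  refine lt_of_le_of_lt ?_ hlt
  rw [eLpNorm_exponent_top]
  refine essSup_le_of_ae_le _ (ae_of_all _ fun y => ?_)
  by_cases hy : y ∈ ⋃ q : selectedCubes (fun x => ‖F x‖ₑ) t, dyadicCube q.1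
  · exact (enorm_goodPart_le_of_mem hy).trans le_add_self
  · simp only [goodPart_of_notMem F hy]
    exact (hFB y).trans le_self_add

theorem integrable_goodPart (hd : d ≠ 0) {F : Eucl d → H₁} (hF : Continuous F)
    (hFi : Integrable F) {t : ℝ≥0∞} (ht : t ≠ 0) : Integrable (goodPart F t) := by
  refine ⟨aestronglyMeasurable_goodPart hF t, ?_⟩
  have h := lintegral_goodPart_rpow_le hd hFi ht zero_le_one
  simp only [ENNReal.rpow_one] at h
  refine lt_of_le_of_lt h (ENNReal.add_lt_top.2 ⟨?_, ?_⟩)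
  · exact lt_of_le_of_lt (setLIntegral_le_lintegral _ _) hFi.2
  · rw [mul_assoc]
    exact ENNReal.mul_lt_top (by simp)
      (lt_of_le_of_lt (mul_volume_setOf_lt_dyadicMaximal_le hd hFi.2.ne ht) hFi.2)

/-- The centre of enlargement of a dyadic cube. -/
def cubePoint (q : ℤ × (Fin d → ℤ)) : Eucl d := WithLp.toLp 2 fun i => (q.2 i : ℝ) * 2 ^ (-q.1)

theorem cubePoint_mem (q : ℤ × (Fin d → ℤ)) : cubePoint q ∈ dyadicCube q := by
  have hpos : (2 : ℝ) ^ q.1 ≠ 0 := by positivity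
  funext i
  simp [dyadicIndex, cubePoint, hpos]

/-- The ball that contains the enlargement of a dyadic cube. -/
def cubeBall (q : ℤ × (Fin d → ℤ)) : Set (Eucl d) :=
  Metric.ball (cubePoint q) (2 * (d * 2 ^ (-q.1)))

theorem volume_cubeBall (hd : d ≠ 0) (q : ℤ × (Fin d → ℤ)) :
    volume (cubeBall q) = ENNReal.ofReal ((2 * d) ^ d) * volume (Metric.ball (0 : Eucl d) 1) *
      volume (dyadicCube q) := by
  have : Nonempty (Fin d) := Fin.pos_iff_nonempty.1 (Nat.pos_of_ne_zero hd)
  rw [cubeBall, Measure.addHaar_ball volume _ (by positivity), volume_dyadicCube]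
  simp only [finrank_euclideanSpace, Fintype.card_fin]
  rw [← mul_assoc, mul_pow, ENNReal.ofReal_mul (by positivity)]
  ring

/-- Translate by `cubePoint q` and apply Hörmander's condition with `ℓ = d * 2 ^ (-q.1)` and `v = y
- cubePoint q`. The radius of `cubeBall` is `2 * ℓ`, so its complement is exactly the region of
integration there. -/
theorem setLIntegral_enorm_kernel_sub_le {K : Eucl d → H₁ →L[ℝ] H₂} {A : ℝ≥0}
    (hK : IsSingularKernel K A) (hd : d ≠ 0) {q : ℤ × (Fin d → ℤ)} {y : Eucl d}
    (hy : y ∈ dyadicCube q) :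
    ∫⁻ x in (cubeBall q)ᶜ, ‖K (x - y) - K (x - cubePoint q)‖ₑ ≤ A := by
  have hd' : (0 : ℝ) < d := by exact_mod_cast Nat.pos_of_ne_zero hd
  have h := hK.hormander (d * 2 ^ (-q.1)) (by positivity) (y - cubePoint q)
    (norm_sub_le_of_mem_dyadicCube hy (cubePoint_mem q))
  refine le_trans (le_of_eq ?_) h
  have hm : MeasurableSet {w : Eucl d | 2 * (d * 2 ^ (-q.1)) ≤ ‖w‖} :=
    measurableSet_le measurable_const measurable_norm
  have hm' : MeasurableSet (cubeBall q)ᶜ := measurableSet_ball.compl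
  rw [← lintegral_indicator hm', ← lintegral_indicator hm,
    ← lintegral_sub_right_eq_self ({w : Eucl d | 2 * (d * 2 ^ (-q.1)) ≤ ‖w‖}.indicator
      fun w => ‖K (w - (y - cubePoint q)) - K w‖ₑ) (cubePoint q)]
  refine lintegral_congr fun x => ?_
  simp only [Set.indicator, Set.mem_compl_iff, cubeBall, Metric.mem_ball, dist_eq_norm, not_lt,
    Set.mem_ofPred_eq, sub_sub_sub_cancel_right]

/-- After Tonelli the integral in `x` is at most `A` uniformly in `y`; the factor `2` pays for the
subtracted mean. -/
theorem setLIntegral_enorm_kernel_badPart_le {K : Eucl d → H₁ →L[ℝ] H₂} {A : ℝ≥0}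
    (hK : IsSingularKernel K A) (hd : d ≠ 0) {F : Eucl d → H₁} (hF : Continuous F)
    (q : ℤ × (Fin d → ℤ)) :
    ∫⁻ x in (cubeBall q)ᶜ, ∫⁻ y in dyadicCube q,
      ‖K (x - y) - K (x - cubePoint q)‖ₑ * ‖F y - cubeMean F q‖ₑ ≤
      2 * A * ∫⁻ y in dyadicCube q, ‖F y‖ₑ := by
  have hKc := hK.continuous
  rw [lintegral_lintegral_swap]
  · calc ∫⁻ y in dyadicCube q, ∫⁻ x in (cubeBall q)ᶜ,
          ‖K (x - y) - K (x - cubePoint q)‖ₑ * ‖F y - cubeMean F q‖ₑ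
        ≤ ∫⁻ y in dyadicCube q, A * ‖F y - cubeMean F q‖ₑ := by
          refine setLIntegral_mono' (measurableSet_dyadicCube q) fun y hy => ?_
          rw [lintegral_mul_const' _ _ enorm_ne_top]
          gcongr
          exact setLIntegral_enorm_kernel_sub_le hK hd hy
      _ ≤ A * (2 * ∫⁻ y in dyadicCube q, ‖F y‖ₑ) := by
          rw [lintegral_const_mul' _ _ (by simp)]
          gcongr
          exact setLIntegral_enorm_sub_cubeMean_le hF q
      _ = _ := by ring
  · have h1 : Continuous fun z : Eucl d × Eucl d => K (z.1 - z.2) - K (z.1 - cubePoint q) :=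
      (hKc.comp (continuous_fst.sub continuous_snd)).sub
        (hKc.comp (continuous_fst.sub continuous_const))
    have h2 : Continuous fun z : Eucl d × Eucl d => F z.2 - cubeMean F q :=
      (hF.comp continuous_snd).sub continuous_const
    exact (h1.enorm.measurable.mul h2.enorm.measurable).aemeasurable

/-- The bad part has mean zero on each selected cube, so `K (x - y)` may be replaced there by its
difference from the constant operator `K (x - cubePoint q)`. -/
theorem enorm_kernelOp_badPart_le [CompleteSpace H₁] [CompleteSpace H₂]
    {K : Eucl d → H₁ →L[ℝ] H₂} (hKc : Continuous K) {M : ℝ}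
    (hM : ∀ x, ‖K x‖ ≤ M)  {F : Eucl d → H₁}
    {t : ℝ≥0∞} (hFi : Integrable F) (hGi : Integrable (goodPart F t)) (x : Eucl d) :
    ‖kernelOp K (fun y => F y - goodPart F t y) x‖ₑ ≤
      ∑' q : selectedCubes (fun x => ‖F x‖ₑ) t, ∫⁻ y in dyadicCube q.1,
        ‖K (x - y) - K (x - cubePoint q.1)‖ₑ * ‖F y - cubeMean F q.1‖ₑ := by
  set Ω := ⋃ q : selectedCubes (fun x => ‖F x‖ₑ) t, dyadicCube q.1 with hΩ
  have hBi : Integrable fun y => F y - goodPart F t y := hFi.sub hGi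
  have hint := integrable_kernel_apply hKc hM hBi x
  rw [kernelOp, ← setIntegral_eq_integral_of_forall_compl_eq_zero (s := Ω)
    (fun y hy => by rw [goodPart_of_notMem F hy, sub_self, map_zero]), hΩ,
    integral_iUnion (fun q => measurableSet_dyadicCube _) (pairwise_disjoint_selectedCubes _ t)
    hint.integrableOn]
  refine enorm_tsum_le_tsum_enorm.trans (ENNReal.tsum_le_tsum fun q => ?_)
  have hQm := measurableSet_dyadicCube q.1
  have hi1 : IntegrableOn (fun y => F y - cubeMean F q.1) (dyadicCube q.1) :=
    hFi.integrableOn.sub (integrableOn_const (volume_dyadicCube_ne_top q.1))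
  have h1 : ∫ y in dyadicCube q.1, K (x - y) (F y - goodPart F t y) =
      ∫ y in dyadicCube q.1, K (x - y) (F y - cubeMean F q.1) :=
    setIntegral_congr_fun hQm fun y hy => by simp only [goodPart_of_mem F q hy]
  have h2 : ∫ y in dyadicCube q.1, K (x - cubePoint q.1) (F y - cubeMean F q.1) = 0 := by
    rw [ContinuousLinearMap.integral_comp_comm _ hi1, setIntegral_sub_cubeMean hFi, map_zero]
  have h3 : IntegrableOn (fun y => K (x - y) (F y - cubeMean F q.1)) (dyadicCube q.1) := by
    refine hint.integrableOn.congr_fun (fun y hy => ?_) hQm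
    simp only [goodPart_of_mem F q hy]
  have h4 : ∫ y in dyadicCube q.1, K (x - y) (F y - goodPart F t y) =
      ∫ y in dyadicCube q.1, (K (x - y) - K (x - cubePoint q.1)) (F y - cubeMean F q.1) := by
    simp only [sub_apply]
    rw [integral_sub h3 (ContinuousLinearMap.integrable_comp _ hi1), h2, sub_zero, h1]
  rw [h4]
  refine (enorm_integral_le_lintegral_enorm _).trans (lintegral_mono fun y => ?_)
  exact ContinuousLinearMap.le_opENorm _ _

/-- The weak type estimate for singular integral operators that are bounded on `L^2`. -/
theorem volume_lt_enorm_kernelOp_le [CompleteSpace H₁] [CompleteSpace H₂]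
    {K : Eucl d → H₁ →L[ℝ] H₂} {A A₂ : ℝ≥0}
    (hK : IsSingularKernel K A) (h2 : StrongType K 2 A₂) (hd : d ≠ 0) {F : Eucl d → H₁}
    (hF : Continuous F) (hFi : Integrable F) {B : ℝ≥0∞} (hB : B ≠ ∞) (hFB : ∀ x, ‖F x‖ₑ ≤ B)
    {t : ℝ} (ht : 0 < t) :
    volume {x | ENNReal.ofReal t < ‖kernelOp K F x‖ₑ} ≤
      (4 * A₂ ^ 2 * (1 + 4 ^ d) + ENNReal.ofReal ((2 * d) ^ d) *
        volume (Metric.ball (0 : Eucl d) 1) + 4 * A * 2 ^ d) *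
      (ENNReal.ofReal (t ^ (-2 : ℝ)) * (∫⁻ x in {x | dyadicMaximal (fun x => ‖F x‖ₑ) x ≤
        ENNReal.ofReal t}, ‖F x‖ₑ ^ (2 : ℝ)) +
        volume {x | ENNReal.ofReal t < dyadicMaximal (fun x => ‖F x‖ₑ) x}) := by
  obtain ⟨M, hM⟩ := hK.exists_norm_le
  have hKc := hK.continuous
  set τ := ENNReal.ofReal t with hτ
  have hτ0 : τ ≠ 0 := by simpa [hτ] using ht
  have hτt : τ ≠ ∞ := ENNReal.ofReal_ne_top
  set φ := fun x => ‖F x‖ₑ with hφ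
  set V := volume {x | τ < dyadicMaximal φ x} with hV
  set I := ∫⁻ x in {x | dyadicMaximal φ x ≤ τ}, ‖F x‖ₑ ^ (2 : ℝ) with hI
  have hGi := integrable_goodPart hd hF hFi hτ0
  have hGtop := memLp_top_goodPart hF hB hFB hτt
  have hBi : Integrable fun y => F y - goodPart F τ y := hFi.sub hGi
  set W := ⋃ q : selectedCubes φ τ, cubeBall q.1 with hW
  have hhalf : τ / 2 + τ / 2 = τ := ENNReal.add_halves τ
  have hτ20 : τ / 2 ≠ 0 := by simpa using hτ0
  have hτ2t : τ / 2 ≠ ∞ := (ENNReal.div_lt_top hτt (by simp)).ne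
  have hsplit : ∀ x, kernelOp K F x = kernelOp K (goodPart F τ) x +
      kernelOp K (fun y => F y - goodPart F τ y) x := by
    intro x
    rw [kernelOp, kernelOp, kernelOp, ← integral_add (integrable_kernel_apply hKc hM hGi x)
      (integrable_kernel_apply hKc hM hBi x)]
    simp
  -- Either the good part contributes at least `τ / 2`, or `x` lies in an enlarged cube, or `x` lies
  -- outside all of them and the bad part contributes at least `τ / 2`.
  have hsub : {x | τ < ‖kernelOp K F x‖ₑ} ⊆ {x | τ / 2 ≤ ‖kernelOp K (goodPart F τ) x‖ₑ} ∪
      (W ∪ {x | τ / 2 ≤ Wᶜ.indicator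
        (fun x => ‖kernelOp K (fun y => F y - goodPart F τ y) x‖ₑ) x}) := by
    intro x hx
    simp only [Set.mem_union, Set.mem_ofPred_eq] at hx ⊢
    by_contra! hcon
    obtain ⟨h3, h4, h5⟩ := hcon
    rw [Set.indicator_of_mem (Set.mem_compl h4)] at h5
    refine absurd hx (not_lt.2 ?_)
    rw [hsplit]
    exact (enorm_add_le _ _).trans ((add_le_add h3.le h5.le).trans hhalf.le)
  -- Chebyshev in `L²`. The `4` comes from the level `τ / 2` and the `4 ^ d` from the bound `2 ^ d *
  -- τ` of the good part on the cubes, where `τ ^ 2` cancels `t ^ (-2)` and leaves `V`.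
  have hgood : volume {x | τ / 2 ≤ ‖kernelOp K (goodPart F τ) x‖ₑ} ≤
      4 * A₂ ^ 2 * (1 + 4 ^ d) * (ENNReal.ofReal (t ^ (-2 : ℝ)) * I + V) := by
    have hm : AEMeasurable (fun x => ‖kernelOp K (goodPart F τ) x‖ₑ ^ (2 : ℝ)) volume :=
      ((continuous_kernelOp hKc hM hGi).enorm.measurable.pow_const _).aemeasurable
    have h3 := meas_ge_le_lintegral_div hm (ε := (τ / 2) ^ (2 : ℝ))
      (ENNReal.rpow_pos (pos_iff_ne_zero.2 hτ20) hτ2t).ne'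
      (ENNReal.rpow_ne_top_of_nonneg zero_le_two hτ2t)
    have h4 : {x | (τ / 2) ^ (2 : ℝ) ≤ ‖kernelOp K (goodPart F τ) x‖ₑ ^ (2 : ℝ)} =
        {x | τ / 2 ≤ ‖kernelOp K (goodPart F τ) x‖ₑ} := by
      ext x
      simp only [Set.mem_ofPred_eq, ENNReal.rpow_le_rpow_iff (zero_lt_two : (0 : ℝ) < 2)]
    have h5 : ∫⁻ x, ‖kernelOp K (goodPart F τ) x‖ₑ ^ (2 : ℝ) ≤
        A₂ ^ 2 * (I + (2 ^ d * τ) ^ 2 * V) := by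
      have h6 := lintegral_goodPart_rpow_le hd hFi hτ0 (zero_le_two : (0 : ℝ) ≤ 2)
      rw [lintegral_enorm_rpow_eq_eLpNorm_rpow _ _ zero_lt_two] at h6 ⊢
      have h7 := h2 _ hGi hGtop
      simp only [ENNReal.ofReal_ofNat] at h6 ⊢
      refine (ENNReal.rpow_le_rpow h7 zero_le_two).trans ?_
      rw [ENNReal.mul_rpow_of_nonneg _ _ zero_le_two, ENNReal.rpow_two]
      refine mul_le_mul' le_rfl (h6.trans (le_of_eq ?_))
      rw [ENNReal.rpow_two]
    have hτi : ENNReal.ofReal (t ^ (-2 : ℝ)) = (τ ^ 2)⁻¹ := by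
      rw [Real.rpow_neg ht.le, ENNReal.ofReal_inv_of_pos (by positivity), Real.rpow_two,
        ENNReal.ofReal_pow ht.le]
    have hcan : (τ ^ 2)⁻¹ * τ ^ 2 = 1 :=
      ENNReal.inv_mul_cancel (pow_ne_zero 2 hτ0) (ENNReal.pow_ne_top hτt)
    rw [h4] at h3
    refine h3.trans ((ENNReal.div_le_div_right h5 _).trans ?_)
    have h8 : ((τ / 2) ^ (2 : ℝ))⁻¹ = 4 * (τ ^ 2)⁻¹ := by
      rw [ENNReal.rpow_two, div_eq_mul_inv, mul_pow,
        ENNReal.mul_inv (Or.inr (by simp)) (Or.inr (by simp)), ← ENNReal.inv_pow, inv_inv, mul_comm]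
      norm_num
    have h9 : ((2 : ℝ≥0∞) ^ d) ^ 2 = 4 ^ d := by rw [← pow_mul, mul_comm, pow_mul]; norm_num
    rw [div_eq_mul_inv, h8, hτi]
    calc A₂ ^ 2 * (I + (2 ^ d * τ) ^ 2 * V) * (4 * (τ ^ 2)⁻¹)
        = 4 * A₂ ^ 2 * (1 * ((τ ^ 2)⁻¹ * I) + 4 ^ d * (((τ ^ 2)⁻¹ * τ ^ 2) * V)) := by
          rw [mul_pow, h9]; ring
      _ ≤ 4 * A₂ ^ 2 * ((1 + 4 ^ d) * ((τ ^ 2)⁻¹ * I) + (1 + 4 ^ d) * V) := by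
          rw [hcan, one_mul V]
          gcongr
          · exact le_self_add
          · exact le_add_self
      _ = _ := by ring
  have hWle : volume W ≤ ENNReal.ofReal ((2 * d) ^ d) * volume (Metric.ball (0 : Eucl d) 1) * V := by
    rw [hV, volume_setOf_lt_dyadicMaximal_eq_tsum hd hFi.2.ne hτ0, ← ENNReal.tsum_mul_left]
    refine (measure_iUnion_le _).trans (ENNReal.tsum_le_tsum fun q => ?_)
    rw [volume_cubeBall hd]
  have hWm : MeasurableSet W := MeasurableSet.iUnion fun q => measurableSet_ball
  -- Chebyshev in `L¹` off the enlarged cubes, the factor `4` combining the level `τ / 2` with the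
  -- `2` of the mean subtraction. The mass of `F` on the cubes is at most `2 ^ d * τ * V`.
  have hbad : volume {x | τ / 2 ≤ Wᶜ.indicator
      (fun x => ‖kernelOp K (fun y => F y - goodPart F τ y) x‖ₑ) x} ≤ 4 * A * 2 ^ d * V := by
    have hcont := continuous_kernelOp hKc hM hBi
    have h3 := meas_ge_le_lintegral_div
      ((hcont.enorm.measurable.indicator hWm.compl).aemeasurable (μ := volume)) hτ20 hτ2t
    refine h3.trans ?_
    rw [lintegral_indicator hWm.compl]
    have h4 : ∫⁻ x in Wᶜ, ‖kernelOp K (fun y => F y - goodPart F τ y) x‖ₑ ≤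
        2 * A * (2 ^ d * τ * V) := by
      calc ∫⁻ x in Wᶜ, ‖kernelOp K (fun y => F y - goodPart F τ y) x‖ₑ
          ≤ ∫⁻ x in Wᶜ, ∑' q : selectedCubes φ τ, ∫⁻ y in dyadicCube q.1,
              ‖K (x - y) - K (x - cubePoint q.1)‖ₑ * ‖F y - cubeMean F q.1‖ₑ :=
            lintegral_mono fun x => enorm_kernelOp_badPart_le hKc hM hFi hGi x
        _ = ∑' q : selectedCubes φ τ, ∫⁻ x in Wᶜ, ∫⁻ y in dyadicCube q.1,
              ‖K (x - y) - K (x - cubePoint q.1)‖ₑ * ‖F y - cubeMean F q.1‖ₑ := by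
            refine lintegral_tsum fun q => Measurable.aemeasurable ?_
            have h1 : Continuous fun z : Eucl d × Eucl d =>
                K (z.1 - z.2) - K (z.1 - cubePoint q.1) :=
              (hKc.comp (continuous_fst.sub continuous_snd)).sub
                (hKc.comp (continuous_fst.sub continuous_const))
            have h2 : Continuous fun z : Eucl d × Eucl d => F z.2 - cubeMean F q.1 :=
              (hF.comp continuous_snd).sub continuous_const
            exact (h1.enorm.measurable.mul h2.enorm.measurable).lintegral_prod_right'
        _ ≤ ∑' q : selectedCubes φ τ, 2 * A * ∫⁻ y in dyadicCube q.1, ‖F y‖ₑ := by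
            refine ENNReal.tsum_le_tsum fun q => ?_
            refine (lintegral_mono_set ?_).trans
              (setLIntegral_enorm_kernel_badPart_le hK hd hF q.1)
            exact Set.compl_subset_compl.2 (Set.subset_iUnion_of_subset q subset_rfl)
        _ = 2 * A * ∫⁻ x in {x | τ < dyadicMaximal φ x}, φ x := by
            rw [ENNReal.tsum_mul_left, setLIntegral_setOf_lt_dyadicMaximal_eq_tsum hd hFi.2.ne hτ0]
        _ ≤ _ := by
            gcongr
            exact setLIntegral_setOf_lt_dyadicMaximal_le hd hFi.2.ne hτ0
    refine (ENNReal.div_le_div_right h4 _).trans (le_of_eq ?_)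
    rw [div_eq_mul_inv, ENNReal.inv_div (by simp) (by simp), div_eq_mul_inv]
    calc 2 * A * (2 ^ d * τ * V) * (2 * τ⁻¹) = 4 * A * 2 ^ d * V * (τ * τ⁻¹) := by ring
      _ = _ := by rw [ENNReal.mul_inv_cancel hτ0 hτt, mul_one]
  calc volume {x | τ < ‖kernelOp K F x‖ₑ}
      ≤ 4 * A₂ ^ 2 * (1 + 4 ^ d) * (ENNReal.ofReal (t ^ (-2 : ℝ)) * I + V) +
        (ENNReal.ofReal ((2 * d) ^ d) * volume (Metric.ball (0 : Eucl d) 1) * V +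
        4 * A * 2 ^ d * V) :=
        (measure_mono hsub).trans ((measure_union_le _ _).trans (add_le_add hgood
          ((measure_union_le _ _).trans (add_le_add hWle hbad))))
    _ ≤ 4 * A₂ ^ 2 * (1 + 4 ^ d) * (ENNReal.ofReal (t ^ (-2 : ℝ)) * I + V) +
        (ENNReal.ofReal ((2 * d) ^ d) * volume (Metric.ball (0 : Eucl d) 1) *
          (ENNReal.ofReal (t ^ (-2 : ℝ)) * I + V) +
        4 * A * 2 ^ d * (ENNReal.ofReal (t ^ (-2 : ℝ)) * I + V)) := by
        gcongr <;> exact le_add_self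
    _ = _ := by ring

end Kernel

/-! ### Passage from continuous compactly supported functions to all of `L^p`. -/

section Extension

variable {d : ℕ} {H₁ H₂ : Type*} [NormedAddCommGroup H₁] [NormedSpace ℝ H₁]
  [NormedAddCommGroup H₂] [NormedSpace ℝ H₂]

/-- The `p`-th power of the constant in the Calderón–Zygmund theorem for `1 < p < 2`. -/
def czConstPow (d : ℕ) (A A₂ : ℝ≥0) (p : ℝ) : ℝ≥0∞ :=
  (4 * A₂ ^ 2 * (1 + 4 ^ d) + ENNReal.ofReal ((2 * d) ^ d) *
    volume (Metric.ball (0 : Eucl d) 1) + 4 * A * 2 ^ d) *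
  (ENNReal.ofReal p * (ENNReal.ofReal (2 - p))⁻¹ +
    ENNReal.ofReal p * (2 * ((ENNReal.ofReal (p - 1))⁻¹ * 2 ^ (p - 1))))

/-- The constant in the Calderón–Zygmund theorem for `1 < p < 2`. -/
def czConst (d : ℕ) (A A₂ : ℝ≥0) (p : ℝ) : ℝ≥0 := (czConstPow d A A₂ p ^ (1 / p)).toNNReal

theorem czConst_ne_top_aux (d : ℕ) (A A₂ : ℝ≥0) :
    4 * (A₂ : ℝ≥0∞) ^ 2 * (1 + 4 ^ d) + ENNReal.ofReal ((2 * d) ^ d) *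
    volume (Metric.ball (0 : Eucl d) 1) + 4 * A * 2 ^ d ≠ ∞ := by
  have h : volume (Metric.ball (0 : Eucl d) 1) < ∞ := measure_ball_lt_top
  finiteness

theorem coe_czConst (d : ℕ) (A A₂ : ℝ≥0) {p : ℝ} (hp : 1 < p) (hp2 : p < 2) :
    (czConst d A A₂ p : ℝ≥0∞) = czConstPow d A A₂ p ^ (1 / p) := by
  rw [czConst, ENNReal.coe_toNNReal]
  refine ENNReal.rpow_ne_top_of_nonneg (by positivity) ?_
  have h1 := czConst_ne_top_aux d A A₂
  have h2 : (ENNReal.ofReal (2 - p))⁻¹ ≠ ∞ := by simpa using hp2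
  have h3 : (ENNReal.ofReal (p - 1))⁻¹ ≠ ∞ := by simpa using hp
  have h4 : (2 : ℝ≥0∞) ^ (p - 1) ≠ ∞ :=
    ENNReal.rpow_ne_top_of_nonneg (by linarith) (by simp)
  rw [czConstPow]
  finiteness

/-- The Calderón–Zygmund theorem on continuous compactly supported functions, `1 < p < 2`. -/
theorem eLpNorm_kernelOp_le_of_continuous [CompleteSpace H₁] [CompleteSpace H₂]
    {K : Eucl d → H₁ →L[ℝ] H₂} {A A₂ : ℝ≥0}
    (hK : IsSingularKernel K A) (h2 : StrongType K 2 A₂) (hd : d ≠ 0) {p : ℝ} (hp : 1 < p)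
    (hp2 : p < 2) {F : Eucl d → H₁} (hF : Continuous F) (hFs : HasCompactSupport F) :
    eLpNorm (kernelOp K F) (ENNReal.ofReal p) volume ≤
      czConst d A A₂ p * eLpNorm F (ENNReal.ofReal p) volume := by
  obtain ⟨M, hM⟩ := hK.exists_norm_le
  have hFi : Integrable F := hF.integrable_of_hasCompactSupport hFs
  obtain ⟨B, hB⟩ := hF.bounded_above_of_compact_support hFs
  have hFB : ∀ x, ‖F x‖ₑ ≤ ENNReal.ofReal B := fun x => by
    rw [← ofReal_norm]; exact ENNReal.ofReal_le_ofReal (hB x)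
  have hp0 : 0 < p := by linarith
  have h := lintegral_rpow_le_of_distribution_le hd hF.enorm hFi.2.ne ENNReal.ofReal_ne_top hFB
    (continuous_kernelOp hK.continuous hM hFi).enorm.measurable (fun x => enorm_ne_top)
    (czConst_ne_top_aux d A A₂) hp hp2
    (fun t ht => volume_lt_enorm_kernelOp_le hK h2 hd hF hFi ENNReal.ofReal_ne_top hFB ht)
  rw [lintegral_enorm_rpow_eq_eLpNorm_rpow _ _ hp0,
    lintegral_enorm_rpow_eq_eLpNorm_rpow _ _ hp0] at h
  rw [coe_czConst d A A₂ hp hp2, ← ENNReal.rpow_le_rpow_iff hp0,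
    ENNReal.mul_rpow_of_nonneg _ _ hp0.le, ← ENNReal.rpow_mul, one_div, inv_mul_cancel₀ hp0.ne',
    ENNReal.rpow_one]
  exact h

theorem memLp_of_integrable_of_memLp_top {α H : Type*} [MeasurableSpace α]
    [NormedAddCommGroup H] {μ : Measure α} {f : α → H} (h1 : Integrable f μ) (htop : MemLp f ∞ μ)
    {p : ℝ} (hp : 1 ≤ p) : MemLp f (ENNReal.ofReal p) μ := by
  have hp0 : 0 < p := by linarith
  refine ⟨h1.1, ?_⟩
  rw [eLpNorm_lt_top_iff_lintegral_rpow_enorm_lt_top (by simpa using hp0) (by simp),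
    ENNReal.toReal_ofReal hp0.le]
  have hB : eLpNorm f ∞ μ < ∞ := htop.2
  calc ∫⁻ x, ‖f x‖ₑ ^ p ∂μ ≤ ∫⁻ x, eLpNorm f ∞ μ ^ (p - 1) * ‖f x‖ₑ ∂μ := by
        refine lintegral_mono_ae ?_
        filter_upwards [ae_le_eLpNormEssSup (f := f) (μ := μ)] with x hx
        rw [eLpNorm_exponent_top]
        calc ‖f x‖ₑ ^ p = ‖f x‖ₑ ^ (p - 1) * ‖f x‖ₑ ^ (1 : ℝ) := by
              rw [← ENNReal.rpow_add_of_nonneg _ _ (by linarith) zero_le_one]; ring_nf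
          _ ≤ _ := by
              rw [ENNReal.rpow_one]
              gcongr
    _ = eLpNorm f ∞ μ ^ (p - 1) * ∫⁻ x, ‖f x‖ₑ ∂μ :=
        lintegral_const_mul' _ _ (ENNReal.rpow_ne_top_of_nonneg (by linarith) hB.ne)
    _ < ∞ := ENNReal.mul_lt_top (ENNReal.rpow_lt_top_of_nonneg (by linarith) hB.ne) h1.2

theorem integrable_decay (d : ℕ) :
    Integrable fun x : Eucl d => (1 + ‖x‖) ^ (-((d : ℝ) + 1)) :=
  integrable_one_add_norm (by simp)

theorem memLp_of_norm_le_decay {H : Type*} [NormedAddCommGroup H] {g : Eucl d → H}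
    (hg : Continuous g) {M : ℝ} (hM : ∀ x, ‖g x‖ ≤ M * (1 + ‖x‖) ^ (-((d : ℝ) + 1)))
    {p : ℝ} (hp : 1 ≤ p) : MemLp g (ENNReal.ofReal p) := by
  have hM0 : 0 ≤ M := by simpa using (norm_nonneg _).trans (hM 0)
  refine memLp_of_integrable_of_memLp_top ?_ ?_ hp
  · exact ((integrable_decay d).const_mul M).mono' hg.aestronglyMeasurable (ae_of_all _ hM)
  · refine memLp_top_of_bound hg.aestronglyMeasurable M (ae_of_all _ fun x => ?_)
    refine (hM x).trans (mul_le_of_le_one_right hM0 ?_)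
    exact Real.rpow_le_one_of_one_le_of_nonpos (by linarith [norm_nonneg x])
      (by linarith [Nat.cast_nonneg (α := ℝ) d])

theorem eLpNorm_kernel_sub {K : Eucl d → H₁ →L[ℝ] H₂} (hK : Continuous K) (q : ℝ≥0∞) (x : Eucl d) :
    eLpNorm (fun y => K (x - y)) q volume = eLpNorm K q volume := by
  have h := (Measure.measurePreserving_sub_left (volume : Measure (Eucl d)) x)
  exact eLpNorm_comp_measurePreserving hK.aestronglyMeasurable h

/-- Hölder's inequality. The value at a fixed point is thus continuous in `F` for the `L^p` norm, so
that density arguments have convergence at every `x`. -/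
theorem integrable_kernel_apply_of_memLp {K : Eucl d → H₁ →L[ℝ] H₂} {p q : ℝ}
    (hpq : p.HolderConjugate q) (hK : Continuous K) (hKq : MemLp K (ENNReal.ofReal q))
    {F : Eucl d → H₁} (hF : MemLp F (ENNReal.ofReal p)) (x : Eucl d) :
    Integrable (fun y => K (x - y) (F y)) ∧ ‖kernelOp K F x‖ₑ ≤
      eLpNorm K (ENNReal.ofReal q) volume * eLpNorm F (ENNReal.ofReal p) volume := by
  have hc : ENNReal.HolderConjugate (ENNReal.ofReal q) (ENNReal.ofReal p) := hpq.symm.ennrealOfReal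
  have hm := aestronglyMeasurable_kernel_apply hK hF.1 x
  have h1 := eLpNorm_le_eLpNorm_mul_eLpNorm'_of_norm (p := ENNReal.ofReal q)
    (q := ENNReal.ofReal p) (r := 1)
    (f := fun y => K (x - y))
    (hK.comp (continuous_const.sub continuous_id)).aestronglyMeasurable hF.1 (fun (T : H₁ →L[ℝ] H₂) (v : H₁) => T v) 1
    (ae_of_all volume fun y => by
      simpa using ContinuousLinearMap.le_opNorm (K (x - y)) (F y))
  simp only [ENNReal.coe_one, one_mul, eLpNorm_kernel_sub hK] at h1
  refine ⟨memLp_one_iff_integrable.1 ⟨hm, h1.trans_lt (ENNReal.mul_lt_top hKq.2 hF.2)⟩,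
    (enorm_integral_le_lintegral_enorm _).trans ?_⟩
  rwa [eLpNorm_one_eq_lintegral_enorm] at h1

theorem kernelOp_sub_of_memLp {K : Eucl d → H₁ →L[ℝ] H₂} {p q : ℝ}
    (hpq : p.HolderConjugate q) (hK : Continuous K) (hKq : MemLp K (ENNReal.ofReal q))
    {F G : Eucl d → H₁} (hF : MemLp F (ENNReal.ofReal p)) (hG : MemLp G (ENNReal.ofReal p))
    (x : Eucl d) : kernelOp K (F - G) x = kernelOp K F x - kernelOp K G x := by
  rw [kernelOp, kernelOp, kernelOp, ← integral_sub
    (integrable_kernel_apply_of_memLp hpq hK hKq hF x).1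
    (integrable_kernel_apply_of_memLp hpq hK hKq hG x).1]
  simp

/-- An `L^p` bound on continuous compactly supported functions extends to `L^p`. -/
theorem eLpNorm_kernelOp_le_of_dense [CompleteSpace H₁] {K : Eucl d → H₁ →L[ℝ] H₂} {p q : ℝ}
    (hpq : p.HolderConjugate q) (hK : Continuous K) {M : ℝ} (hM : ∀ x, ‖K x‖ ≤ M)
    (hKq : MemLp K (ENNReal.ofReal q)) {C : ℝ≥0}
    (h : ∀ F : Eucl d → H₁, Continuous F → HasCompactSupport F →
      eLpNorm (kernelOp K F) (ENNReal.ofReal p) volume ≤ C * eLpNorm F (ENNReal.ofReal p) volume)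
    {F : Eucl d → H₁} (hF : MemLp F (ENNReal.ofReal p)) :
    eLpNorm (kernelOp K F) (ENNReal.ofReal p) volume ≤ C * eLpNorm F (ENNReal.ofReal p) volume := by
  set P := ENNReal.ofReal p
  have hP1 : 1 ≤ P := by simpa [P] using hpq.lt.le
  have hε : ∀ n : ℕ, ((n : ℝ≥0∞) + 1)⁻¹ ≠ 0 := fun n => by simp
  choose g hgs hgF hgc hgm using fun n : ℕ =>
    hF.exists_hasCompactSupport_eLpNorm_sub_le ENNReal.ofReal_ne_top (hε n)
  have hlim : Filter.Tendsto (fun n : ℕ => ((n : ℝ≥0∞) + 1)⁻¹) Filter.atTop (nhds 0) := by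
    have := ENNReal.tendsto_inv_nat_nhds_zero.comp (Filter.tendsto_add_atTop_nat 1)
    refine this.congr fun n => ?_
    simp
  have hpt : ∀ x, Filter.Tendsto (fun n => kernelOp K (g n) x) Filter.atTop
      (nhds (kernelOp K F x)) := by
    intro x
    rw [tendsto_iff_edist_tendsto_0]
    have hb : Filter.Tendsto (fun n : ℕ => eLpNorm K (ENNReal.ofReal q) volume *
        ((n : ℝ≥0∞) + 1)⁻¹) Filter.atTop (nhds 0) := by
      have := ENNReal.Tendsto.const_mul hlim (Or.inr hKq.2.ne)
      rwa [mul_zero] at this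
    refine tendsto_of_tendsto_of_tendsto_of_le_of_le tendsto_const_nhds hb (fun n => zero_le)
      fun n => ?_
    simp only
    rw [edist_comm, edist_eq_enorm_sub, ← kernelOp_sub_of_memLp hpq hK hKq hF (hgm n)]
    exact (integrable_kernel_apply_of_memLp hpq hK hKq (hF.sub (hgm n)) x).2.trans
      (mul_le_mul' le_rfl (hgF n))
  have hmeas : ∀ n, AEStronglyMeasurable (kernelOp K (g n)) volume := fun n =>
    (continuous_kernelOp hK hM
      ((hgc n).integrable_of_hasCompactSupport (hgs n))).aestronglyMeasurable
  -- Fatou's lemma: the images of the approximants converge pointwise, so the bound survives in the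
  -- limit.
  have hF2 := Lp.eLpNorm_lim_le_liminf_eLpNorm (p := P) hmeas (kernelOp K F) (ae_of_all _ hpt)
  have hub : ∀ n : ℕ, eLpNorm (kernelOp K (g n)) P volume ≤
      C * (eLpNorm F P volume + ((n : ℝ≥0∞) + 1)⁻¹) := by
    intro n
    refine (h (g n) (hgc n) (hgs n)).trans (mul_le_mul' le_rfl ?_)
    have h1 : g n = F - (F - g n) := by simp
    calc eLpNorm (g n) P volume = eLpNorm (F - (F - g n)) P volume := by rw [← h1]
      _ ≤ eLpNorm F P volume + eLpNorm (F - g n) P volume :=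
        eLpNorm_sub_le hF.1 (hF.sub (hgm n)).1 hP1
      _ ≤ _ := by gcongr; exact hgF n
  have hlim2 : Filter.Tendsto (fun n : ℕ => C * (eLpNorm F P volume + ((n : ℝ≥0∞) + 1)⁻¹))
      Filter.atTop (nhds (C * eLpNorm F P volume)) := by
    have := ENNReal.Tendsto.const_mul (a := (C : ℝ≥0∞)) (hlim.const_add (eLpNorm F P volume))
      (Or.inr ENNReal.coe_ne_top)
    rwa [add_zero] at this
  calc eLpNorm (kernelOp K F) P volume
      ≤ Filter.atTop.liminf fun n => eLpNorm (kernelOp K (g n)) P volume := hF2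
    _ ≤ Filter.atTop.liminf fun n : ℕ => C * (eLpNorm F P volume + ((n : ℝ≥0∞) + 1)⁻¹) :=
        Filter.liminf_le_liminf (Filter.Eventually.of_forall hub)
    _ = C * eLpNorm F P volume := hlim2.liminf_eq

end Extension

/-! ### Duality and the range `p > 2`. -/

section Duality

variable {d : ℕ} {H₁ H₂ : Type*} [NormedAddCommGroup H₁] [InnerProductSpace ℝ H₁]
  [NormedAddCommGroup H₂] [InnerProductSpace ℝ H₂] 

/-- The field `‖W‖ ^ (p - 2) • W` is the extremal one in Hölder's inequality against `W`; it lies in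
`L^q` exactly when `W` lies in `L^p`. -/
theorem enorm_rpow_sub_two_smul {H : Type*} [NormedAddCommGroup H] [NormedSpace ℝ H] {p : ℝ}
    (hp : 1 < p) (w : H) : ‖‖w‖ ^ (p - 2) • w‖ₑ = ‖w‖ₑ ^ (p - 1) := by
  rcases eq_or_ne w 0 with rfl | hw
  · simp [ENNReal.zero_rpow_of_pos (by linarith : 0 < p - 1)]
  · have hw' : 0 < ‖w‖ := norm_pos_iff.2 hw
    rw [← ofReal_norm, norm_smul, Real.norm_of_nonneg (by positivity),
      ← ofReal_norm, ENNReal.ofReal_rpow_of_pos hw']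
    congr 1
    calc ‖w‖ ^ (p - 2) * ‖w‖ = ‖w‖ ^ (p - 2) * ‖w‖ ^ (1 : ℝ) := by rw [Real.rpow_one]
      _ = ‖w‖ ^ (p - 1) := by rw [← Real.rpow_add hw']; ring_nf

/-- The `L^p` norm is controlled by the pairing with integrable bounded functions. -/
theorem eLpNorm_le_of_forall_integral_inner_le {H : Type*} [NormedAddCommGroup H]
    [InnerProductSpace ℝ H] {W : Eucl d → H} (hW : StronglyMeasurable W) {p q : ℝ}
    (hpq : p.HolderConjugate q) {C : ℝ≥0∞}
    (h : ∀ g : Eucl d → H, Integrable g → MemLp g ∞ → Integrable (fun x => inner ℝ (g x) (W x)) →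
      ENNReal.ofReal (∫ x, inner ℝ (g x) (W x)) ≤ C * eLpNorm g (ENNReal.ofReal q) volume) :
    eLpNorm W (ENNReal.ofReal p) volume ≤ C := by
  have hp1 := hpq.lt
  have hp0 := hpq.pos
  have hq0 := hpq.symm.pos
  -- Restriction to these bounded sets, on which `W` is bounded too, makes the extremal test
  -- function integrable and bounded, and its pairing with `W` finite before any bound on `W` is
  -- known.
  set S : ℕ → Set (Eucl d) := fun N => {x | ‖x‖ ≤ N ∧ ‖W x‖ ≤ N} with hS
  have hSm : ∀ N, MeasurableSet (S N) := fun N =>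
    (measurableSet_le measurable_norm measurable_const).inter
      (measurableSet_le hW.norm.measurable measurable_const)
  have hSfin : ∀ N, volume (S N) < ∞ := fun N => by
    refine (measure_mono ?_).trans_lt (measure_closedBall_lt_top (x := (0 : Eucl d)) (r := N))
    intro x hx
    simpa using hx.1
  have hmono : Monotone S := fun m n hmn x hx =>
    ⟨hx.1.trans (by exact_mod_cast hmn), hx.2.trans (by exact_mod_cast hmn)⟩
  have hU : ⋃ N, S N = Set.univ := by
    refine Set.eq_univ_of_forall fun x => Set.mem_iUnion.2 ?_
    obtain ⟨N, hN⟩ := exists_nat_ge (max ‖x‖ ‖W x‖)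
    exact ⟨N, (le_max_left _ _).trans hN, (le_max_right _ _).trans hN⟩
  have key : ∀ N, ∫⁻ x in S N, ‖W x‖ₑ ^ p ≤ C ^ p := by
    intro N
    set X := ∫⁻ x in S N, ‖W x‖ₑ ^ p with hX
    have hbd : ∀ x ∈ S N, ‖W x‖ₑ ≤ N := fun x hx => by
      rw [← ofReal_norm]
      simpa using ENNReal.ofReal_le_ofReal hx.2
    have hXfin : X ≠ ∞ := by
      refine ne_top_of_le_ne_top (b := ((N : ℝ≥0∞) ^ p) * volume (S N)) ?_ ?_
      · exact ENNReal.mul_ne_top (ENNReal.rpow_ne_top_of_nonneg hp0.le (by simp)) (hSfin N).ne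
      · rw [← setLIntegral_const]
        exact setLIntegral_mono' (hSm N) fun x hx => ENNReal.rpow_le_rpow (hbd x hx) hp0.le
    set g : Eucl d → H := (S N).indicator fun x => ‖W x‖ ^ (p - 2) • W x with hg
    have hgm : StronglyMeasurable g := by
      have h0 : Measurable fun x => ‖W x‖ ^ (p - 2) := hW.norm.measurable.pow_const _
      exact (h0.stronglyMeasurable.smul hW).indicator (hSm N)
    have hgn : ∀ x, ‖g x‖ₑ = (S N).indicator (fun x => ‖W x‖ₑ ^ (p - 1)) x := by
      intro x
      by_cases hx : x ∈ S N
      · simp only [hg, Set.indicator_of_mem hx, enorm_rpow_sub_two_smul hp1]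
      · simp [hg, Set.indicator_of_notMem hx]
    have hgbd : ∀ x, ‖g x‖ₑ ≤ ((N : ℝ≥0∞) ^ (p - 1)) := by
      intro x
      rw [hgn]
      by_cases hx : x ∈ S N
      · rw [Set.indicator_of_mem hx]
        exact ENNReal.rpow_le_rpow (hbd x hx) (by linarith)
      · rw [Set.indicator_of_notMem hx]
        exact zero_le
    have hNfin : (N : ℝ≥0∞) ^ (p - 1) ≠ ∞ :=
      ENNReal.rpow_ne_top_of_nonneg (by linarith) (by simp)
    have hgtop : MemLp g ∞ := by
      refine memLp_top_of_bound_enorm hgm.aestronglyMeasurable ((N : ℝ≥0∞) ^ (p - 1)).toNNReal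
        (ae_of_all _ fun x => ?_)
      rw [ENNReal.coe_toNNReal hNfin]
      exact hgbd x
    have hgi : Integrable g := by
      refine ⟨hgm.aestronglyMeasurable, ?_⟩
      simp only [HasFiniteIntegral, hgn]
      rw [lintegral_indicator (hSm N)]
      refine lt_of_le_of_lt (setLIntegral_mono' (hSm N) fun x hx =>
        ENNReal.rpow_le_rpow (hbd x hx) (by linarith : 0 ≤ p - 1)) ?_
      rw [setLIntegral_const]
      exact ENNReal.mul_lt_top hNfin.lt_top (hSfin N)
    have hinner : ∀ x, inner ℝ (g x) (W x) = (S N).indicator (fun x => ‖W x‖ ^ p) x := by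
      intro x
      by_cases hx : x ∈ S N
      · simp only [hg, Set.indicator_of_mem hx, real_inner_smul_left, real_inner_self_eq_norm_sq]
        rcases eq_or_ne (W x) 0 with h0 | h0
        · simp [h0, Real.zero_rpow hp0.ne']
        · rw [← Real.rpow_two, ← Real.rpow_add (norm_pos_iff.2 h0)]; ring_nf
      · simp [hg, Set.indicator_of_notMem hx]
    have henn : ∀ x, ENNReal.ofReal (inner ℝ (g x) (W x)) =
        (S N).indicator (fun x => ‖W x‖ₑ ^ p) x := by
      intro x
      rw [hinner]
      by_cases hx : x ∈ S N
      · simp only [Set.indicator_of_mem hx]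
        rw [← ENNReal.ofReal_rpow_of_nonneg (norm_nonneg _) hp0.le, ofReal_norm]
      · simp [Set.indicator_of_notMem hx]
    have hnn : ∀ x, 0 ≤ inner ℝ (g x) (W x) := fun x => by
      rw [hinner]; exact Set.indicator_nonneg (fun _ _ => by positivity) x
    have hinm : AEStronglyMeasurable (fun x => inner ℝ (g x) (W x)) volume :=
      (hgm.inner hW).aestronglyMeasurable
    have hlint : ∫⁻ x, ENNReal.ofReal (inner ℝ (g x) (W x)) = X := by
      simp only [henn]
      rw [lintegral_indicator (hSm N)]
    have hii : Integrable fun x => inner ℝ (g x) (W x) :=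
      (lintegral_ofReal_ne_top_iff_integrable hinm (ae_of_all _ hnn)).1 (by rwa [hlint])
    have h1 := h g hgi hgtop hii
    rw [ofReal_integral_eq_lintegral_ofReal hii (ae_of_all _ hnn), hlint] at h1
    have h2 : eLpNorm g (ENNReal.ofReal q) volume = X ^ (1 / q) := by
      have h3 := lintegral_enorm_rpow_eq_eLpNorm_rpow volume g hq0
      have h4 : ∫⁻ x, ‖g x‖ₑ ^ q = X := by
        have h5 : ∀ x, ‖g x‖ₑ ^ q = (S N).indicator (fun x => ‖W x‖ₑ ^ p) x := by
          intro x
          rw [hgn]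
          by_cases hx : x ∈ S N
          · simp only [Set.indicator_of_mem hx]
            rw [← ENNReal.rpow_mul, hpq.sub_one_mul_conj]
          · simp [Set.indicator_of_notMem hx, hq0]
        simp only [h5]
        rw [lintegral_indicator (hSm N)]
      rw [← h4, h3, ← ENNReal.rpow_mul, mul_one_div_cancel hq0.ne', ENNReal.rpow_one]
    rw [h2] at h1
    rcases eq_or_ne X 0 with h0 | h0
    · rw [h0]; exact zero_le
    -- The test gave `X ≤ C * X ^ (1 / q)`, and `X` is finite and non-zero, so one may divide.
    have h6 : X ^ (1 / p) ≤ C := by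
      have h7 : X = X ^ (1 / p) * X ^ (1 / q) := by
        rw [← ENNReal.rpow_add _ _ h0 hXfin, one_div, one_div, hpq.inv_add_inv_eq_one,
          ENNReal.rpow_one]
      have h8 : X ^ (1 / q) ≠ 0 := (ENNReal.rpow_pos (pos_iff_ne_zero.2 h0) hXfin).ne'
      have h9 : X ^ (1 / q) ≠ ∞ := ENNReal.rpow_ne_top_of_nonneg (by positivity) hXfin
      have h10 : X ^ (1 / p) * X ^ (1 / q) ≤ C * X ^ (1 / q) := by rwa [← h7]
      exact (ENNReal.mul_le_mul_iff_left h8 h9).1 h10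
    calc X = (X ^ (1 / p)) ^ p := by
          rw [← ENNReal.rpow_mul, one_div_mul_cancel hp0.ne', ENNReal.rpow_one]
      _ ≤ C ^ p := ENNReal.rpow_le_rpow h6 hp0.le
  have hsup : ∫⁻ x, ‖W x‖ₑ ^ p ≤ C ^ p := by
    rw [← setLIntegral_univ, ← hU, setLIntegral_iUnion_of_directed _
      (directed_of_isDirected_le hmono)]
    exact iSup_le key
  rw [lintegral_enorm_rpow_eq_eLpNorm_rpow _ _ hp0] at hsup
  exact (ENNReal.rpow_le_rpow_iff hp0).1 hsup

variable [CompleteSpace H₁] [CompleteSpace H₂]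

/-- The kernel of the adjoint operator. -/
def adjointKernel (K : Eucl d → H₁ →L[ℝ] H₂) (x : Eucl d) : H₂ →L[ℝ] H₁ :=
  (K (-x)).adjoint

theorem adjointKernel_adjointKernel (K : Eucl d → H₁ →L[ℝ] H₂) :
    adjointKernel (adjointKernel K) = K := by
  funext x
  simp [adjointKernel]

/-- Taking adjoints is isometric, and `w ↦ -w` preserves the region in Hörmander's condition while
changing `v` into `-v`. The constant is unchanged. -/
theorem IsSingularKernel.adjointKernel {K : Eucl d → H₁ →L[ℝ] H₂} {A : ℝ≥0}
    (hK : IsSingularKernel K A) : IsSingularKernel (adjointKernel K) A where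
  continuous := (ContinuousLinearMap.adjoint (𝕜 := ℝ) (E := H₁) (F := H₂)).continuous.comp
    (hK.continuous.comp continuous_neg)
  bound := by
    obtain ⟨M, hM⟩ := hK.bound
    refine ⟨M, fun x => ?_⟩
    simpa [_root_.adjointKernel] using hM (-x)
  hormander := by
    intro ℓ hℓ v hv
    have hm : MeasurableSet {w : Eucl d | 2 * ℓ ≤ ‖w‖} :=
      measurableSet_le measurable_const measurable_norm
    refine le_trans (le_of_eq ?_) (hK.hormander ℓ hℓ (-v) (by simpa using hv))
    rw [← lintegral_indicator hm, ← lintegral_indicator hm, ← lintegral_neg_eq_self]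
    refine lintegral_congr fun w => ?_
    simp only [Set.indicator, Set.mem_ofPred_eq, norm_neg, _root_.adjointKernel, ← map_sub]
    rw [← ofReal_norm, LinearIsometryEquiv.norm_map, ofReal_norm]
    simp [add_comm]

theorem integral_inner_kernelOp {K : Eucl d → H₁ →L[ℝ] H₂} (hK : Continuous K) {M : ℝ}
    (hM : ∀ x, ‖K x‖ ≤ M) {g : Eucl d → H₁} {F : Eucl d → H₂} (hg : Integrable g)
    (hF : Integrable F) :
    ∫ x, inner ℝ (g x) (kernelOp (adjointKernel K) F x) = ∫ x, inner ℝ (kernelOp K g x) (F x) := by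
  have hKa : Continuous (adjointKernel K) :=
    (ContinuousLinearMap.adjoint (𝕜 := ℝ) (E := H₁) (F := H₂)).continuous.comp
    (hK.comp continuous_neg)
  have hMa : ∀ x, ‖adjointKernel K x‖ ≤ M := fun x => by simpa [adjointKernel] using hM (-x)
  have h1 : ∀ x, inner ℝ (g x) (kernelOp (adjointKernel K) F x) =
      ∫ y, inner ℝ (g x) (adjointKernel K (x - y) (F y)) := fun x => by
    rw [kernelOp]
    exact (integral_inner (integrable_kernel_apply hKa hMa hF x) _).symm
  have h2 : ∀ x, inner ℝ (kernelOp K g x) (F x) =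
      ∫ y, inner ℝ (g y) (adjointKernel K (y - x) (F x)) := fun x => by
    rw [kernelOp, real_inner_comm, ← integral_inner (integrable_kernel_apply hK hM hg x)]
    refine integral_congr_ae (ae_of_all _ fun y => ?_)
    simp only [adjointKernel, neg_sub, ContinuousLinearMap.adjoint_inner_right]
    exact real_inner_comm _ _
  simp only [h1, h2]
  refine integral_integral_swap ?_
  have hint : Integrable (fun z : Eucl d × Eucl d => M * (‖g z.1‖ * ‖F z.2‖))
      (volume.prod volume) := (hg.norm.mul_prod hF.norm).const_mul M
  refine hint.mono' ?_ (ae_of_all _ fun z => ?_)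
  · have hK2 : AEStronglyMeasurable (fun z : Eucl d × Eucl d => adjointKernel K (z.1 - z.2))
        (volume.prod volume) := (hKa.comp (continuous_fst.sub continuous_snd)).aestronglyMeasurable
    exact hg.1.comp_fst.inner
      ((ContinuousLinearMap.id ℝ (H₂ →L[ℝ] H₁)).aestronglyMeasurable_comp₂ hK2 hF.1.comp_snd)
  · refine (norm_inner_le_norm _ _).trans ?_
    calc ‖g z.1‖ * ‖adjointKernel K (z.1 - z.2) (F z.2)‖
        ≤ ‖g z.1‖ * (M * ‖F z.2‖) := by
          gcongr
          exact (ContinuousLinearMap.le_opNorm _ _).trans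
            (mul_le_mul_of_nonneg_right (hMa _) (norm_nonneg _))
      _ = _ := by ring

/-- For an integrable `g` the pairing with the adjoint operator is moved onto `kernelOp K g` by
Fubini, then Hölder and the assumed `L^q` bound apply. -/
theorem StrongType.adjointKernel {K : Eucl d → H₁ →L[ℝ] H₂} {A : ℝ≥0}
    (hK : IsSingularKernel K A) {p q : ℝ} (hpq : p.HolderConjugate q) {C : ℝ≥0}
    (h : StrongType K (ENNReal.ofReal q) C) :
    StrongType (adjointKernel K) (ENNReal.ofReal p) C := by
  obtain ⟨M, hM⟩ := hK.exists_norm_le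
  obtain ⟨M', hM'⟩ := hK.adjointKernel.exists_norm_le
  intro F hF hFtop
  refine eLpNorm_le_of_forall_integral_inner_le
    (continuous_kernelOp hK.adjointKernel.continuous hM' hF).stronglyMeasurable hpq
    fun g hg hgtop _ => ?_
  rw [integral_inner_kernelOp hK.continuous hM hg hF]
  have hc : ENNReal.HolderConjugate (ENNReal.ofReal q) (ENNReal.ofReal p) := hpq.symm.ennrealOfReal
  have h1 := eLpNorm_le_eLpNorm_mul_eLpNorm'_of_norm (p := ENNReal.ofReal q)
    (q := ENNReal.ofReal p) (r := 1) (μ := volume)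
    (continuous_kernelOp hK.continuous hM hg).aestronglyMeasurable
    hF.1 (fun (v w : H₂) => (inner ℝ v w : ℝ)) 1
    (ae_of_all volume fun y => by simpa using norm_inner_le_norm (𝕜 := ℝ) (kernelOp K g y) (F y))
  simp only [ENNReal.coe_one, one_mul, eLpNorm_one_eq_lintegral_enorm] at h1
  calc ENNReal.ofReal (∫ x, inner ℝ (kernelOp K g x) (F x))
      ≤ ‖∫ x, inner ℝ (kernelOp K g x) (F x)‖ₑ := Real.ofReal_le_enorm _
    _ ≤ eLpNorm (kernelOp K g) (ENNReal.ofReal q) volume * eLpNorm F (ENNReal.ofReal p) volume :=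
        (enorm_integral_le_lintegral_enorm _).trans h1
    _ ≤ C * eLpNorm g (ENNReal.ofReal q) volume * eLpNorm F (ENNReal.ofReal p) volume := by
        gcongr; exact h g hg hgtop
    _ = _ := by ring

theorem strongType_of_lt_two {K : Eucl d → H₁ →L[ℝ] H₂} {A A₂ : ℝ≥0}
    (hK : IsSingularKernel K A) (h2 : StrongType K 2 A₂) (hd : d ≠ 0) {p : ℝ} (hp : 1 < p)
    (hp2 : p < 2) : StrongType K (ENNReal.ofReal p) (czConst d A A₂ p) := by
  obtain ⟨M, hM⟩ := hK.exists_norm_le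
  obtain ⟨M', hM'⟩ := hK.bound
  have hpq := Real.HolderConjugate.conjExponent hp
  intro F hF hFtop
  exact eLpNorm_kernelOp_le_of_dense hpq hK.continuous hM
    (memLp_of_norm_le_decay hK.continuous hM' hpq.symm.lt.le)
    (fun F hF hFs => eLpNorm_kernelOp_le_of_continuous hK h2 hd hp hp2 hF hFs)
    (memLp_of_integrable_of_memLp_top hF hFtop hp.le)

/-- The constant in the Calderón–Zygmund theorem for `1 < p < ∞`. -/
def czBound (d : ℕ) (A A₂ : ℝ≥0) (p : ℝ) : ℝ≥0 :=
  if p < 2 then czConst d A A₂ p else if p = 2 then A₂ else czConst d A A₂ p.conjExponent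

/-- The Calderón–Zygmund theorem. -/
theorem eLpNorm_kernelOp_le {K : Eucl d → H₁ →L[ℝ] H₂} {A A₂ : ℝ≥0}
    (hK : IsSingularKernel K A) (h2 : StrongType K 2 A₂) (hd : d ≠ 0) {p : ℝ} (hp : 1 < p)
    {F : Eucl d → H₁} (hF : MemLp F (ENNReal.ofReal p)) :
    eLpNorm (kernelOp K F) (ENNReal.ofReal p) volume ≤
      czBound d A A₂ p * eLpNorm F (ENNReal.ofReal p) volume := by
  have hpq := Real.HolderConjugate.conjExponent hp
  have h : StrongType K (ENNReal.ofReal p) (czBound d A A₂ p) := by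
    rcases lt_trichotomy p 2 with h | rfl | h
    · rw [czBound, if_pos h]
      exact strongType_of_lt_two hK h2 hd hp h
    · rw [czBound, if_neg (lt_irrefl _), if_pos rfl]
      simpa using h2
    · rw [czBound, if_neg (not_lt.2 h.le), if_neg h.ne']
      -- For `p > 2` the conjugate exponent is below `2`. The adjoint kernel has the same constants,
      -- so it is bounded on the conjugate space, and a second duality returns to `K`.
      have h2' : StrongType (adjointKernel K) 2 A₂ := by
        have := StrongType.adjointKernel (p := 2) (q := 2) hK
          Real.HolderConjugate.two_two (C := A₂) (by simpa using h2)
        simpa using this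
      have hq2 : p.conjExponent < 2 := by
        rw [Real.conjExponent, div_lt_iff₀ (by linarith)]
        linarith
      have h3 := strongType_of_lt_two hK.adjointKernel h2' hd hpq.symm.lt hq2
      have h4 := StrongType.adjointKernel hK.adjointKernel hpq h3
      rwa [adjointKernel_adjointKernel] at h4
  obtain ⟨M, hM⟩ := hK.exists_norm_le
  obtain ⟨M', hM'⟩ := hK.bound
  refine eLpNorm_kernelOp_le_of_dense hpq hK.continuous hM
    (memLp_of_norm_le_decay hK.continuous hM' hpq.symm.lt.le) (fun G hG hGs => ?_) hF
  refine h G (hG.integrable_of_hasCompactSupport hGs) ?_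
  obtain ⟨B, hB⟩ := hG.bounded_above_of_compact_support hGs
  exact memLp_top_of_bound hG.aestronglyMeasurable B (ae_of_all _ hB)

end Duality

/-! ### Homogeneous kernels -/

section HomKernel

variable {d : ℕ}

/-- A function on `ℝ^d × ℝ` that is `C^n` off the origin and homogeneous of degree `-(d+1)`. -/
structure IsHomKernel {d : ℕ} (n : WithTop ℕ∞) (κ : Eucl d × ℝ → ℝ) : Prop where
  contDiffOn : ContDiffOn ℝ n κ {0}ᶜ
  hom : ∀ r : ℝ, 0 < r → ∀ z : Eucl d × ℝ, z ≠ 0 → κ (r • z) = (r ^ (d + 1))⁻¹ * κ z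

theorem IsHomKernel.contDiffAt {n : WithTop ℕ∞} {κ : Eucl d × ℝ → ℝ} (h : IsHomKernel n κ)
    {z : Eucl d × ℝ} (hz : z ≠ 0) : ContDiffAt ℝ n κ z :=
  (h.contDiffOn z hz).contDiffAt (isOpen_compl_singleton.mem_nhds hz)

theorem IsHomKernel.differentiableAt {n : WithTop ℕ∞} (hn : n ≠ 0) {κ : Eucl d × ℝ → ℝ}
    (h : IsHomKernel n κ) {z : Eucl d × ℝ} (hz : z ≠ 0) : DifferentiableAt ℝ κ z :=
  (h.contDiffAt hz).differentiableAt hn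

theorem IsHomKernel.continuousOn {n : WithTop ℕ∞} {κ : Eucl d × ℝ → ℝ} (h : IsHomKernel n κ) :
    ContinuousOn κ {0}ᶜ := h.contDiffOn.continuousOn

theorem IsHomKernel.measurable {n : WithTop ℕ∞} {κ : Eucl d × ℝ → ℝ} (h : IsHomKernel n κ) :
    Measurable κ := measurable_of_continuousOn_compl_singleton 0 h.continuousOn

theorem IsHomKernel.of_le {m n : WithTop ℕ∞} (hmn : m ≤ n) {κ : Eucl d × ℝ → ℝ}
    (h : IsHomKernel n κ) : IsHomKernel m κ := ⟨h.contDiffOn.of_le hmn, h.hom⟩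

/-- The two sides of the homogeneity relation are differentiated in `z`; the chain rule costs one
power of `r`. -/
theorem IsHomKernel.fderiv_smul {n : WithTop ℕ∞} (hn : n ≠ 0) {κ : Eucl d × ℝ → ℝ}
    (h : IsHomKernel n κ) {r : ℝ} (hr : 0 < r) {z : Eucl d × ℝ} (hz : z ≠ 0) :
    fderiv ℝ κ (r • z) = (r ^ (d + 2))⁻¹ • fderiv ℝ κ z := by
  have hrz : r • z ≠ 0 := smul_ne_zero hr.ne' hz
  have h1 : HasFDerivAt (fun w => κ (r • w))
      ((fderiv ℝ κ (r • z)).comp (r • ContinuousLinearMap.id ℝ (Eucl d × ℝ))) z :=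
    (h.differentiableAt hn hrz).hasFDerivAt.comp z ((hasFDerivAt_id z).const_smul r)
  have h2 : HasFDerivAt (fun w => κ (r • w)) ((r ^ (d + 1))⁻¹ • fderiv ℝ κ z) z := by
    refine ((h.differentiableAt hn hz).hasFDerivAt.const_mul ((r ^ (d + 1))⁻¹)).congr_of_eventuallyEq ?_
    filter_upwards [isOpen_compl_singleton.mem_nhds hz] with w hw
    exact h.hom r hr w hw
  have h3 := h1.unique h2
  refine ContinuousLinearMap.ext fun v => ?_
  have h4 := congrArg (fun T : (Eucl d × ℝ) →L[ℝ] ℝ => T v) h3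
  simp only [ContinuousLinearMap.comp_apply, smul_apply, ContinuousLinearMap.id_apply, map_smul,
    smul_eq_mul] at h4 ⊢
  have hr0 := hr.ne'
  field_simp at h4 ⊢
  rw [← h4]
  ring

/-- The kernel and its derivative are bounded on the compact unit sphere, and homogeneity carries
the bounds to every `z ≠ 0`. -/
theorem IsHomKernel.exists_bound {n : WithTop ℕ∞} (hn : n ≠ 0) {κ : Eucl d × ℝ → ℝ}
    (h : IsHomKernel n κ) : ∃ C : ℝ, 0 ≤ C ∧ ∀ z : Eucl d × ℝ, z ≠ 0 →
      |κ z| ≤ C / ‖z‖ ^ (d + 1) ∧ ‖fderiv ℝ κ z‖ ≤ C / ‖z‖ ^ (d + 2) := by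
  have hsub : Metric.sphere (0 : Eucl d × ℝ) 1 ⊆ {0}ᶜ := fun z hz h0 => by
    rw [Set.mem_singleton_iff] at h0
    simp [h0] at hz
  have hone : 1 ≤ n := ENat.one_le_iff_ne_zero_withTop.2 hn
  obtain ⟨C₁, hC₁⟩ := (isCompact_sphere (0 : Eucl d × ℝ) 1).exists_bound_of_continuousOn
    (h.continuousOn.mono hsub)
  obtain ⟨C₂, hC₂⟩ := (isCompact_sphere (0 : Eucl d × ℝ) 1).exists_bound_of_continuousOn
    ((h.contDiffOn.continuousOn_fderiv_of_isOpen isOpen_compl_singleton hone).mono hsub)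
  refine ⟨max 0 (max C₁ C₂), le_max_left _ _, fun z hz => ?_⟩
  have hz' : 0 < ‖z‖ := norm_pos_iff.2 hz
  set w := ‖z‖⁻¹ • z with hw
  have hws : w ∈ Metric.sphere (0 : Eucl d × ℝ) 1 := by
    rw [mem_sphere_zero_iff_norm, hw, norm_smul, norm_inv, norm_norm, inv_mul_cancel₀ hz'.ne']
  have hw0 : w ≠ 0 := hsub hws
  have hzw : z = ‖z‖ • w := by rw [hw, smul_smul, mul_inv_cancel₀ hz'.ne', one_smul]
  constructor
  · calc |κ z| = (‖z‖ ^ (d + 1))⁻¹ * ‖κ w‖ := by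
          conv_lhs => rw [hzw]
          rw [h.hom _ hz' w hw0, abs_mul, abs_of_nonneg (by positivity), Real.norm_eq_abs]
      _ ≤ (‖z‖ ^ (d + 1))⁻¹ * max 0 (max C₁ C₂) := by
          gcongr
          exact (hC₁ w hws).trans ((le_max_left _ _).trans (le_max_right _ _))
      _ = _ := by rw [mul_comm, div_eq_mul_inv]
  · calc ‖fderiv ℝ κ z‖ = (‖z‖ ^ (d + 2))⁻¹ * ‖fderiv ℝ κ w‖ := by
          conv_lhs => rw [hzw]
          rw [h.fderiv_smul hn hz' hw0, norm_smul, Real.norm_of_nonneg (by positivity)]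
      _ ≤ (‖z‖ ^ (d + 2))⁻¹ * max 0 (max C₁ C₂) := by
          gcongr
          exact (hC₂ w hws).trans ((le_max_right _ _).trans (le_max_right _ _))
      _ = _ := by rw [mul_comm, div_eq_mul_inv]

/-- Mean value inequality on the ball of radius `‖x‖ / 2` about `(x, t)`. Its points have norm at
least `‖(x, t)‖ / 2`, whence the factor `2 ^ (d + 2)`. -/
theorem IsHomKernel.exists_bound_sub {n : WithTop ℕ∞} (hn : n ≠ 0) {κ : Eucl d × ℝ → ℝ}
    (h : IsHomKernel n κ) : ∃ C : ℝ, 0 ≤ C ∧ ∀ (x y : Eucl d) (t : ℝ), x ≠ 0 → 2 * ‖y‖ ≤ ‖x‖ →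
      |κ (x - y, t) - κ (x, t)| ≤ C * ‖y‖ / ‖(x, t)‖ ^ (d + 2) := by
  obtain ⟨C, hC0, hC⟩ := h.exists_bound hn
  refine ⟨C * 2 ^ (d + 2), by positivity, fun x y t hx hxy => ?_⟩
  have hxp : 0 < ‖x‖ := norm_pos_iff.2 hx
  have hle : ‖x‖ ≤ ‖(x, t)‖ := le_max_left _ _
  have hz : ∀ z ∈ Metric.closedBall (x, t) (‖x‖ / 2), ‖(x, t)‖ / 2 ≤ ‖z‖ := by
    intro z hz
    rw [mem_closedBall_iff_norm] at hz
    have h1 : ‖(x, t)‖ ≤ ‖z‖ + ‖z - (x, t)‖ := by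
      rw [norm_sub_rev]
      simpa using norm_add_le z ((x, t) - z)
    linarith
  have hz0 : ∀ z ∈ Metric.closedBall (x, t) (‖x‖ / 2), z ≠ 0 := fun z hz1 =>
    norm_pos_iff.1 (by linarith [hz z hz1])
  have hmem : (x - y, t) ∈ Metric.closedBall (x, t) (‖x‖ / 2) := by
    rw [mem_closedBall_iff_norm, Prod.mk_sub_mk]
    simp only [sub_sub_cancel_left, sub_self, Prod.norm_mk, norm_neg, norm_zero]
    exact max_le (by linarith) (by positivity)
  have hpos : 0 < ‖(x, t)‖ := by linarith
  have h2 := (convex_closedBall (x, t) (‖x‖ / 2)).norm_image_sub_le_of_norm_fderiv_le (𝕜 := ℝ)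
    (f := κ) (C := C * 2 ^ (d + 2) / ‖(x, t)‖ ^ (d + 2)) (fun z hz1 => h.differentiableAt hn (hz0 z hz1))
    (fun z hz1 => ((hC z (hz0 z hz1)).2).trans ?_) (Metric.mem_closedBall_self (by positivity)) hmem
  · rw [Prod.mk_sub_mk] at h2
    simp only [sub_sub_cancel_left, sub_self, Prod.norm_mk, norm_neg, norm_zero] at h2
    rw [max_eq_left (norm_nonneg y)] at h2
    refine h2.trans (le_of_eq ?_)
    rw [Prod.norm_mk]
    ring
  · have h3 := hz z hz1
    have h4 : (‖(x, t)‖ / 2) ^ (d + 2) ≤ ‖z‖ ^ (d + 2) := by gcongr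
    rw [div_pow] at h4
    calc C / ‖z‖ ^ (d + 2) ≤ C / (‖(x, t)‖ ^ (d + 2) / 2 ^ (d + 2)) := by gcongr
      _ = _ := by field_simp

/-- Decay of a homogeneous kernel in `x`, locally uniformly in `t > 0`. -/
theorem div_norm_prod_le_decay {C a : ℝ} (hC : 0 ≤ C) (ha : 0 < a) (x : Eucl d) {t : ℝ}
    (hat : a ≤ t) : C / ‖(x, t)‖ ^ (d + 1) ≤
      C * (2 / min 1 a) ^ (d + 1) * (1 + ‖x‖) ^ (-((d : ℝ) + 1)) := by
  have hm : 0 < min 1 a := lt_min one_pos ha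
  have h1 : min 1 a / 2 * (1 + ‖x‖) ≤ ‖(x, t)‖ := by
    have hx : ‖x‖ ≤ ‖(x, t)‖ := le_max_left _ _
    have ht : a ≤ ‖(x, t)‖ := hat.trans ((le_abs_self t).trans (le_max_right _ _))
    have h2 : min 1 a * ‖x‖ ≤ ‖x‖ := mul_le_of_le_one_left (norm_nonneg _) (min_le_left _ _)
    have h3 : min 1 a ≤ a := min_le_right _ _
    linarith
  have h4 : (1 + ‖x‖) ^ (-((d : ℝ) + 1)) = ((1 + ‖x‖) ^ (d + 1))⁻¹ := by
    rw [Real.rpow_neg (by positivity), ← Nat.cast_add_one, Real.rpow_natCast]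
  rw [h4]
  calc C / ‖(x, t)‖ ^ (d + 1) ≤ C / (min 1 a / 2 * (1 + ‖x‖)) ^ (d + 1) := by gcongr
    _ = _ := by
      rw [mul_pow, div_pow, div_pow]
      field_simp

theorem prod_ne_zero_of_pos {x : Eucl d} {t : ℝ} (ht : 0 < t) : (x, t) ≠ 0 := fun h =>
  ht.ne' (congrArg Prod.snd h)

theorem IsHomKernel.continuous_slice {n : WithTop ℕ∞} {κ : Eucl d × ℝ → ℝ}
    (h : IsHomKernel n κ) {t : ℝ} (ht : 0 < t) : Continuous fun x => κ (x, t) :=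
  h.continuousOn.comp_continuous (by fun_prop) fun _ => prod_ne_zero_of_pos ht

/-- The convolution of `f` with the kernel `κ (·, t)`. -/
def kernelConv (κ : Eucl d × ℝ → ℝ) (f : Eucl d → ℝ) (x : Eucl d) (t : ℝ) : ℝ :=
  ∫ y, κ (x - y, t) * f y

theorem kernelConv_congr {κ : Eucl d × ℝ → ℝ} {f g : Eucl d → ℝ} (h : f =ᵐ[volume] g) :
    kernelConv κ f = kernelConv κ g := by
  funext x t
  exact integral_congr_ae (h.mono fun y hy => by simp only [hy])

theorem measurable_kernelConv {κ : Eucl d × ℝ → ℝ} (hκ : Measurable κ) {f : Eucl d → ℝ}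
    (hf : AEStronglyMeasurable f volume) :
    Measurable fun z : Eucl d × ℝ => kernelConv κ f z.1 z.2 := by
  rw [kernelConv_congr hf.ae_eq_mk]
  have hfm := hf.stronglyMeasurable_mk.measurable
  have h1 : Measurable fun w : (Eucl d × ℝ) × Eucl d =>
      κ (w.1.1 - w.2, w.1.2) * hf.mk f w.2 :=
    (hκ.comp (by fun_prop)).mul (hfm.comp measurable_snd)
  exact h1.stronglyMeasurable.integral_prod_right'.measurable

end HomKernel

/-! ### The vector valued kernel of a square function -/

section VectorKernel

variable {d : ℕ}

/-- Lebesgue measure on the type of points of `[a, b]`. -/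
def iccMeasure (a b : ℝ) : Measure (Set.Icc a b) := Measure.comap Subtype.val volume

instance (a b : ℝ) : IsFiniteMeasure (iccMeasure a b) := by
  refine ⟨?_⟩
  have h := lintegral_subtype_comap (μ := volume) (measurableSet_Icc (a := a) (b := b)) fun _ => 1
  rw [lintegral_one, setLIntegral_one] at h
  rw [iccMeasure, h]
  exact measure_Icc_lt_top

/-- The continuous map `x ↦ (t ↦ √t κ(x, t))` with values in the continuous functions on `[a, b]`. -/
def kernelMap {κ : Eucl d × ℝ → ℝ} (h : IsHomKernel 1 κ) {a : ℝ} (ha : 0 < a) (b : ℝ) :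
    C(Eucl d, C(Set.Icc a b, ℝ)) :=
  ContinuousMap.curry ⟨fun z => √(z.2 : ℝ) * κ (z.1, (z.2 : ℝ)), by
    refine (Real.continuous_sqrt.comp (by fun_prop)).mul ?_
    exact h.continuousOn.comp_continuous (by fun_prop) fun z =>
      prod_ne_zero_of_pos (ha.trans_le z.2.2.1)⟩

theorem kernelMap_apply {κ : Eucl d × ℝ → ℝ} (h : IsHomKernel 1 κ) {a : ℝ} (ha : 0 < a) (b : ℝ)
    (x : Eucl d) (t : Set.Icc a b) : kernelMap h ha b x t = √(t : ℝ) * κ (x, (t : ℝ)) := rfl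

/-- The kernel `kernelMap`, with values in operators. -/
def kernelCM {κ : Eucl d × ℝ → ℝ} (h : IsHomKernel 1 κ) {a : ℝ} (ha : 0 < a) (b : ℝ)
    (x : Eucl d) : ℝ →L[ℝ] C(Set.Icc a b, ℝ) :=
  ContinuousLinearMap.toSpanSingleton ℝ (kernelMap h ha b x)

/-- The `L^2` valued kernel of the square function truncated to `[a, b]`. -/
def vecKernel {κ : Eucl d × ℝ → ℝ} (h : IsHomKernel 1 κ) {a : ℝ} (ha : 0 < a) (b : ℝ)
    (x : Eucl d) : ℝ →L[ℝ] Lp ℝ 2 (iccMeasure a b) :=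
  (ContinuousMap.toLp 2 (iccMeasure a b) ℝ).comp (kernelCM h ha b x)

theorem continuous_kernelCM {κ : Eucl d × ℝ → ℝ} (h : IsHomKernel 1 κ) {a : ℝ} (ha : 0 < a)
    (b : ℝ) : Continuous (kernelCM h ha b) :=
  (ContinuousLinearMap.toSpanSingletonCLE (𝕜 := ℝ) (E := C(Set.Icc a b, ℝ))).continuous.comp
    (kernelMap h ha b).continuous

/-- Continuity and decay are checked for the uniform norm on `[a, b]`, where currying and pointwise
bounds suffice, and then pass through the bounded inclusion into `L²`. -/
theorem continuous_vecKernel {κ : Eucl d × ℝ → ℝ} (h : IsHomKernel 1 κ) {a : ℝ} (ha : 0 < a)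
    (b : ℝ) : Continuous (vecKernel h ha b) :=
  continuous_const.clm_comp (continuous_kernelCM h ha b)

theorem exists_norm_kernelCM_le {κ : Eucl d × ℝ → ℝ} (h : IsHomKernel 1 κ) {a : ℝ} (ha : 0 < a)
    (b : ℝ) : ∃ M : ℝ, ∀ x, ‖kernelCM h ha b x‖ ≤ M * (1 + ‖x‖) ^ (-((d : ℝ) + 1)) := by
  obtain ⟨C, hC0, hC⟩ := h.exists_bound one_ne_zero
  refine ⟨√b * (C * (2 / min 1 a) ^ (d + 1)), fun x => ?_⟩
  have hm : 0 < min 1 a := lt_min one_pos ha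
  rw [kernelCM, ContinuousLinearMap.norm_toSpanSingleton,
    ContinuousMap.norm_le _ (by positivity)]
  intro t
  rw [kernelMap_apply, norm_mul, Real.norm_of_nonneg (Real.sqrt_nonneg _), mul_assoc]
  have ht := ha.trans_le t.2.1
  exact mul_le_mul (Real.sqrt_le_sqrt t.2.2)
    (((hC _ (prod_ne_zero_of_pos ht)).1).trans (div_norm_prod_le_decay hC0 ha x t.2.1))
    (norm_nonneg _) (Real.sqrt_nonneg _)

theorem exists_norm_vecKernel_le {κ : Eucl d × ℝ → ℝ} (h : IsHomKernel 1 κ) {a : ℝ} (ha : 0 < a)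
    (b : ℝ) : ∃ M : ℝ, ∀ x, ‖vecKernel h ha b x‖ ≤ M * (1 + ‖x‖) ^ (-((d : ℝ) + 1)) := by
  obtain ⟨M, hM⟩ := exists_norm_kernelCM_le h ha b
  refine ⟨‖ContinuousMap.toLp (E := ℝ) 2 (iccMeasure a b) ℝ‖ * M, fun x => ?_⟩
  refine (ContinuousLinearMap.opNorm_comp_le _ _).trans ?_
  rw [mul_assoc]
  exact mul_le_mul_of_nonneg_left (hM x) (norm_nonneg _)

theorem enorm_toLp_sq {a b : ℝ} (g : C(Set.Icc a b, ℝ)) {G : ℝ → ℝ} (hg : ∀ t : Set.Icc a b,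
    g t = G t) : ‖ContinuousMap.toLp 2 (iccMeasure a b) ℝ g‖ₑ ^ 2 =
      ∫⁻ t in Set.Icc a b, ‖G t‖ₑ ^ 2 := by
  rw [Lp.enorm_def, eLpNorm_congr_ae (ContinuousMap.coeFn_toLp (iccMeasure a b) g)]
  have h1 := lintegral_enorm_rpow_eq_eLpNorm_rpow (iccMeasure a b) g zero_lt_two
  simp only [ENNReal.ofReal_ofNat, ENNReal.rpow_two] at h1
  rw [← h1, iccMeasure, ← lintegral_subtype_comap (μ := volume) measurableSet_Icc fun t => ‖G t‖ₑ ^ 2]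
  exact lintegral_congr fun t => by rw [hg]

/-- The integrand has antiderivative `-1 / (2 (r² + t²))`. This integral is what remains of the
`t`-variable in Hörmander's condition. -/
theorem integral_id_div_sq_add_sq {r : ℝ} (hr : 0 < r) :
    IntegrableOn (fun t : ℝ => t / (r ^ 2 + t ^ 2) ^ 2) (Set.Ioi 0) ∧
    ∫ t in Set.Ioi (0 : ℝ), t / (r ^ 2 + t ^ 2) ^ 2 = 1 / (2 * r ^ 2) := by
  have hd : ∀ t ∈ Set.Ici (0 : ℝ), HasDerivAt (fun t : ℝ => -(1 / 2) * (r ^ 2 + t ^ 2)⁻¹)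
      (t / (r ^ 2 + t ^ 2) ^ 2) t := by
    intro t _
    have hne : r ^ 2 + t ^ 2 ≠ 0 := by positivity
    have h1 : HasDerivAt (fun t : ℝ => r ^ 2 + t ^ 2) (2 * t) t := by
      simpa using (hasDerivAt_pow 2 t).const_add (r ^ 2)
    refine ((h1.inv hne).const_mul (-(1 / 2))).congr_deriv ?_
    field_simp
  have hpos : ∀ t ∈ Set.Ioi (0 : ℝ), 0 ≤ t / (r ^ 2 + t ^ 2) ^ 2 := fun t ht => by
    have : (0 : ℝ) < t := ht
    positivity
  have hlim : Filter.Tendsto (fun t : ℝ => -(1 / 2) * (r ^ 2 + t ^ 2)⁻¹) Filter.atTop (nhds 0) := by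
    have h1 : Filter.Tendsto (fun t : ℝ => r ^ 2 + t ^ 2) Filter.atTop Filter.atTop :=
      Filter.tendsto_atTop_add_const_left _ _ (Filter.tendsto_pow_atTop two_ne_zero)
    have := (Filter.Tendsto.inv_tendsto_atTop h1).const_mul (-(1 / 2) : ℝ)
    simpa using this
  refine ⟨integrableOn_Ioi_deriv_of_nonneg' hd hpos hlim, ?_⟩
  rw [integral_Ioi_of_hasDerivAt_of_nonneg' hd hpos hlim]
  field_simp
  norm_num

/-- The integral is invariant under scaling by `ℓ`. Where `2 * ℓ ≤ ‖w‖` one has `ℓ + ‖w‖ ≤ 2 * ‖w‖`,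
so the integrand is dominated by a rescaled copy of the integrable `(1 + ‖x‖) ^ (-(d + 1))`. -/
theorem exists_lintegral_norm_rpow_le (d : ℕ) : ∃ I : ℝ≥0, ∀ ℓ : ℝ, 0 < ℓ →
    ∫⁻ w in {w : Eucl d | 2 * ℓ ≤ ‖w‖}, ENNReal.ofReal (ℓ / ‖w‖ ^ (d + 1)) ≤ I := by
  have hI := integrable_decay d
  refine ⟨(2 ^ (d + 1) * ∫ x : Eucl d, (1 + ‖x‖) ^ (-((d : ℝ) + 1))).toNNReal, fun ℓ hℓ => ?_⟩
  set g : Eucl d → ℝ := fun x => 2 ^ (d + 1) * (ℓ ^ d)⁻¹ * (1 + ‖ℓ⁻¹ • x‖) ^ (-((d : ℝ) + 1)) with hg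
  have hgi : Integrable g := (hI.comp_smul (inv_ne_zero hℓ.ne')).const_mul _
  have hg0 : ∀ x, 0 ≤ g x := fun x => by positivity
  have hm : MeasurableSet {w : Eucl d | 2 * ℓ ≤ ‖w‖} :=
    measurableSet_le measurable_const measurable_norm
  have hle : ∀ w ∈ {w : Eucl d | 2 * ℓ ≤ ‖w‖}, ENNReal.ofReal (ℓ / ‖w‖ ^ (d + 1)) ≤
      ENNReal.ofReal (g w) := by
    intro w hw
    have hw' : 2 * ℓ ≤ ‖w‖ := hw
    refine ENNReal.ofReal_le_ofReal ?_
    have h1 : 1 + ‖ℓ⁻¹ • w‖ = (ℓ + ‖w‖) / ℓ := by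
      rw [norm_smul, norm_inv, Real.norm_of_nonneg hℓ.le]
      field_simp
    have hwp : 0 < ‖w‖ := by linarith
    simp only [hg, h1]
    rw [Real.rpow_neg (by positivity), ← Nat.cast_add_one, Real.rpow_natCast, div_pow, inv_div]
    have h2 : (ℓ + ‖w‖) ^ (d + 1) ≤ (2 * ‖w‖) ^ (d + 1) := by
      gcongr
      linarith
    rw [mul_pow] at h2
    calc ℓ / ‖w‖ ^ (d + 1) = 2 ^ (d + 1) * ℓ / (2 ^ (d + 1) * ‖w‖ ^ (d + 1)) := by
          field_simp
      _ ≤ 2 ^ (d + 1) * ℓ / (ℓ + ‖w‖) ^ (d + 1) := by gcongr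
      _ = _ := by
          rw [pow_succ ℓ d]
          field_simp
  calc ∫⁻ w in {w : Eucl d | 2 * ℓ ≤ ‖w‖}, ENNReal.ofReal (ℓ / ‖w‖ ^ (d + 1))
      ≤ ∫⁻ w, ENNReal.ofReal (g w) := (setLIntegral_mono' hm hle).trans
        (setLIntegral_le_lintegral _ _)
    _ = ENNReal.ofReal (∫ w, g w) :=
        (ofReal_integral_eq_lintegral_ofReal hgi (ae_of_all _ hg0)).symm
    _ = _ := by
        rw [integral_const_mul, Measure.integral_comp_inv_smul_of_nonneg volume
          (fun x : Eucl d => (1 + ‖x‖) ^ (-((d : ℝ) + 1))) hℓ.le, finrank_euclideanSpace_fin,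
          smul_eq_mul]
        change _ = ENNReal.ofReal _
        congr 1
        field_simp

theorem enorm_vecKernel_sub_sq {κ : Eucl d × ℝ → ℝ} (h : IsHomKernel 1 κ) {a : ℝ} (ha : 0 < a)
    (b : ℝ) (x y : Eucl d) : ‖vecKernel h ha b x - vecKernel h ha b y‖ₑ ^ 2 =
      ∫⁻ t in Set.Icc a b, ENNReal.ofReal t * ‖κ (x, t) - κ (y, t)‖ₑ ^ 2 := by
  have h1 : vecKernel h ha b x - vecKernel h ha b y = ContinuousLinearMap.toSpanSingleton ℝ
      (ContinuousMap.toLp 2 (iccMeasure a b) ℝ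
        (kernelMap h ha b x - kernelMap h ha b y)) := by
    ext1
    simp [vecKernel, kernelCM]
  have h2 : ‖vecKernel h ha b x - vecKernel h ha b y‖ₑ =
      ‖ContinuousMap.toLp 2 (iccMeasure a b) ℝ
        (kernelMap h ha b x - kernelMap h ha b y)‖ₑ := by
    rw [h1, ← ofReal_norm, ContinuousLinearMap.norm_toSpanSingleton, ofReal_norm]
  rw [h2, enorm_toLp_sq _ (G := fun t => √t * (κ (x, t) - κ (y, t)))]
  · refine setLIntegral_congr_fun measurableSet_Icc fun t ht => ?_
    have ht0 : 0 ≤ t := ha.le.trans ht.1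
    simp only [enorm_mul, mul_pow]
    rw [Real.enorm_of_nonneg (Real.sqrt_nonneg _), ← ENNReal.ofReal_pow (Real.sqrt_nonneg _),
      Real.sq_sqrt ht0]
  · intro t
    rw [ContinuousMap.sub_apply, kernelMap_apply, kernelMap_apply, mul_sub]

/-- Homogeneous kernels give rise to singular kernels, uniformly in the truncation. -/
theorem exists_isSingularKernel_vecKernel {κ : Eucl d × ℝ → ℝ} (h : IsHomKernel 1 κ) :
    ∃ A : ℝ≥0, ∀ (a : ℝ) (ha : 0 < a) (b : ℝ), IsSingularKernel (vecKernel h ha b) A := by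
  obtain ⟨C, hC0, hC⟩ := h.exists_bound_sub one_ne_zero
  obtain ⟨I, hI⟩ := exists_lintegral_norm_rpow_le d
  refine ⟨(2 * C).toNNReal * I, fun a ha b => ⟨continuous_vecKernel h ha b,
    exists_norm_vecKernel_le h ha b, fun ℓ hℓ v hv => ?_⟩⟩
  have hm : MeasurableSet {w : Eucl d | 2 * ℓ ≤ ‖w‖} :=
    measurableSet_le measurable_const measurable_norm
  have key : ∀ w ∈ {w : Eucl d | 2 * ℓ ≤ ‖w‖}, ‖vecKernel h ha b (w - v) - vecKernel h ha b w‖ₑ ≤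
      ENNReal.ofReal (2 * C) * ENNReal.ofReal (ℓ / ‖w‖ ^ (d + 1)) := by
    intro w hw
    have hw' : 2 * ℓ ≤ ‖w‖ := hw
    have hwp : 0 < ‖w‖ := by linarith
    have hint := integral_id_div_sq_add_sq hwp
    rw [← ENNReal.ofReal_mul (by positivity)]
    refine (ENNReal.pow_le_pow_left_iff two_ne_zero).1 ?_
    rw [enorm_vecKernel_sub_sq, ← ENNReal.ofReal_pow (by positivity)]
    -- Since `‖(w, t)‖` is a maximum, `‖(w, t)‖ ^ (d + 2) ≥ ‖w‖ ^ d * (‖w‖ ^ 2 + t ^ 2) / 2`, so the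
    -- difference of the kernel is at most `D / (‖w‖ ^ 2 + t ^ 2)`. Enlarging `[a, b]` to the half
    -- line then removes `a` and `b` from the bound.
    set D := C * ℓ / ‖w‖ ^ d * 2 with hD
    have hpt : ∀ t ∈ Set.Icc a b, ENNReal.ofReal t * ‖κ (w - v, t) - κ (w, t)‖ₑ ^ 2 ≤
        ENNReal.ofReal (D ^ 2 * (t / (‖w‖ ^ 2 + t ^ 2) ^ 2)) := by
      intro t ht
      have ht0 : 0 < t := ha.trans_le ht.1
      rw [← ofReal_norm, ← ENNReal.ofReal_pow (norm_nonneg _), ← ENNReal.ofReal_mul ht0.le]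
      refine ENNReal.ofReal_le_ofReal ?_
      have h1 := hC w v t (norm_pos_iff.1 hwp) (by linarith)
      have hn1 : ‖w‖ ≤ ‖(w, t)‖ := le_max_left _ _
      have hn2 : t ≤ ‖(w, t)‖ := (le_abs_self t).trans (le_max_right _ _)
      have h2 : (‖w‖ ^ 2 + t ^ 2) / 2 ≤ ‖(w, t)‖ ^ 2 := by
        have e1 : ‖w‖ ^ 2 ≤ ‖(w, t)‖ ^ 2 := by gcongr
        have e2 : t ^ 2 ≤ ‖(w, t)‖ ^ 2 := by gcongr
        linarith
      have h3 : C * ‖v‖ / ‖(w, t)‖ ^ (d + 2) ≤ D / (‖w‖ ^ 2 + t ^ 2) := by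
        calc C * ‖v‖ / ‖(w, t)‖ ^ (d + 2)
            ≤ C * ℓ / (‖w‖ ^ d * ((‖w‖ ^ 2 + t ^ 2) / 2)) := by
              rw [pow_add]
              gcongr
          _ = _ := by rw [hD]; field_simp
      have h4 : ‖κ (w - v, t) - κ (w, t)‖ ^ 2 ≤ (D / (‖w‖ ^ 2 + t ^ 2)) ^ 2 := by
        gcongr
        exact h1.trans h3
      calc t * ‖κ (w - v, t) - κ (w, t)‖ ^ 2 ≤ t * (D / (‖w‖ ^ 2 + t ^ 2)) ^ 2 := by gcongr
        _ = _ := by rw [div_pow]; ring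
    calc ∫⁻ t in Set.Icc a b, ENNReal.ofReal t * ‖κ (w - v, t) - κ (w, t)‖ₑ ^ 2
        ≤ ∫⁻ t in Set.Icc a b, ENNReal.ofReal (D ^ 2 * (t / (‖w‖ ^ 2 + t ^ 2) ^ 2)) :=
          setLIntegral_mono' measurableSet_Icc hpt
      _ ≤ ∫⁻ t in Set.Ioi 0, ENNReal.ofReal (D ^ 2 * (t / (‖w‖ ^ 2 + t ^ 2) ^ 2)) :=
          lintegral_mono_set fun t ht => ha.trans_le ht.1
      _ = ENNReal.ofReal (∫ t in Set.Ioi 0, D ^ 2 * (t / (‖w‖ ^ 2 + t ^ 2) ^ 2)) := by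
          rw [ofReal_integral_eq_lintegral_ofReal (hint.1.const_mul _)]
          filter_upwards [ae_restrict_mem measurableSet_Ioi] with t ht
          have : (0 : ℝ) < t := ht
          positivity
      _ ≤ _ := by
          rw [integral_const_mul, hint.2]
          refine ENNReal.ofReal_le_ofReal ?_
          have h5 : D ^ 2 * (1 / (2 * ‖w‖ ^ 2)) = 2 * (C * (ℓ / ‖w‖ ^ (d + 1))) ^ 2 := by
            rw [hD]; field_simp; ring
          rw [h5, mul_assoc, mul_pow]
          nlinarith [sq_nonneg (C * (ℓ / ‖w‖ ^ (d + 1)))]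
  calc ∫⁻ w in {w | 2 * ℓ ≤ ‖w‖}, ‖vecKernel h ha b (w - v) - vecKernel h ha b w‖ₑ
      ≤ ∫⁻ w in {w | 2 * ℓ ≤ ‖w‖}, ENNReal.ofReal (2 * C) * ENNReal.ofReal (ℓ / ‖w‖ ^ (d + 1)) :=
        setLIntegral_mono' hm key
    _ ≤ _ := by
        rw [lintegral_const_mul' _ _ ENNReal.ofReal_ne_top, ENNReal.coe_mul]
        exact mul_le_mul' le_rfl (hI ℓ hℓ)

/-- The vector valued integral is taken in `C([a, b])`, where it commutes both with the inclusion
into `L²` and with evaluation at each `t`; so it is represented by the scalar convolutions. -/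
theorem enorm_kernelOp_vecKernel_sq {κ : Eucl d × ℝ → ℝ} (h : IsHomKernel 1 κ) {a : ℝ}
    (ha : 0 < a) (b : ℝ) {p : ℝ} (hp : 1 < p) {f : Eucl d → ℝ}
    (hf : MemLp f (ENNReal.ofReal p)) (x : Eucl d) :
    ‖kernelOp (vecKernel h ha b) f x‖ₑ ^ 2 =
      ∫⁻ t in Set.Icc a b, ENNReal.ofReal t * ‖kernelConv κ f x t‖ₑ ^ 2 := by
  obtain ⟨M, hM⟩ := exists_norm_kernelCM_le h ha b
  have hpq := Real.HolderConjugate.conjExponent hp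
  have hc := continuous_kernelCM h ha b
  have hint := (integrable_kernel_apply_of_memLp hpq hc
    (memLp_of_norm_le_decay hc hM hpq.symm.lt.le) hf x).1
  have h1 : kernelOp (vecKernel h ha b) f x =
      ContinuousMap.toLp 2 (iccMeasure a b) ℝ (kernelOp (kernelCM h ha b) f x) := by
    rw [kernelOp, kernelOp, ← ContinuousLinearMap.integral_comp_comm _ hint]
    rfl
  rw [h1, enorm_toLp_sq _ (G := fun t => √t * kernelConv κ f x t)]
  · refine setLIntegral_congr_fun measurableSet_Icc fun t ht => ?_
    have ht0 : 0 ≤ t := ha.le.trans ht.1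
    simp only [enorm_mul, mul_pow]
    rw [Real.enorm_of_nonneg (Real.sqrt_nonneg _), ← ENNReal.ofReal_pow (Real.sqrt_nonneg _),
      Real.sq_sqrt ht0]
  · intro t
    have h2 := (ContinuousMap.evalCLM ℝ t : C(Set.Icc a b, ℝ) →L[ℝ] ℝ).integral_comp_comm hint
    change ContinuousMap.evalCLM ℝ t (∫ y, kernelCM h ha b (x - y) (f y)) = _
    rw [← h2, kernelConv, ← integral_const_mul]
    refine integral_congr_ae (ae_of_all _ fun y => ?_)
    change f y * (√(t : ℝ) * κ (x - y, (t : ℝ))) = _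
    ring

/-! ### Square functions -/

/-- The square function of a family of kernels, with respect to `t dt`. -/
def squareFn (κ : Eucl d × ℝ → ℝ) (f : Eucl d → ℝ) (x : Eucl d) : ℝ≥0∞ :=
  (∫⁻ t in Set.Ioi (0 : ℝ), ENNReal.ofReal t * ‖kernelConv κ f x t‖ₑ ^ 2) ^ (1 / 2 : ℝ)

theorem measurable_squareFn {κ : Eucl d × ℝ → ℝ} (hκ : Measurable κ) {f : Eucl d → ℝ}
    (hf : AEStronglyMeasurable f volume) : Measurable (squareFn κ f) := by
  refine Measurable.pow_const ?_ _
  have h1 : Measurable fun z : Eucl d × ℝ =>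
      ENNReal.ofReal z.2 * ‖kernelConv κ f z.1 z.2‖ₑ ^ 2 :=
    (by fun_prop : Measurable fun z : Eucl d × ℝ => ENNReal.ofReal z.2).mul
      ((measurable_kernelConv hκ hf).enorm.pow_const 2)
  exact h1.lintegral_prod_right'

theorem squareFn_rpow {κ : Eucl d × ℝ → ℝ} {f : Eucl d → ℝ} (x : Eucl d) :
    squareFn κ f x ^ (2 : ℝ) =
      ∫⁻ t in Set.Ioi (0 : ℝ), ENNReal.ofReal t * ‖kernelConv κ f x t‖ₑ ^ 2 := by
  rw [squareFn, ← ENNReal.rpow_mul]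
  simp

/-- The `L^p` bound for square functions of homogeneous kernels that are bounded on `L^2`. -/
theorem exists_lintegral_squareFn_rpow_le {κ : Eucl d × ℝ → ℝ} (h : IsHomKernel 1 κ) (hd : d ≠ 0)
    {A₂ : ℝ≥0} (h2 : ∀ f : Eucl d → ℝ, Continuous f → HasCompactSupport f →
      ∫⁻ x, squareFn κ f x ^ (2 : ℝ) ≤ (A₂ * eLpNorm f 2 volume) ^ (2 : ℝ)) {p : ℝ} (hp : 1 < p) :
    ∃ C : ℝ≥0, ∀ f : Eucl d → ℝ, MemLp f (ENNReal.ofReal p) →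
      ∫⁻ x, squareFn κ f x ^ p ≤ (C * eLpNorm f (ENNReal.ofReal p) volume) ^ p := by
  obtain ⟨A, hA⟩ := exists_isSingularKernel_vecKernel h
  have hp0 : 0 < p := by linarith
  refine ⟨czBound d A A₂ p, fun f hf => ?_⟩
  have hst : ∀ (a : ℝ) (ha : 0 < a) (b : ℝ), StrongType (vecKernel h ha b) 2 A₂ := by
    intro a ha b F hF hFtop
    obtain ⟨M, hM⟩ := (hA a ha b).exists_norm_le
    obtain ⟨M', hM'⟩ := (hA a ha b).bound
    have hF2 := memLp_of_integrable_of_memLp_top hF hFtop one_le_two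
    have h22 := Real.HolderConjugate.two_two
    have h3 := eLpNorm_kernelOp_le_of_dense h22 (hA a ha b).continuous hM
      (memLp_of_norm_le_decay (hA a ha b).continuous hM' one_le_two) (C := A₂)
      (fun g hg hgs => ?_) hF2
    · simpa using h3
    · have hg2 : MemLp g (ENNReal.ofReal 2) := hg.memLp_of_hasCompactSupport hgs
      rw [← ENNReal.rpow_le_rpow_iff zero_lt_two, ← lintegral_enorm_rpow_eq_eLpNorm_rpow _ _ zero_lt_two]
      simp only [ENNReal.ofReal_ofNat]
      refine le_trans (lintegral_mono fun x => ?_) (h2 g hg hgs)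
      rw [ENNReal.rpow_two, enorm_kernelOp_vecKernel_sq h ha b one_lt_two hg2, squareFn_rpow]
      exact lintegral_mono_set fun t ht => ha.trans_le ht.1
  -- These intervals exhaust the half line. The Calderón–Zygmund constant is the same for all of
  -- them, so monotone convergence concludes.
  set S : ℕ → Set ℝ := fun N => Set.Icc ((N : ℝ) + 1)⁻¹ (N + 1) with hS
  have hSmono : Monotone S := by
    intro m n hmn
    have h1 : (m : ℝ) + 1 ≤ n + 1 := by exact_mod_cast Nat.succ_le_succ hmn
    exact Set.Icc_subset_Icc (inv_anti₀ (by positivity) h1) h1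
  have hSU : ⋃ N, S N = Set.Ioi (0 : ℝ) := by
    ext t
    simp only [hS, Set.mem_iUnion, Set.mem_Icc, Set.mem_Ioi]
    constructor
    · rintro ⟨N, hN, -⟩
      exact lt_of_lt_of_le (by positivity) hN
    · intro ht
      obtain ⟨N, hN⟩ := exists_nat_ge (max t t⁻¹)
      have h1 : t⁻¹ ≤ (N : ℝ) + 1 := ((le_max_right _ _).trans hN).trans (by linarith)
      exact ⟨N, inv_le_of_inv_le₀ ht h1, ((le_max_left _ _).trans hN).trans (by linarith)⟩
  set G : ℕ → Eucl d → ℝ≥0∞ := fun N x =>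
    (∫⁻ t in S N, ENNReal.ofReal t * ‖kernelConv κ f x t‖ₑ ^ 2) ^ (p / 2) with hG
  have hGm : ∀ N, Measurable (G N) := by
    intro N
    refine Measurable.pow_const ?_ _
    have h1 : Measurable fun z : Eucl d × ℝ =>
        ENNReal.ofReal z.2 * ‖kernelConv κ f z.1 z.2‖ₑ ^ 2 :=
      (by fun_prop : Measurable fun z : Eucl d × ℝ => ENNReal.ofReal z.2).mul
        ((measurable_kernelConv h.measurable hf.1).enorm.pow_const 2)
    exact h1.lintegral_prod_right'
  have hGmono : Monotone G := fun m n hmn x =>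
    ENNReal.rpow_le_rpow (lintegral_mono_set (hSmono hmn)) (by positivity)
  have hsup : ∀ x, squareFn κ f x ^ p = ⨆ N, G N x := by
    intro x
    have h1 : squareFn κ f x ^ p =
        (∫⁻ t in Set.Ioi (0 : ℝ), ENNReal.ofReal t * ‖kernelConv κ f x t‖ₑ ^ 2) ^ (p / 2) := by
      rw [squareFn, ← ENNReal.rpow_mul]
      congr 1
      ring
    rw [h1, ← hSU, setLIntegral_iUnion_of_directed _ (directed_of_isDirected_le hSmono)]
    exact (ENNReal.orderIsoRpow (p / 2) (by positivity)).map_iSup _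
  simp only [hsup]
  rw [lintegral_iSup hGm hGmono]
  refine iSup_le fun N => ?_
  have ha : (0 : ℝ) < ((N : ℝ) + 1)⁻¹ := by positivity
  have h3 := eLpNorm_kernelOp_le (hA _ ha (N + 1)) (hst _ ha (N + 1)) hd hp hf
  have h4 := ENNReal.rpow_le_rpow h3 hp0.le
  rw [← lintegral_enorm_rpow_eq_eLpNorm_rpow _ _ hp0] at h4
  refine le_trans (le_of_eq (lintegral_congr fun x => ?_)) h4
  simp only [hG]
  rw [← enorm_kernelOp_vecKernel_sq h ha _ hp hf, ← ENNReal.rpow_two, ← ENNReal.rpow_mul]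
  congr 1
  ring

end VectorKernel

/-! ### Time derivatives of homogeneous kernels -/

section TimeDeriv

variable {d : ℕ}

theorem sq_norm_add_sq_pos {z : Eucl d × ℝ} (hz : z ≠ 0) : 0 < ‖z.1‖ ^ 2 + z.2 ^ 2 := by
  rcases eq_or_ne z.2 0 with h2 | h2
  · have h1 : z.1 ≠ 0 := fun h1 => hz (Prod.ext h1 h2)
    have := norm_pos_iff.2 h1
    positivity
  · positivity

/-- The degree is `k - 2 * s = -(d + 1)`. -/
theorem isHomKernel_mul_rpow {n : WithTop ℕ∞} {g : Eucl d × ℝ → ℝ} (k : ℕ) (hg : ContDiff ℝ n g)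
    (hom : ∀ (r : ℝ) z, g (r • z) = r ^ k * g z) {s : ℝ} (hs : s = ((d : ℝ) + 1 + k) / 2) :
    IsHomKernel n fun z : Eucl d × ℝ => g z * (‖z.1‖ ^ 2 + z.2 ^ 2) ^ (-s) where
  contDiffOn := by
    refine hg.contDiffOn.mul (ContDiffOn.rpow_const_of_ne ?_ fun z hz => (sq_norm_add_sq_pos hz).ne')
    exact ((contDiff_fst.norm_sq ℝ).add (contDiff_snd.pow 2)).contDiffOn
  hom r hr z hz := by
    have hpos := sq_norm_add_sq_pos hz
    have h1 : ‖(r • z).1‖ ^ 2 + (r • z).2 ^ 2 = r ^ 2 * (‖z.1‖ ^ 2 + z.2 ^ 2) := by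
      rw [Prod.smul_fst, Prod.smul_snd, norm_smul, smul_eq_mul, Real.norm_eq_abs, mul_pow, mul_pow,
        sq_abs]
      ring
    have h2 : (r ^ 2) ^ (-s) = (r ^ (d + 1))⁻¹ * (r ^ k)⁻¹ := by
      rw [← mul_inv, ← pow_add, ← Real.rpow_natCast r 2, ← Real.rpow_mul hr.le,
        ← Real.rpow_natCast r (d + 1 + k), ← Real.rpow_neg hr.le, hs]
      congr 1
      push_cast
      ring
    have hk : r ^ k ≠ 0 := (pow_pos hr k).ne'
    rw [hom, h1, Real.mul_rpow (by positivity) hpos.le, h2]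
    field_simp

/-- The kernel `∂_t (t Q(x, t))`. -/
def timeDeriv (Q : Eucl d × ℝ → ℝ) (z : Eucl d × ℝ) : ℝ := Q z + z.2 * fderiv ℝ Q z (0, 1)

/-- The operator `t ∂_t` keeps the degree of homogeneity and costs one derivative; this is why the
kernels start as `C²`. -/
theorem IsHomKernel.timeDeriv {Q : Eucl d × ℝ → ℝ} (h : IsHomKernel 2 Q) :
    IsHomKernel 1 (timeDeriv Q) where
  contDiffOn := by
    have h1 : ContDiffOn ℝ 1 (fderiv ℝ Q) {0}ᶜ :=
      h.contDiffOn.fderiv_of_isOpen isOpen_compl_singleton (by norm_num)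
    exact (h.contDiffOn.of_le (by norm_num)).add
      (contDiff_snd.contDiffOn.mul (h1.clm_apply contDiffOn_const))
  hom r hr z hz := by
    have hr0 := hr.ne'
    unfold _root_.timeDeriv
    rw [h.hom r hr z hz, h.fderiv_smul (by norm_num) hr hz, smul_apply, Prod.smul_snd, smul_eq_mul,
      smul_eq_mul, pow_succ r (d + 1)]
    field_simp

theorem IsHomKernel.hasDerivAt_timeDeriv {n : WithTop ℕ∞} (hn : n ≠ 0) {Q : Eucl d × ℝ → ℝ}
    (h : IsHomKernel n Q) (v : Eucl d) {t : ℝ} (ht : 0 < t) :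
    HasDerivAt (fun s => s * Q (v, s)) (_root_.timeDeriv Q (v, t)) t := by
  have h1 : HasDerivAt (fun s : ℝ => (v, s)) ((0 : Eucl d), (1 : ℝ)) t :=
    (hasDerivAt_const t v).prodMk (hasDerivAt_id t)
  have h2 := (h.differentiableAt hn (prod_ne_zero_of_pos (x := v) ht)).hasFDerivAt.comp_hasDerivAt t h1
  exact ((hasDerivAt_id t).mul h2).congr_deriv (by simp [_root_.timeDeriv])

theorem IsHomKernel.exists_decay {n : WithTop ℕ∞} (hn : n ≠ 0) {Q : Eucl d × ℝ → ℝ}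
    (h : IsHomKernel n Q) {a : ℝ} (ha : 0 < a) : ∃ C, 0 ≤ C ∧ ∀ v t, a ≤ t →
      |Q (v, t)| ≤ C * (1 + ‖v‖) ^ (-((d : ℝ) + 1)) := by
  obtain ⟨C, hC0, hC⟩ := h.exists_bound hn
  have hm : 0 < min 1 a := lt_min one_pos ha
  exact ⟨C * (2 / min 1 a) ^ (d + 1), by positivity, fun v t hat =>
    (hC _ (prod_ne_zero_of_pos (ha.trans_le hat))).1.trans (div_norm_prod_le_decay hC0 ha v hat)⟩

variable {F : Type*} [NormedAddCommGroup F] [NormedSpace ℝ F]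

theorem IsHomKernel.integrable_smul {n : WithTop ℕ∞} (hn : n ≠ 0) {Q : Eucl d × ℝ → ℝ}
    (h : IsHomKernel n Q) {f : Eucl d → F} (hf : AEStronglyMeasurable f volume)
    (hfi : Integrable fun v => (1 + ‖v‖) ^ (-((d : ℝ) + 1)) • f v) {t : ℝ} (ht : 0 < t) :
    Integrable fun v => Q (v, t) • f v := by
  obtain ⟨C, hC0, hC⟩ := h.exists_decay hn ht
  refine (hfi.norm.const_mul C).mono' ((h.continuous_slice ht).aestronglyMeasurable.smul hf)
    (.of_forall fun v => ?_)
  rw [norm_smul, norm_smul, Real.norm_eq_abs, Real.norm_of_nonneg (by positivity), ← mul_assoc]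
  gcongr
  exact hC v t le_rfl

/-- Differentiation under the integral sign: for times above `t / 2` the derivative is dominated by
a multiple of the weight `(1 + ‖v‖) ^ (-(d + 1))`. The weighted integrability hypothesis covers both
translates of `L^p` functions, for convolutions, and characters, for Fourier transforms. -/
theorem IsHomKernel.hasDerivAt_integral {Q : Eucl d × ℝ → ℝ} (h : IsHomKernel 2 Q) {f : Eucl d → F}
    (hf : AEStronglyMeasurable f volume)
    (hfi : Integrable fun v => (1 + ‖v‖) ^ (-((d : ℝ) + 1)) • f v) {t : ℝ} (ht : 0 < t) :
    HasDerivAt (fun s => ∫ v, (s * Q (v, s)) • f v) (∫ v, _root_.timeDeriv Q (v, t) • f v) t := by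
  have h1 := h.timeDeriv
  obtain ⟨C, hC0, hC⟩ := h1.exists_decay one_ne_zero (half_pos ht)
  refine (hasDerivAt_integral_of_dominated_loc_of_deriv_le (s := Set.Ioi (t / 2))
    (F := fun s v => (s * Q (v, s)) • f v) (F' := fun s v => _root_.timeDeriv Q (v, s) • f v)
    (bound := fun v => C * ‖(1 + ‖v‖) ^ (-((d : ℝ) + 1)) • f v‖) (Ioi_mem_nhds (by linarith)) ?_ ?_
    ?_ ?_ (hfi.norm.const_mul C) ?_).2
  · filter_upwards [Ioi_mem_nhds ht] with s hs
    exact ((h.continuous_slice hs).const_mul s).aestronglyMeasurable.smul hf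
  · simp_rw [mul_smul]
    exact (h.integrable_smul two_ne_zero hf hfi ht).smul t
  · exact (h1.continuous_slice ht).aestronglyMeasurable.smul hf
  · refine .of_forall fun v s hs => ?_
    rw [norm_smul, norm_smul, Real.norm_eq_abs, Real.norm_of_nonneg (by positivity), ← mul_assoc]
    gcongr
    exact hC v s (Set.mem_Ioi.1 hs).le
  · refine .of_forall fun v s hs => ?_
    exact (h.hasDerivAt_timeDeriv two_ne_zero v ((half_pos ht).trans hs)).smul_const (f v)

theorem integrable_decay_smul_sub {p : ℝ} (hp : 1 < p) {f : Eucl d → ℝ}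
    (hf : MemLp f (ENNReal.ofReal p) volume) (x : Eucl d) :
    Integrable fun v => (1 + ‖v‖) ^ (-((d : ℝ) + 1)) • f (x - v) := by
  have hpq := Real.HolderConjugate.conjExponent hp
  have hg : MemLp (fun v : Eucl d => (1 + ‖v‖) ^ (-((d : ℝ) + 1)))
      (ENNReal.ofReal p.conjExponent) volume := by
    refine memLp_of_norm_le_decay (M := 1) ?_ (fun x => ?_) hpq.symm.lt.le
    · exact (by fun_prop : Continuous fun v : Eucl d => 1 + ‖v‖).rpow_const
        fun v => Or.inl (by positivity)
    · rw [one_mul, Real.norm_of_nonneg (by positivity)]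
  have hf' : MemLp (fun v => f (x - v)) (ENNReal.ofReal p) volume :=
    hf.comp_measurePreserving (volume.measurePreserving_sub_left x)
  have := hpq.symm.ennrealOfReal
  exact hg.integrable_mul hf'

theorem kernelConv_eq_integral_sub (κ : Eucl d × ℝ → ℝ) (f : Eucl d → ℝ) (x : Eucl d) (t : ℝ) :
    kernelConv κ f x t = ∫ v, κ (v, t) • f (x - v) := by
  rw [kernelConv, ← integral_sub_left_eq_self _ volume x]
  simp only [sub_sub_cancel, smul_eq_mul]

theorem aestronglyMeasurable_comp_sub_left {f : Eucl d → ℝ} (hf : AEStronglyMeasurable f volume)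
    (x : Eucl d) : AEStronglyMeasurable (fun v => f (x - v)) volume :=
  hf.comp_measurePreserving (volume.measurePreserving_sub_left x)

theorem IsHomKernel.hasDerivAt_kernelConv {Q : Eucl d × ℝ → ℝ} (h : IsHomKernel 2 Q)
    {p : ℝ} (hp : 1 < p) {f : Eucl d → ℝ} (hf : MemLp f (ENNReal.ofReal p) volume) (x : Eucl d)
    {t : ℝ} (ht : 0 < t) : HasDerivAt (fun s => ∫ v, (s * Q (v, s)) * f (x - v))
      (kernelConv (_root_.timeDeriv Q) f x t) t := by
  rw [kernelConv_eq_integral_sub]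
  exact h.hasDerivAt_integral (aestronglyMeasurable_comp_sub_left hf.1 x)
    (integrable_decay_smul_sub hp hf x) ht

theorem IsHomKernel.integrable_mul_sub {n : WithTop ℕ∞} (hn : n ≠ 0) {Q : Eucl d × ℝ → ℝ}
    (h : IsHomKernel n Q) {p : ℝ} (hp : 1 < p) {f : Eucl d → ℝ}
    (hf : MemLp f (ENNReal.ofReal p) volume) (x : Eucl d) {t : ℝ} (ht : 0 < t) :
    Integrable fun v => Q (v, t) * f (x - v) :=
  h.integrable_smul hn (aestronglyMeasurable_comp_sub_left hf.1 x)
    (integrable_decay_smul_sub hp hf x) ht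

end TimeDeriv

/-! ### The Poisson kernel and the entries of the matrix kernel -/

section Kernels

variable {d : ℕ}

theorem sphereArea_pos (d : ℕ) : 0 < sphereArea d := by
  have := Real.Gamma_pos_of_pos (s := ((d : ℝ) + 1) / 2) (by positivity)
  rw [sphereArea]
  positivity

/-- The scalar Poisson kernel, divided by `t`. -/
def scalarPoissonKernel (z : Eucl d × ℝ) : ℝ :=
  2 / sphereArea d * (‖z.1‖ ^ 2 + z.2 ^ 2) ^ (-(((d : ℝ) + 1) / 2))

/-- The tangential entries of the matrix kernel, divided by `t`. -/
def tangentialKernel (i j : Fin d) (z : Eucl d × ℝ) : ℝ :=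
  2 * ((d : ℝ) + 1) / sphereArea d * (z.1 i * z.1 j) * (‖z.1‖ ^ 2 + z.2 ^ 2) ^ (-(((d : ℝ) + 3) / 2))

/-- The entries of the last row of the matrix kernel, divided by `t`. -/
def normalKernel (j : Fin d) (z : Eucl d × ℝ) : ℝ :=
  2 * ((d : ℝ) + 1) / sphereArea d * (z.2 * z.1 j) * (‖z.1‖ ^ 2 + z.2 ^ 2) ^ (-(((d : ℝ) + 3) / 2))

theorem contDiff_fst_apply (i : Fin d) {n : WithTop ℕ∞} : ContDiff ℝ n fun z : Eucl d × ℝ => z.1 i :=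
  (EuclideanSpace.proj (𝕜 := ℝ) i).contDiff.comp contDiff_fst

theorem isHomKernel_scalarPoissonKernel : IsHomKernel 2 (scalarPoissonKernel (d := d)) :=
  isHomKernel_mul_rpow 0 contDiff_const (by simp) (by push_cast; ring)

theorem isHomKernel_tangentialKernel (i j : Fin d) : IsHomKernel 2 (tangentialKernel i j) := by
  refine isHomKernel_mul_rpow 2 (contDiff_const.mul ((contDiff_fst_apply i).mul (contDiff_fst_apply j)))
    (fun r z => ?_) (by push_cast; ring)
  simp only [Prod.smul_fst, PiLp.smul_apply, smul_eq_mul]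
  ring

theorem isHomKernel_normalKernel (j : Fin d) : IsHomKernel 2 (normalKernel j) := by
  refine isHomKernel_mul_rpow 2 (contDiff_const.mul (contDiff_snd.mul (contDiff_fst_apply j)))
    (fun r z => ?_) (by push_cast; ring)
  simp only [Prod.smul_fst, Prod.smul_snd, PiLp.smul_apply, smul_eq_mul]
  ring

theorem matrixPoissonKernel_inl_inl (t : ℝ) (x : Eucl d) (i j : Fin d) :
    matrixPoissonKernel t x (.inl i) (.inl j) = t * tangentialKernel i j (x, t) := by
  have : 0 ≤ ‖x‖ ^ 2 + t ^ 2 := by positivity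
  simp only [matrixPoissonKernel, tangentialKernel, Matrix.smul_apply, Matrix.fromBlocks_apply₁₁,
    Matrix.of_apply, smul_eq_mul, Real.rpow_neg this]
  ring

theorem matrixPoissonKernel_inr_inl (t : ℝ) (x : Eucl d) (i : Unit) (j : Fin d) :
    matrixPoissonKernel t x (.inr i) (.inl j) = t * normalKernel j (x, t) := by
  have : 0 ≤ ‖x‖ ^ 2 + t ^ 2 := by positivity
  simp only [matrixPoissonKernel, normalKernel, Matrix.smul_apply, Matrix.fromBlocks_apply₂₁,
    Matrix.of_apply, smul_eq_mul, Real.rpow_neg this]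
  ring

/-- The rows of the matrix kernel, divided by `t`. -/
def rowKernel (i : Fin d ⊕ Unit) (j : Fin d) : Eucl d × ℝ → ℝ :=
  Sum.elim (fun i => tangentialKernel i j) (fun _ => normalKernel j) i

theorem isHomKernel_rowKernel (i : Fin d ⊕ Unit) (j : Fin d) : IsHomKernel 2 (rowKernel i j) := by
  cases i with
  | inl i => exact isHomKernel_tangentialKernel i j
  | inr i => exact isHomKernel_normalKernel j

theorem matrixPoissonKernel_inl (t : ℝ) (x : Eucl d) (i : Fin d ⊕ Unit) (j : Fin d) :
    matrixPoissonKernel t x i (.inl j) = t * rowKernel i j (x, t) := by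
  cases i with
  | inl i => exact matrixPoissonKernel_inl_inl t x i j
  | inr i => exact matrixPoissonKernel_inr_inl t x i j

variable {p : ℝ} {f : Eucl d → Eucl d}

theorem MemLp.apply_eucl {p : ℝ≥0∞} (hf : MemLp f p volume) (j : Fin d) :
    MemLp (fun x => f x j) p volume :=
  (EuclideanSpace.proj (𝕜 := ℝ) j).comp_memLp' hf

theorem convolutionExistsAt_matrixPoissonKernel (hp : 1 < p)
    (hf : MemLp f (ENNReal.ofReal p) volume) (x : Eucl d) {t : ℝ} (ht : 0 < t)
    (i j : Fin d ⊕ Unit) :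
    ConvolutionExistsAt (fun y => matrixPoissonKernel t y i j)
      (fun y => extendByZero f y j) x (ContinuousLinearMap.mul ℝ ℝ) volume := by
  rw [ConvolutionExistsAt]
  cases j with
  | inr j => simp [extendByZero]
  | inl j =>
    simp only [matrixPoissonKernel_inl, extendByZero, Sum.elim_inl, ContinuousLinearMap.mul_apply',
      mul_assoc]
    exact ((isHomKernel_rowKernel i j).integrable_mul_sub two_ne_zero hp (MemLp.apply_eucl hf j) x
      ht).const_mul t

theorem poissonTypeIntegral_apply (f : Eucl d → Eucl d) (x : Eucl d) (t : ℝ) (i : Fin d ⊕ Unit) :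
    poissonTypeIntegral f x t i = ∑ j, ∫ v, (t * rowKernel i j (v, t)) * f (x - v) j := by
  simp only [poissonTypeIntegral, Fintype.sum_sum_type, extendByZero, Sum.elim_inl, Sum.elim_inr,
    matrixPoissonKernel_inl, convolution, ContinuousLinearMap.mul_apply', mul_zero, integral_zero,
    Finset.sum_const_zero, add_zero]

theorem hasDerivAt_poissonTypeIntegral (hp : 1 < p)
    (hf : MemLp f (ENNReal.ofReal p) volume) (x : Eucl d) {t : ℝ} (ht : 0 < t) :
    HasDerivAt (fun s => poissonTypeIntegral f x s) (WithLp.toLp 2 fun i => ∑ j,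
      kernelConv (timeDeriv (rowKernel i j)) (fun y => f y j) x t) t := by
  have h1 : HasDerivAt (fun s i => poissonTypeIntegral f x s i) (fun i => ∑ j,
      kernelConv (timeDeriv (rowKernel i j)) (fun y => f y j) x t) t := by
    rw [hasDerivAt_pi]
    intro i
    simp only [poissonTypeIntegral_apply]
    exact HasDerivAt.fun_sum fun j _ => (isHomKernel_rowKernel i j).hasDerivAt_kernelConv hp
      (MemLp.apply_eucl hf j) x ht
  exact (PiLp.hasFDerivAt_toLp (𝕜 := ℝ) 2 _).comp_hasDerivAt t h1

end Kernels

/-! ### The Fourier transform of the Poisson kernel -/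

section GaussIntegral

open Filter Topology Set Real

/-- The subordination integral. With `u = v²` the integrand has an antiderivative in terms of the
Gauss integral `Φ` at `a v ± b / v`, because `(a v ± b / v)² = a² v² + b² / v² ± 2 a b`. -/
theorem integral_rpow_neg_half_mul_exp {a b : ℝ} (ha : 0 < a) (hb : 0 < b) :
    ∫ u in Ioi (0 : ℝ), u ^ (-(1 / 2) : ℝ) * exp (-(a ^ 2 * u) - b ^ 2 / u) =
      √π / a * exp (-(2 * a * b)) := by
  set Φ : ℝ → ℝ := fun y => ∫ s in (0 : ℝ)..y, exp (-s ^ 2) with hΦ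
  have hcont : Continuous fun s : ℝ => exp (-s ^ 2) := by fun_prop
  have hΦd (y : ℝ) : HasDerivAt Φ (exp (-y ^ 2)) y :=
    intervalIntegral.integral_hasDerivAt_right (hcont.intervalIntegrable _ _)
      (hcont.stronglyMeasurableAtFilter _ _) hcont.continuousAt
  have hΦtop : Tendsto Φ atTop (𝓝 (√π / 2)) := by
    have h1 := intervalIntegral_tendsto_integral_Ioi 0
      (integrable_exp_neg_mul_sq one_pos).integrableOn tendsto_id
    rw [integral_gaussian_Ioi] at h1
    simpa [hΦ] using h1
  have hΦneg (y : ℝ) : Φ (-y) = -Φ y := by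
    have := intervalIntegral.integral_comp_neg (a := 0) (b := y) fun s : ℝ => exp (-s ^ 2)
    simp only [even_two, Even.neg_pow, neg_zero] at this
    simp only [hΦ]
    rw [intervalIntegral.integral_symm, this]
  have hΦbot : Tendsto Φ atBot (𝓝 (-(√π / 2))) := by
    have h1 := (hΦtop.comp tendsto_neg_atBot_atTop).neg
    refine h1.congr fun y => ?_
    rw [Function.comp_apply, hΦneg, neg_neg]
  -- In the derivative the factors `a - b / v²` and `a + b / v²` add up to `2 a`, and the prefactors
  -- `exp (± 2 a b)` complete the squares.
  set H : ℝ → ℝ := fun v =>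
    a⁻¹ * (exp (2 * a * b) * Φ (a * v + b / v) + exp (-(2 * a * b)) * Φ (a * v - b / v)) with hH
  have hHd (v : ℝ) (hv : 0 < v) :
      HasDerivAt H (2 * exp (-(a ^ 2 * v ^ 2) - b ^ 2 / v ^ 2)) v := by
    have h1 : HasDerivAt (fun v => b / v) (-b / v ^ 2) v := by
      exact ((hasDerivAt_const v b).fun_div (hasDerivAt_id' v) hv.ne').congr_deriv (by simp)
    have h2 : HasDerivAt (fun v => a * v) a v := by simpa using (hasDerivAt_id v).const_mul a
    have h3 := (hΦd (a * v + b / v)).comp v (h2.add h1)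
    have h4 := (hΦd (a * v - b / v)).comp v (h2.sub h1)
    refine (((h3.const_mul (exp (2 * a * b))).add (h4.const_mul (exp (-(2 * a * b))))).const_mul
      a⁻¹).congr_deriv ?_
    have e1 : exp (2 * a * b) * exp (-(a * v + b / v) ^ 2) =
        exp (-(a ^ 2 * v ^ 2) - b ^ 2 / v ^ 2) := by
      rw [← Real.exp_add]; congr 1; field_simp; ring
    have e2 : exp (-(2 * a * b)) * exp (-(a * v - b / v) ^ 2) =
        exp (-(a ^ 2 * v ^ 2) - b ^ 2 / v ^ 2) := by
      rw [← Real.exp_add]; congr 1; field_simp; ring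
    rw [← mul_assoc, ← mul_assoc, e1, e2]
    field_simp
    ring
  have hdiv0 : Tendsto (fun v : ℝ => b / v) (𝓝[>] 0) atTop := by
    simpa only [div_eq_mul_inv] using tendsto_inv_nhdsGT_zero.const_mul_atTop hb
  have hdivtop : Tendsto (fun v : ℝ => b / v) atTop (𝓝 0) := tendsto_id.const_div_atTop b
  have hmul0 : Tendsto (fun v : ℝ => a * v) (𝓝[>] 0) (𝓝 0) :=
    ((continuous_const_mul a).tendsto' 0 0 (mul_zero a)).mono_left nhdsWithin_le_nhds
  have hmultop : Tendsto (fun v : ℝ => a * v) atTop atTop := tendsto_id.const_mul_atTop ha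
  have hH0 : Tendsto H (𝓝[>] 0)
      (𝓝 (a⁻¹ * (exp (2 * a * b) * (√π / 2) + exp (-(2 * a * b)) * -(√π / 2)))) := by
    refine (((hΦtop.comp (hmul0.add_atTop hdiv0)).const_mul _).add
      ((hΦbot.comp ?_).const_mul _)).const_mul _
    exact (hmul0.add_atBot (tendsto_neg_atTop_atBot.comp hdiv0)).congr fun v => (sub_eq_add_neg _ _).symm
  have hHtop : Tendsto H atTop
      (𝓝 (a⁻¹ * (exp (2 * a * b) * (√π / 2) + exp (-(2 * a * b)) * (√π / 2)))) := by
    refine (((hΦtop.comp (hmultop.atTop_add hdivtop)).const_mul _).add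
      ((hΦtop.comp ?_).const_mul _)).const_mul _
    simpa only [sub_eq_add_neg] using hmultop.atTop_add hdivtop.neg
  have hsqrt0 : Tendsto Real.sqrt (𝓝[>] 0) (𝓝[>] 0) := by
    refine tendsto_nhdsWithin_iff.2 ⟨?_, ?_⟩
    · exact (Real.continuous_sqrt.tendsto' 0 0 Real.sqrt_zero).mono_left nhdsWithin_le_nhds
    · filter_upwards [self_mem_nhdsWithin] with u hu using Real.sqrt_pos.2 hu
  -- At `u = 0` the formula for `H` divides by zero, so its right limit is inserted there to make
  -- the antiderivative continuous.
  set G := Function.update (fun u => H (√u)) 0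
    (a⁻¹ * (exp (2 * a * b) * (√π / 2) + exp (-(2 * a * b)) * -(√π / 2))) with hG
  have hGc : ContinuousWithinAt G (Ici 0) 0 := by
    rw [hG, continuousWithinAt_update_same, Ici_sdiff_left]
    exact hH0.comp hsqrt0
  have hGd : ∀ u ∈ Ioi (0 : ℝ), HasDerivAt G
      (u ^ (-(1 / 2) : ℝ) * exp (-(a ^ 2 * u) - b ^ 2 / u)) u := by
    intro u hu
    have hs : 0 < √u := Real.sqrt_pos.2 hu
    have h1 := (hHd (√u) hs).comp u (Real.hasDerivAt_sqrt (ne_of_gt hu))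
    rw [Real.sq_sqrt (le_of_lt hu)] at h1
    refine (h1.congr_of_eventuallyEq ?_).congr_deriv ?_
    · filter_upwards [Ioi_mem_nhds hu] with w hw
      rw [hG, Function.update_of_ne (ne_of_gt hw), Function.comp_apply]
    · rw [Real.rpow_neg (le_of_lt hu), ← Real.sqrt_eq_rpow]
      field_simp
  have hGtop : Tendsto G atTop
      (𝓝 (a⁻¹ * (exp (2 * a * b) * (√π / 2) + exp (-(2 * a * b)) * (√π / 2)))) := by
    refine (hHtop.comp Real.tendsto_sqrt_atTop).congr' ?_
    filter_upwards [Ioi_mem_atTop 0] with w hw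
    rw [hG, Function.update_of_ne (ne_of_gt hw), Function.comp_apply]
  rw [integral_Ioi_of_hasDerivAt_of_nonneg hGc hGd (fun u hu => ?_) hGtop, hG, Function.update_self]
  · ring
  · have : 0 < u := hu
    positivity

end GaussIntegral

/-! ### Subordination of the Poisson kernel to Gaussians. -/

section PoissonFourier

open Complex FourierTransform Real

variable {d : ℕ}

/-- The Fourier transform of the slice at height `t` of a kernel. -/
def kernelFourier (κ : Eucl d × ℝ → ℝ) (t : ℝ) (ξ : Eucl d) : ℂ :=
  𝓕 (fun x => ((κ (x, t) : ℝ) : ℂ)) ξ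

/-- Euler's integral for `Γ(s) r^(-s)`, `s = (d + 1) / 2`, together with `2 / ω_d = Γ(s) / π^s`. -/
theorem scalarPoissonKernel_eq_integral (x : Eucl d) {t : ℝ} (ht : 0 < t) :
    scalarPoissonKernel (x, t) = π ^ (-(((d : ℝ) + 1) / 2)) * ∫ u in Set.Ioi (0 : ℝ),
      u ^ (((d : ℝ) + 1) / 2 - 1) * rexp (-((‖x‖ ^ 2 + t ^ 2) * u)) := by
  have hr : 0 < ‖x‖ ^ 2 + t ^ 2 := by positivity
  have hs : 0 < ((d : ℝ) + 1) / 2 := by positivity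
  have hΓ := (Real.Gamma_pos_of_pos hs).ne'
  have hπ : π ^ (((d : ℝ) + 1) / 2) ≠ 0 := by positivity
  rw [Real.integral_rpow_mul_exp_neg_mul_Ioi hs hr, scalarPoissonKernel, sphereArea,
    Real.rpow_neg hr.le, Real.rpow_neg Real.pi_pos.le, one_div, Real.inv_rpow hr.le]
  field_simp

/-- Transforming the Gaussians under the integral produces `(π / u)^(d/2) exp (-π²‖ξ‖² / u)`. The
powers of `u` combine to `u^(-1/2)`, and the subordination integral applies with `a = t` and `b =
π‖ξ‖`, positive as `ξ ≠ 0`. -/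
theorem kernelFourier_scalarPoissonKernel {ξ : Eucl d} (hξ : ξ ≠ 0) {t : ℝ} (ht : 0 < t) :
    t * kernelFourier scalarPoissonKernel t ξ = rexp (-(2 * π * ‖ξ‖ * t)) := by
  have hs : 0 < ((d : ℝ) + 1) / 2 := by positivity
  set s : ℝ := ((d : ℝ) + 1) / 2 with hsdef
  set k : Eucl d → ℝ → ℝ := fun x u => u ^ (s - 1) * rexp (-((‖x‖ ^ 2 + t ^ 2) * u)) with hk
  have hint (x : Eucl d) : IntegrableOn (k x) (Set.Ioi 0) := by
    have hr : 0 < ‖x‖ ^ 2 + t ^ 2 := by positivity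
    have := integrableOn_rpow_mul_exp_neg_mul_rpow (p := 1) (s := s - 1) (by linarith) one_pos hr
    simpa only [Real.rpow_one, neg_mul] using this
  have hswap : Integrable (fun z : Eucl d × ℝ =>
      cexp (↑(-2 * π * inner ℝ z.1 ξ) * I) • ((k z.1 z.2 : ℝ) : ℂ))
      (volume.prod (volume.restrict (Set.Ioi 0))) := by
    rw [integrable_prod_iff]
    · have hnorm (x : Eucl d) (u : ℝ) :
          ‖cexp (↑(-2 * π * inner ℝ x ξ) * I) • ((k x u : ℝ) : ℂ)‖ = ‖k x u‖ := by
        rw [norm_smul, norm_exp_ofReal_mul_I, one_mul, norm_real]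
      constructor
      · exact .of_forall fun x => ((hint x).ofReal (𝕜 := ℂ)).const_mul (cexp (↑(-2 * π * inner ℝ x ξ) * I))
      · simp_rw [hnorm]
        have h1 (x : Eucl d) : ∫ u in Set.Ioi (0 : ℝ), ‖k x u‖ =
            π ^ s * scalarPoissonKernel (x, t) := by
          rw [scalarPoissonKernel_eq_integral x ht, ← hsdef, Real.rpow_neg Real.pi_pos.le,
            mul_inv_cancel_left₀ (by positivity)]
          refine setIntegral_congr_fun measurableSet_Ioi fun u hu => ?_
          have : 0 < u := hu
          exact Real.norm_of_nonneg (by positivity)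
        simp_rw [h1]
        have h2 := isHomKernel_scalarPoissonKernel.integrable_smul (d := d) two_ne_zero
          (f := fun _ => (1 : ℝ)) aestronglyMeasurable_const
          (by simpa using integrable_decay d) ht
        simpa using h2.const_mul (π ^ s)
    · refine Measurable.aestronglyMeasurable ?_
      simp only [hk]
      fun_prop
  have hgauss (u : ℝ) (hu : 0 < u) : ∫ x, cexp (↑(-2 * π * inner ℝ x ξ) * I) • ((k x u : ℝ) : ℂ) =
      ((π ^ ((d : ℝ) / 2) * (u ^ (-(1 / 2) : ℝ) *
        rexp (-(t ^ 2 * u) - (π * ‖ξ‖) ^ 2 / u)) : ℝ) : ℂ) := by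
    have h1 := fourier_gaussian_innerProductSpace (V := Eucl d) (b := (u : ℂ)) (by simpa using hu) ξ
    rw [fourier_eq', finrank_euclideanSpace_fin] at h1
    have h2 (x : Eucl d) : cexp (↑(-2 * π * inner ℝ x ξ) * I) • ((k x u : ℝ) : ℂ) =
        ((u ^ (s - 1) * rexp (-(t ^ 2 * u)) : ℝ) : ℂ) *
          (cexp (↑(-2 * π * inner ℝ x ξ) * I) • cexp (-u * ‖x‖ ^ 2)) := by
      have : k x u = u ^ (s - 1) * rexp (-(t ^ 2 * u)) * rexp (-u * ‖x‖ ^ 2) := by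
        rw [hk, mul_assoc, ← Real.exp_add]
        ring_nf
      rw [this, smul_eq_mul, smul_eq_mul]
      push_cast
      ring
    simp_rw [h2]
    rw [integral_const_mul, h1]
    have h3 : (π / u : ℂ) ^ ((d : ℂ) / 2) = (((π / u) ^ ((d : ℝ) / 2) : ℝ) : ℂ) := by
      rw [Complex.ofReal_cpow (by positivity)]
      push_cast
      rfl
    have h4 : cexp (-π ^ 2 * ‖ξ‖ ^ 2 / u) = ((rexp (-((π * ‖ξ‖) ^ 2 / u)) : ℝ) : ℂ) := by
      push_cast
      ring_nf
    rw [h3, h4, ← Complex.ofReal_mul, ← Complex.ofReal_mul]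
    congr 1
    rw [Real.div_rpow Real.pi_pos.le hu.le, sub_eq_add_neg (-(t ^ 2 * u)), Real.exp_add,
      show (-(1 / 2) : ℝ) = s - 1 - (d : ℝ) / 2 by rw [hsdef]; ring, Real.rpow_sub hu (s - 1)]
    ring
  have hF : kernelFourier scalarPoissonKernel t ξ = ((π ^ (-s) : ℝ) : ℂ) *
      ∫ x : Eucl d, ∫ u in Set.Ioi (0 : ℝ),
        cexp (↑(-2 * π * inner ℝ x ξ) * I) • ((k x u : ℝ) : ℂ) := by
    rw [kernelFourier, fourier_eq', ← integral_const_mul]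
    congr 1
    ext x
    rw [scalarPoissonKernel_eq_integral x ht, integral_smul, integral_complex_ofReal]
    push_cast
    simp only [smul_eq_mul]
    ring
  rw [hF, integral_integral_swap hswap, setIntegral_congr_fun measurableSet_Ioi hgauss,
    integral_complex_ofReal, integral_const_mul,
    integral_rpow_neg_half_mul_exp ht (mul_pos Real.pi_pos (norm_pos_iff.2 hξ)), ← ofReal_mul,
    ← ofReal_mul]
  congr 1
  have h5 : π ^ (-s) * π ^ ((d : ℝ) / 2) * √π = 1 := by
    rw [Real.sqrt_eq_rpow, ← Real.rpow_add Real.pi_pos, ← Real.rpow_add Real.pi_pos, hsdef]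
    ring_nf
    exact Real.rpow_zero π
  calc _ = π ^ (-s) * π ^ ((d : ℝ) / 2) * √π * rexp (-(2 * t * (π * ‖ξ‖))) := by
        field_simp
    _ = _ := by rw [h5, one_mul]; ring_nf

end PoissonFourier

/-! ### Fourier transforms of the entries of the matrix kernel -/

section KernelFourier

open Complex FourierTransform Real

variable {d : ℕ}

theorem IsHomKernel.integrable_slice {n : WithTop ℕ∞} (hn : n ≠ 0) {κ : Eucl d × ℝ → ℝ}
    (h : IsHomKernel n κ) {t : ℝ} (ht : 0 < t) : Integrable fun x => κ (x, t) := by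
  simpa using h.integrable_smul hn (f := fun _ => (1 : ℝ)) aestronglyMeasurable_const
    (by simpa using integrable_decay d) ht

theorem IsHomKernel.integrable_fderiv_slice {κ : Eucl d × ℝ → ℝ} (h : IsHomKernel 1 κ) {t : ℝ}
    (ht : 0 < t) : Integrable fun x => fderiv ℝ κ (x, t) := by
  obtain ⟨C, hC0, hC⟩ := h.exists_bound one_ne_zero
  have hcont : Continuous fun x : Eucl d => fderiv ℝ κ (x, t) :=
    (h.contDiffOn.continuousOn_fderiv_of_isOpen isOpen_compl_singleton le_rfl).comp_continuous
      (by fun_prop) fun _ => prod_ne_zero_of_pos ht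
  have hm : 0 < min 1 t := lt_min one_pos ht
  refine ((integrable_decay d).const_mul (C / t * (2 / min 1 t) ^ (d + 1))).mono'
    hcont.aestronglyMeasurable (.of_forall fun x => ?_)
  have hx := prod_ne_zero_of_pos (x := x) ht
  have hxp : 0 < ‖(x, t)‖ := norm_pos_iff.2 hx
  have htx : t ≤ ‖(x, t)‖ := (le_abs_self t).trans (le_max_right _ _)
  refine ((hC _ hx).2.trans ?_).trans (div_norm_prod_le_decay (by positivity) ht x le_rfl)
  rw [div_div, pow_succ' _ (d + 1)]
  gcongr

theorem innerSL_apply_single (x : Eucl d) (j : Fin d) :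
    innerSL ℝ x (EuclideanSpace.single j (1 : ℝ)) = x j := by
  rw [innerSL_apply_apply, EuclideanSpace.inner_single_right]
  simp

theorem IsHomKernel.fourier_fderiv_apply {κ : Eucl d × ℝ → ℝ} (h : IsHomKernel 1 κ) {t : ℝ}
    (ht : 0 < t) (i : Fin d) (ξ : Eucl d) :
    𝓕 (fun x => ((fderiv ℝ κ (x, t) (EuclideanSpace.single i 1, 0) : ℝ) : ℂ)) ξ =
      2 * π * I * ξ i * kernelFourier κ t ξ := by
  have hd (x : Eucl d) : HasFDerivAt (fun x => ((κ (x, t) : ℝ) : ℂ))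
      (ofRealCLM.comp ((fderiv ℝ κ (x, t)).comp (ContinuousLinearMap.inl ℝ (Eucl d) ℝ))) x :=
    ofRealCLM.hasFDerivAt.comp x ((h.differentiableAt one_ne_zero
      (prod_ne_zero_of_pos ht)).hasFDerivAt.comp x (hasFDerivAt_prodMk_left x t))
  have hfd : fderiv ℝ (fun x => ((κ (x, t) : ℝ) : ℂ)) = fun x =>
      ofRealCLM.comp ((fderiv ℝ κ (x, t)).comp (ContinuousLinearMap.inl ℝ (Eucl d) ℝ)) :=
    funext fun x => (hd x).fderiv
  have hint : Integrable (fderiv ℝ (fun x => ((κ (x, t) : ℝ) : ℂ))) := by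
    rw [hfd]
    exact ((ContinuousLinearMap.compL ℝ (Eucl d) ℝ ℂ ofRealCLM).comp
      ((ContinuousLinearMap.compL ℝ (Eucl d) (Eucl d × ℝ) ℝ).flip
        (ContinuousLinearMap.inl ℝ (Eucl d) ℝ))).integrable_comp (h.integrable_fderiv_slice ht)
  have h1 := congrFun (Real.fourier_fderiv (h.integrable_slice one_ne_zero ht).ofReal
    (fun x => (hd x).differentiableAt) hint) ξ
  have h2 := congrArg (fun T : Eucl d →L[ℝ] ℂ => T (EuclideanSpace.single i 1)) h1
  simp only [fourier_continuousLinearMap_apply hint, VectorFourier.fourierSMulRight_apply] at h2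
  rw [hfd] at h2
  simp only [ContinuousLinearMap.comp_apply, ContinuousLinearMap.inl_apply, ofRealCLM_apply] at h2
  rw [h2, kernelFourier]
  rw [neg_apply, neg_apply, innerSL_apply_single, real_smul, smul_eq_mul]
  push_cast
  ring

/-- Differentiating the power produces the factor `-(d + 1) x_i`; the transform of this kernel thus
follows from that of the Poisson kernel. -/
theorem normalKernel_eq_fderiv (i : Fin d) (x : Eucl d) {t : ℝ} (ht : 0 < t) :
    normalKernel i (x, t) =
      -t * fderiv ℝ scalarPoissonKernel (x, t) (EuclideanSpace.single i 1, 0) := by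
  have hr : 0 < ‖x‖ ^ 2 + t ^ 2 := by positivity
  have h1 : HasFDerivAt (fun z : Eucl d × ℝ => ‖z.1‖ ^ 2 + z.2 ^ 2) _ (x, t) :=
    ((hasFDerivAt_fst (𝕜 := ℝ) (p := (x, t))).norm_sq).add
      ((hasFDerivAt_snd (𝕜 := ℝ) (p := (x, t))).pow 2)
  have h2 := (h1.rpow_const (p := -(((d : ℝ) + 1) / 2)) (Or.inl hr.ne')).const_mul (2 / sphereArea d)
  rw [show scalarPoissonKernel (d := d) = fun z => 2 / sphereArea d *
    (‖z.1‖ ^ 2 + z.2 ^ 2) ^ (-(((d : ℝ) + 1) / 2)) from rfl, h2.fderiv, normalKernel,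
    show -(((d : ℝ) + 1) / 2) - 1 = -(((d : ℝ) + 3) / 2) by ring]
  simp [PiLp.inner_apply]
  ring

theorem kernelFourier_normalKernel (i : Fin d) {ξ : Eucl d} (hξ : ξ ≠ 0) {t : ℝ} (ht : 0 < t) :
    kernelFourier (normalKernel i) t ξ = -(2 * π * I) * (ξ i * rexp (-(2 * π * ‖ξ‖ * t)) : ℝ) := by
  have h1 : kernelFourier (normalKernel i) t ξ = -t *
      𝓕 (fun x => ((fderiv ℝ scalarPoissonKernel (x, t) (EuclideanSpace.single i 1, 0) : ℝ) : ℂ)) ξ := by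
    rw [kernelFourier, fourier_eq, fourier_eq, ← integral_const_mul]
    congr 1
    ext x
    rw [normalKernel_eq_fderiv i x ht, Circle.smul_def, Circle.smul_def]
    push_cast
    simp only [smul_eq_mul]
    ring
  rw [h1, (isHomKernel_scalarPoissonKernel.of_le one_le_two).fourier_fderiv_apply ht]
  push_cast
  rw [← ofReal_ofNat 2]
  have h2 := kernelFourier_scalarPoissonKernel hξ ht
  push_cast at h2 ⊢
  rw [← h2]
  ring

/-- This makes the first moment of the kernel integrable, which allows its Fourier transform to be
differentiated. -/
theorem norm_mul_abs_normalKernel_le (i : Fin d) (x : Eucl d) {t : ℝ} (ht : 0 < t) :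
    ‖x‖ * |normalKernel i (x, t)| ≤ ((d : ℝ) + 1) * t * scalarPoissonKernel (x, t) := by
  have hr : 0 < ‖x‖ ^ 2 + t ^ 2 := by positivity
  have hω := sphereArea_pos d
  have hxi : |x i| ≤ ‖x‖ := PiLp.norm_apply_le x i
  have h1 : (‖x‖ ^ 2 + t ^ 2) ^ (-(((d : ℝ) + 1) / 2)) =
      (‖x‖ ^ 2 + t ^ 2) * (‖x‖ ^ 2 + t ^ 2) ^ (-(((d : ℝ) + 3) / 2)) := by
    rw [← Real.rpow_one_add' hr.le (by linarith [Nat.cast_nonneg (α := ℝ) d])]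
    congr 1
    ring
  have h2 : |normalKernel i (x, t)| = 2 * ((d : ℝ) + 1) / sphereArea d * (t * |x i|) *
      (‖x‖ ^ 2 + t ^ 2) ^ (-(((d : ℝ) + 3) / 2)) := by
    rw [normalKernel, abs_mul, abs_mul, abs_mul, abs_of_pos ht,
      abs_of_nonneg (by positivity : 0 ≤ 2 * ((d : ℝ) + 1) / sphereArea d),
      abs_of_nonneg (by positivity : 0 ≤ (‖x‖ ^ 2 + t ^ 2) ^ (-(((d : ℝ) + 3) / 2)))]
  rw [h2, scalarPoissonKernel, h1]
  have h3 : ‖x‖ * |x i| ≤ ‖x‖ ^ 2 + t ^ 2 := by nlinarith [norm_nonneg x, sq_nonneg t]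
  calc _ = 2 * ((d : ℝ) + 1) / sphereArea d * t * (‖x‖ ^ 2 + t ^ 2) ^ (-(((d : ℝ) + 3) / 2)) *
        (‖x‖ * |x i|) := by ring
    _ ≤ 2 * ((d : ℝ) + 1) / sphereArea d * t * (‖x‖ ^ 2 + t ^ 2) ^ (-(((d : ℝ) + 3) / 2)) *
        (‖x‖ ^ 2 + t ^ 2) := by gcongr
    _ = _ := by ring

theorem hasFDerivAt_apply_mul_exp_norm (i : Fin d) (c : ℝ) {ξ : Eucl d} (hξ : ξ ≠ 0) :
    ∃ T : Eucl d →L[ℝ] ℝ, HasFDerivAt (fun η : Eucl d => η i * rexp (-(c * ‖η‖))) T ξ ∧ ∀ j,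
      T (EuclideanSpace.single j 1) =
        ((if i = j then 1 else 0) - c * (ξ i * ξ j / ‖ξ‖)) * rexp (-(c * ‖ξ‖)) := by
  have hpos := norm_pos_iff.2 hξ
  have h1 : HasFDerivAt (fun η : Eucl d => √(‖η‖ ^ 2)) _ ξ :=
    ((hasFDerivAt_id (𝕜 := ℝ) ξ).norm_sq).sqrt (by simpa using hξ)
  simp only [Real.sqrt_sq (norm_nonneg _)] at h1
  have h2 := (PiLp.hasFDerivAt_apply (𝕜 := ℝ) (E := fun _ : Fin d => ℝ) 2 ξ i).mul
    (h1.const_mul c).neg.exp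
  refine ⟨_, h2, fun j => ?_⟩
  have h3 := innerSL_apply_single ξ j
  rw [innerSL_apply_apply] at h3
  simp only [id_eq, one_div, mul_inv_rev, Pi.neg_apply, add_apply, smul_apply,
    neg_apply, ContinuousLinearMap.comp_id, innerSL_apply_apply, h3, smul_eq_mul, nsmul_eq_mul,
    PiLp.proj_apply, PiLp.single_apply]
  field_simp
  ring

/-- Here `t * tangentialKernel i j` is `x_j` times `normalKernel i`, and multiplication by `-2πi
x_j` becomes `∂/∂ξ_j`. So `ξ_i exp (-2π‖ξ‖t)` is to be differentiated in `ξ_j`, away from the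
origin. -/
theorem kernelFourier_tangentialKernel (i j : Fin d) {ξ : Eucl d} (hξ : ξ ≠ 0) {t : ℝ}
    (ht : 0 < t) : t * kernelFourier (tangentialKernel i j) t ξ =
      (((if i = j then 1 else 0) - 2 * π * t * (ξ i * ξ j / ‖ξ‖)) * rexp (-(2 * π * ‖ξ‖ * t)) : ℝ) := by
  set g : Eucl d → ℂ := fun x => ((normalKernel i (x, t) : ℝ) : ℂ) with hg
  have hgint : Integrable g :=
    ((isHomKernel_normalKernel i).integrable_slice two_ne_zero ht).ofReal
  have hgint' : Integrable fun x => ‖x‖ * ‖g x‖ := by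
    refine (((isHomKernel_scalarPoissonKernel.integrable_slice two_ne_zero ht).const_mul
      (((d : ℝ) + 1) * t))).mono' (continuous_norm.aestronglyMeasurable.mul hgint.1.norm)
      (.of_forall fun x => ?_)
    rw [norm_mul, norm_norm, norm_norm, hg, norm_real]
    exact norm_mul_abs_normalKernel_le i x ht
  have h1 := Real.hasFDerivAt_fourier hgint hgint' ξ
  obtain ⟨T, hT, hTj⟩ := hasFDerivAt_apply_mul_exp_norm i (2 * π * t) hξ
  have h2 := (ofRealCLM.hasFDerivAt.comp ξ hT).const_mul (-(2 * π * I))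
  have h3 := h1.unique (h2.congr_of_eventuallyEq (by
    filter_upwards [isOpen_compl_singleton.mem_nhds hξ] with η hη
    rw [hg]
    refine (kernelFourier_normalKernel i hη ht).trans ?_
    rw [Function.comp_apply, ofRealCLM_apply]
    ring_nf))
  have hsm : Integrable (VectorFourier.fourierSMulRight (innerSL ℝ) g) := by
    refine (hgint'.const_mul (2 * π)).mono' hgint.1.fourierSMulRight (.of_forall fun x => ?_)
    refine (VectorFourier.norm_fourierSMulRight_le _ _ _).trans ?_
    have h5 : ‖innerSL ℝ (E := Eucl d)‖ ≤ 1 := norm_innerSL_le ℝ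
    calc 2 * π * ‖innerSL ℝ (E := Eucl d)‖ * ‖x‖ * ‖g x‖ ≤ 2 * π * 1 * ‖x‖ * ‖g x‖ := by gcongr
      _ = _ := by ring
  have h4 := congrArg (fun T : Eucl d →L[ℝ] ℂ => T (EuclideanSpace.single j 1)) h3
  simp only [fourier_continuousLinearMap_apply hsm, VectorFourier.fourierSMulRight_apply] at h4
  have h5 : 𝓕 (fun x : Eucl d => -(2 * π * I) •
      innerSL ℝ x (EuclideanSpace.single j (1 : ℝ)) • g x) ξ =
      -(2 * π * I) * (t * kernelFourier (tangentialKernel i j) t ξ) := by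
    rw [kernelFourier, fourier_eq, fourier_eq, ← integral_const_mul, ← integral_const_mul]
    congr 1
    ext x
    rw [innerSL_apply_single, hg, Circle.smul_def, Circle.smul_def]
    simp only [tangentialKernel, normalKernel, smul_eq_mul, real_smul]
    push_cast
    ring
  rw [h5] at h4
  have h6 : (-(2 * π * I) : ℂ) ≠ 0 := by simp [Real.pi_ne_zero]
  refine mul_left_cancel₀ h6 (h4.trans ?_)
  rw [smul_apply, ContinuousLinearMap.comp_apply, ofRealCLM_apply, hTj, smul_eq_mul]
  ring_nf

theorem IsHomKernel.hasDerivAt_kernelFourier {κ : Eucl d × ℝ → ℝ} (h : IsHomKernel 2 κ)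
    (ξ : Eucl d) {t : ℝ} (ht : 0 < t) :
    HasDerivAt (fun s : ℝ => (s : ℂ) * kernelFourier κ s ξ)
      (kernelFourier (_root_.timeDeriv κ) t ξ) t := by
  have hc : Continuous fun v : Eucl d => cexp (↑(-2 * π * inner ℝ v ξ) * I) := by fun_prop
  have h1 := h.hasDerivAt_integral (f := fun v => cexp (↑(-2 * π * inner ℝ v ξ) * I))
    hc.aestronglyMeasurable ?_ ht
  · have e (κ' : Eucl d × ℝ → ℝ) (s : ℝ) : kernelFourier κ' s ξ =
        ∫ v, κ' (v, s) • cexp (↑(-2 * π * inner ℝ v ξ) * I) := by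
      rw [kernelFourier, fourier_eq']
      congr 1
      ext v
      rw [real_smul, smul_eq_mul, mul_comm]
    simp_rw [e, ← integral_const_mul]
    refine h1.congr_of_eventuallyEq (.of_forall fun s => ?_)
    refine integral_congr_ae (.of_forall fun v => ?_)
    simp only [real_smul, ofReal_mul]
    ring
  · refine (integrable_decay d).mono' ?_ (.of_forall fun v => ?_)
    · exact (integrable_decay d).1.smul hc.aestronglyMeasurable
    · rw [norm_smul, norm_exp_ofReal_mul_I, mul_one, Real.norm_of_nonneg (by positivity)]

/-- The Fourier transform in `x` commutes with `∂_t`, so an explicit formula valid for all positive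
times may simply be differentiated. -/
theorem kernelFourier_timeDeriv_eq {κ : Eucl d × ℝ → ℝ} (h : IsHomKernel 2 κ) {ξ : Eucl d}
    {F : ℝ → ℂ} {F' : ℂ} {t : ℝ} (ht : 0 < t) (hF : ∀ s, 0 < s → s * kernelFourier κ s ξ = F s)
    (hF' : HasDerivAt F F' t) : kernelFourier (timeDeriv κ) t ξ = F' :=
  (h.hasDerivAt_kernelFourier ξ ht).unique (hF'.congr_of_eventuallyEq
    (Filter.mem_of_superset (Ioi_mem_nhds ht) fun s hs => hF s hs))

theorem hasDerivAt_exp_neg_mul (a t : ℝ) :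
    HasDerivAt (fun s => rexp (-(a * s))) (-a * rexp (-(a * t))) t := by
  have := ((hasDerivAt_id' t).const_mul a).fun_neg.exp
  exact this.congr_deriv (by ring)

theorem kernelFourier_timeDeriv_scalarPoissonKernel {ξ : Eucl d} (hξ : ξ ≠ 0) {t : ℝ}
    (ht : 0 < t) : kernelFourier (timeDeriv scalarPoissonKernel) t ξ =
      (-(2 * π * ‖ξ‖) * rexp (-(2 * π * ‖ξ‖ * t)) : ℝ) :=
  kernelFourier_timeDeriv_eq isHomKernel_scalarPoissonKernel ht
    (fun _ hs => kernelFourier_scalarPoissonKernel hξ hs) (hasDerivAt_exp_neg_mul _ t).ofReal_comp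

theorem kernelFourier_timeDeriv_tangentialKernel (i j : Fin d) {ξ : Eucl d} (hξ : ξ ≠ 0) {t : ℝ}
    (ht : 0 < t) : kernelFourier (timeDeriv (tangentialKernel i j)) t ξ =
      (-(2 * π * ‖ξ‖) * ((if i = j then 1 else 0) +
        (1 - 2 * π * ‖ξ‖ * t) * (ξ i * ξ j / ‖ξ‖ ^ 2)) * rexp (-(2 * π * ‖ξ‖ * t)) : ℝ) := by
  have hpos := norm_pos_iff.2 hξ
  refine kernelFourier_timeDeriv_eq (isHomKernel_tangentialKernel i j) ht
    (fun _ hs => kernelFourier_tangentialKernel i j hξ hs) (HasDerivAt.ofReal_comp ?_)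
  refine (((((hasDerivAt_id' t).const_mul (2 * π)).mul_const (ξ i * ξ j / ‖ξ‖)).const_sub
    (if i = j then 1 else 0)).fun_mul (hasDerivAt_exp_neg_mul (2 * π * ‖ξ‖) t)).congr_deriv ?_
  field_simp
  ring

theorem kernelFourier_timeDeriv_normalKernel (i : Fin d) {ξ : Eucl d} (hξ : ξ ≠ 0) {t : ℝ}
    (ht : 0 < t) : kernelFourier (timeDeriv (normalKernel i)) t ξ =
      -(2 * π * I) * (ξ i * ((1 - 2 * π * ‖ξ‖ * t) * rexp (-(2 * π * ‖ξ‖ * t))) : ℝ) := by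
  have h1 : HasDerivAt (fun s => ξ i * (s * rexp (-(2 * π * ‖ξ‖ * s))))
      (ξ i * ((1 - 2 * π * ‖ξ‖ * t) * rexp (-(2 * π * ‖ξ‖ * t)))) t := by
    refine (((hasDerivAt_id' t).fun_mul (hasDerivAt_exp_neg_mul (2 * π * ‖ξ‖) t)).const_mul
      (ξ i)).congr_deriv ?_
    ring
  refine kernelFourier_timeDeriv_eq (isHomKernel_normalKernel i) ht (fun s hs => ?_)
    (h1.ofReal_comp.const_mul (-(2 * π * I)))
  rw [kernelFourier_normalKernel i hξ hs]
  push_cast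
  ring

/-- The size condition on the Fourier transform of a kernel that gives the `L²` bound of the
square function. -/
def HasPoissonFourierBound (κ : Eucl d × ℝ → ℝ) : Prop :=
  ∀ ξ : Eucl d, ξ ≠ 0 → ∀ t : ℝ, 0 < t → ‖kernelFourier κ t ξ‖ ≤
    2 * π * ‖ξ‖ * (2 + 2 * π * ‖ξ‖ * t) * rexp (-(2 * π * ‖ξ‖ * t))

theorem hasPoissonFourierBound_scalarPoissonKernel :
    HasPoissonFourierBound (timeDeriv (scalarPoissonKernel (d := d))) := by
  intro ξ hξ t ht
  rw [kernelFourier_timeDeriv_scalarPoissonKernel hξ ht, norm_real, norm_mul, norm_neg,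
    Real.norm_of_nonneg (by positivity), Real.norm_of_nonneg (by positivity)]
  have hs : 0 ≤ 2 * π * ‖ξ‖ * t := by positivity
  exact mul_le_mul_of_nonneg_right (le_mul_of_one_le_right (by positivity) (by linarith))
    (Real.exp_pos _).le

/-- With `s = 2π‖ξ‖t`, use `|ξ_i ξ_j| ≤ ‖ξ‖²` and `|1 - s| ≤ 1 + s`; the tangential entries give `1
+ (1 + s) = 2 + s`. -/
theorem hasPoissonFourierBound_rowKernel (i : Fin d ⊕ Unit) (j : Fin d) :
    HasPoissonFourierBound (timeDeriv (rowKernel i j)) := by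
  intro ξ hξ t ht
  have hpos := norm_pos_iff.2 hξ
  have hs : 0 ≤ 2 * π * ‖ξ‖ * t := by positivity
  have h1 : |1 - 2 * π * ‖ξ‖ * t| ≤ 1 + 2 * π * ‖ξ‖ * t := abs_le.2 ⟨by linarith, by linarith⟩
  have hle (k : Fin d) : |ξ k| ≤ ‖ξ‖ := PiLp.norm_apply_le ξ k
  cases i with
  | inl i =>
    change ‖kernelFourier (timeDeriv (tangentialKernel i j)) t ξ‖ ≤ _
    rw [kernelFourier_timeDeriv_tangentialKernel i j hξ ht, norm_real, norm_mul, norm_mul, norm_neg,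
      Real.norm_of_nonneg (by positivity : 0 ≤ 2 * π * ‖ξ‖),
      Real.norm_of_nonneg (Real.exp_pos _).le]
    have h2 : |ξ i * ξ j / ‖ξ‖ ^ 2| ≤ 1 := by
      rw [abs_div, abs_mul, abs_of_nonneg (sq_nonneg ‖ξ‖), div_le_one (by positivity), sq]
      exact mul_le_mul (hle i) (hle j) (abs_nonneg _) (norm_nonneg _)
    gcongr
    refine (norm_add_le _ _).trans ?_
    rw [norm_mul, Real.norm_eq_abs (1 - _), Real.norm_eq_abs (ξ i * _ / _)]
    have h3 : ‖(if i = j then (1 : ℝ) else 0)‖ ≤ 1 := by split_ifs <;> simp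
    have h4 := mul_le_mul h1 h2 (abs_nonneg _) (by linarith)
    linarith
  | inr i =>
    change ‖kernelFourier (timeDeriv (normalKernel j)) t ξ‖ ≤ _
    rw [kernelFourier_timeDeriv_normalKernel j hξ ht, norm_mul, norm_real, norm_mul, norm_mul,
      Real.norm_of_nonneg (Real.exp_pos _).le, Real.norm_eq_abs, Real.norm_eq_abs]
    have h2 : ‖(-(2 * π * I) : ℂ)‖ = 2 * π := by simp [Real.pi_pos.le]
    rw [h2]
    calc 2 * π * (|ξ j| * (|1 - 2 * π * ‖ξ‖ * t| * rexp (-(2 * π * ‖ξ‖ * t))))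
        ≤ 2 * π * (‖ξ‖ * ((2 + 2 * π * ‖ξ‖ * t) * rexp (-(2 * π * ‖ξ‖ * t)))) := by
          gcongr
          · exact hle j
          · linarith
      _ = _ := by ring

end KernelFourier

/-! ### Plancherel for integrable square-integrable functions -/

section Plancherel

open FourierTransform SchwartzMap

variable {V : Type*} [NormedAddCommGroup V] [InnerProductSpace ℝ V] [FiniteDimensional ℝ V]
  [MeasurableSpace V] [BorelSpace V]

/-- Both sides are tested against smooth compactly supported functions: the `L²` transform through
tempered distributions, the integral through the multiplication formula. This makes Plancherel
available for transforms given by integrals. -/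
theorem MemLp.coeFn_fourier_toLp {f : V → ℂ} (h1 : Integrable f) (h2 : MemLp f 2 volume) :
    ⇑(𝓕 (h2.toLp f) : Lp ℂ 2 (volume : Measure V)) =ᵐ[volume] 𝓕 f := by
  refine ae_eq_of_integral_contDiff_smul_eq ?_ ?_ fun g hg hgc => ?_
  · exact (Lp.memLp _).locallyIntegrable (by norm_num)
  · exact (VectorFourier.fourierIntegral_continuous Real.continuous_fourierChar
      continuous_inner h1).locallyIntegrable
  · have hgC : ContDiff ℝ ((⊤ : ℕ∞) : WithTop ℕ∞) fun x => ((g x : ℝ) : ℂ) :=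
      Complex.ofRealCLM.contDiff.comp hg
    have hgS : HasCompactSupport fun x => ((g x : ℝ) : ℂ) := hgc.comp_left Complex.ofReal_zero
    set φ : 𝓢(V, ℂ) := hgS.toSchwartzMap hgC with hφ
    have hφx (x : V) : φ x = ((g x : ℝ) : ℂ) := rfl
    have e1 := congrArg (fun T : 𝓢'(V, ℂ) => T φ) (Lp.fourier_toTemperedDistribution_eq (h2.toLp f))
    simp only [TemperedDistribution.fourier_apply, Lp.toTemperedDistribution_apply] at e1
    have e2 : ∫ x, (𝓕 φ) x • (h2.toLp f) x = ∫ x, 𝓕 (φ : V → ℂ) x • f x := by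
      refine integral_congr_ae ?_
      filter_upwards [h2.coeFn_toLp] with x hx
      rw [hx, fourier_coe]
    have e3 : ∫ x, 𝓕 (φ : V → ℂ) x • f x = ∫ x, φ x • 𝓕 f x := by
      have := VectorFourier.integral_fourierIntegral_smul_eq_flip (L := innerₗ V)
        Real.continuous_fourierChar continuous_inner (φ.integrable (μ := volume)) h1
      rw [flip_innerₗ] at this
      exact this
    rw [e2, e3] at e1
    simp only [hφx] at e1
    simp only [Complex.real_smul]
    exact e1.symm

theorem lintegral_enorm_fourier_sq {f : V → ℂ} (h1 : Integrable f) (h2 : MemLp f 2 volume) :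
    ∫⁻ ξ, ‖𝓕 f ξ‖ₑ ^ 2 = ∫⁻ x, ‖f x‖ₑ ^ 2 := by
  have e (g : V → ℂ) : ∫⁻ x, ‖g x‖ₑ ^ 2 = eLpNorm g 2 volume ^ 2 := by
    rw [← ENNReal.rpow_natCast (eLpNorm g 2 volume), eLpNorm_eq_lintegral_rpow_enorm_toReal
      (by norm_num) (by norm_num), ← ENNReal.rpow_mul]
    simp
  have h3 := Lp.norm_fourier_eq (h2.toLp f)
  rw [e, e, ← eLpNorm_congr_ae (MemLp.coeFn_fourier_toLp h1 h2),
    ← eLpNorm_congr_ae h2.coeFn_toLp, ← Lp.enorm_def, ← Lp.enorm_def, ← ofReal_norm, ← ofReal_norm, h3]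

theorem integral_fourier_mul_conj {f g : V → ℂ} (hf1 : Integrable f) (hf2 : MemLp f 2 volume)
    (hg1 : Integrable g) (hg2 : MemLp g 2 volume) :
    ∫ ξ, 𝓕 f ξ * (starRingEnd ℂ) (𝓕 g ξ) = ∫ x, f x * (starRingEnd ℂ) (g x) := by
  have h3 := Lp.inner_fourier_eq (hg2.toLp g) (hf2.toLp f)
  rw [L2.inner_def, L2.inner_def] at h3
  have e1 : ∫ ξ, 𝓕 f ξ * (starRingEnd ℂ) (𝓕 g ξ) =
      ∫ ξ, inner ℂ ((𝓕 (hg2.toLp g) : Lp ℂ 2 (volume : Measure V)) ξ)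
        ((𝓕 (hf2.toLp f) : Lp ℂ 2 (volume : Measure V)) ξ) := by
    refine integral_congr_ae ?_
    filter_upwards [MemLp.coeFn_fourier_toLp hf1 hf2, MemLp.coeFn_fourier_toLp hg1 hg2] with ξ h4 h5
    rw [h4, h5, RCLike.inner_apply]
  have e2 : ∫ x, f x * (starRingEnd ℂ) (g x) = ∫ x, inner ℂ (hg2.toLp g x) (hf2.toLp f x) := by
    refine integral_congr_ae ?_
    filter_upwards [hf2.coeFn_toLp, hg2.coeFn_toLp] with ξ h4 h5
    rw [h4, h5, RCLike.inner_apply]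
  rw [e1, e2, h3]

end Plancherel

/-! ### The `L²` bound of square functions -/

section SquareFnL2

open FourierTransform Real

variable {d : ℕ}

theorem ofReal_kernelConv (κ : Eucl d × ℝ → ℝ) (f : Eucl d → ℝ) (x : Eucl d) (t : ℝ) :
    ((kernelConv κ f x t : ℝ) : ℂ) = ((fun x => ((κ (x, t) : ℝ) : ℂ))
      ⋆[ContinuousLinearMap.mul ℂ ℂ, volume] (fun x => ((f x : ℝ) : ℂ))) x := by
  rw [kernelConv_eq_integral_sub, convolution, ← integral_complex_ofReal]
  simp

variable {κ κ' : Eucl d × ℝ → ℝ} {f g : Eucl d → ℝ}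

/-- For such `f` a slice is integrable by Young's inequality and bounded, hence in `L¹ ∩ L²`, where
Plancherel applies. -/
theorem memLp_kernelConv (h : IsHomKernel 1 κ) (hf : Continuous f) (hfc : HasCompactSupport f)
    {t : ℝ} (ht : 0 < t) : Integrable (fun x => ((kernelConv κ f x t : ℝ) : ℂ)) ∧
      MemLp (fun x => ((kernelConv κ f x t : ℝ) : ℂ)) 2 volume := by
  have hκi := h.integrable_slice one_ne_zero ht
  have hint : Integrable fun x => ((kernelConv κ f x t : ℝ) : ℂ) := by
    simp_rw [ofReal_kernelConv]
    exact hκi.ofReal.integrable_convolution _ (hf.integrable_of_hasCompactSupport hfc).ofReal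
  refine ⟨hint, ?_⟩
  obtain ⟨M, hM⟩ := hf.bounded_above_of_compact_support hfc
  have htop : MemLp (fun x => ((kernelConv κ f x t : ℝ) : ℂ)) ∞ volume := by
    refine memLp_top_of_bound hint.1 ((∫ v, |κ (v, t)|) * M) (.of_forall fun x => ?_)
    rw [Complex.norm_real, kernelConv_eq_integral_sub, ← integral_mul_const]
    refine norm_integral_le_of_norm_le (hκi.abs.mul_const M) (.of_forall fun v => ?_)
    rw [norm_smul, Real.norm_eq_abs]
    gcongr
    exact hM _
  simpa using memLp_of_integrable_of_memLp_top hint htop one_le_two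

theorem fourier_kernelConv (h : IsHomKernel 1 κ) (hf : Integrable f) {t : ℝ} (ht : 0 < t)
    (ξ : Eucl d) : 𝓕 (fun x => ((kernelConv κ f x t : ℝ) : ℂ)) ξ =
      kernelFourier κ t ξ * 𝓕 (fun x => ((f x : ℝ) : ℂ)) ξ := by
  simp_rw [ofReal_kernelConv]
  exact Real.fourier_mul_convolution_eq (h.integrable_slice one_ne_zero ht).ofReal hf.ofReal ξ

theorem integral_id_mul_exp {a : ℝ} (ha : 0 < a) :
    IntegrableOn (fun t => t * rexp (-(a * t))) (Set.Ioi 0) ∧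
      ∫ t in Set.Ioi (0 : ℝ), t * rexp (-(a * t)) = (a ^ 2)⁻¹ := by
  constructor
  · have := integrableOn_rpow_mul_exp_neg_mul_rpow (p := 1) (s := 1) (by norm_num) one_pos ha
    simpa using this
  · have := Real.integral_rpow_mul_exp_neg_mul_Ioi (a := 2) two_pos ha
    rw [Real.Gamma_two] at this
    norm_num at this
    simpa using this

theorem lintegral_id_mul_exp {a : ℝ} (ha : 0 < a) :
    ∫⁻ t in Set.Ioi (0 : ℝ), ENNReal.ofReal (t * rexp (-(a * t))) = ENNReal.ofReal (a ^ 2)⁻¹ := by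
  rw [← (integral_id_mul_exp ha).2, ofReal_integral_eq_lintegral_ofReal (integral_id_mul_exp ha).1]
  filter_upwards [self_mem_ae_restrict measurableSet_Ioi] with t ht
  have : 0 < t := ht
  positivity

/-- From `1 + s / 2 ≤ exp (s / 2)`, squared. It trades the polynomial factor for half of the
exponential decay. -/
theorem two_add_mul_exp_neg_le {s : ℝ} (hs : 0 ≤ s) :
    ((2 + s) * rexp (-s)) ^ 2 ≤ 4 * rexp (-s) := by
  have h1 : 1 + s / 2 ≤ rexp (s / 2) := by linarith [Real.add_one_le_exp (s / 2)]
  have h2 : (1 + s / 2) ^ 2 ≤ rexp s := by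
    have h3 : rexp s = rexp (s / 2) ^ 2 := by
      rw [← Real.exp_nat_mul]
      congr 1
      push_cast
      ring
    rw [h3]
    gcongr
  have h4 : rexp s * rexp (-s) = 1 := by rw [← Real.exp_add]; simp
  have h5 : 0 < rexp (-s) := Real.exp_pos _
  calc ((2 + s) * rexp (-s)) ^ 2 = 4 * (1 + s / 2) ^ 2 * (rexp (-s) * rexp (-s)) := by ring
    _ ≤ 4 * rexp s * (rexp (-s) * rexp (-s)) := by gcongr
    _ = 4 * rexp (-s) * (rexp s * rexp (-s)) := by ring
    _ = _ := by rw [h4, mul_one]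

theorem HasPoissonFourierBound.sq_le (hb : HasPoissonFourierBound κ) {ξ : Eucl d} (hξ : ξ ≠ 0)
    {t : ℝ} (ht : 0 < t) : ‖kernelFourier κ t ξ‖ ^ 2 ≤
      4 * (2 * π * ‖ξ‖) ^ 2 * rexp (-(2 * π * ‖ξ‖ * t)) := by
  have hs : 0 ≤ 2 * π * ‖ξ‖ * t := by positivity
  calc ‖kernelFourier κ t ξ‖ ^ 2
      ≤ (2 * π * ‖ξ‖ * (2 + 2 * π * ‖ξ‖ * t) * rexp (-(2 * π * ‖ξ‖ * t))) ^ 2 := by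
        gcongr
        exact hb ξ hξ t ht
    _ = (2 * π * ‖ξ‖) ^ 2 * ((2 + 2 * π * ‖ξ‖ * t) * rexp (-(2 * π * ‖ξ‖ * t))) ^ 2 := by ring
    _ ≤ (2 * π * ‖ξ‖) ^ 2 * (4 * rexp (-(2 * π * ‖ξ‖ * t))) := by
        gcongr
        exact two_add_mul_exp_neg_le hs
    _ = _ := by ring

theorem ae_ne_zero (hd : d ≠ 0) : ∀ᵐ ξ : Eucl d, ξ ≠ 0 := by
  have : Nonempty (Fin d) := ⟨⟨0, Nat.pos_of_ne_zero hd⟩⟩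
  simp [ae_iff]

/-- Plancherel in `x` at each height, then Tonelli. With `ρ = 2π‖ξ‖` the squared multiplier is at
most `4 ρ² exp (-ρt)`, whose integral against `t dt` is `4` for every `ρ`; hence the constant `2`.
-/
theorem lintegral_squareFn_sq_le (h : IsHomKernel 1 κ) (hd : d ≠ 0) (hb : HasPoissonFourierBound κ)
    (hf : Continuous f) (hfc : HasCompactSupport f) :
    ∫⁻ x, squareFn κ f x ^ (2 : ℝ) ≤ ((2 : ℝ≥0) * eLpNorm f 2 volume) ^ (2 : ℝ) := by
  have hfi : Integrable fun x => ((f x : ℝ) : ℂ) := (hf.integrable_of_hasCompactSupport hfc).ofReal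
  have hf2 : MemLp (fun x => ((f x : ℝ) : ℂ)) 2 volume := (hf.memLp_of_hasCompactSupport hfc).ofReal
  have hFm : Measurable fun ξ => 𝓕 (fun x => ((f x : ℝ) : ℂ)) ξ :=
    (VectorFourier.fourierIntegral_continuous Real.continuous_fourierChar
      continuous_inner hfi).measurable
  have hm := measurable_kernelConv h.measurable hf.aestronglyMeasurable
  simp_rw [squareFn_rpow]
  rw [lintegral_lintegral_swap (by fun_prop)]
  calc ∫⁻ t in Set.Ioi (0 : ℝ), ∫⁻ x, ENNReal.ofReal t * ‖kernelConv κ f x t‖ₑ ^ 2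
      ≤ ∫⁻ t in Set.Ioi (0 : ℝ), ∫⁻ ξ : Eucl d,
          ENNReal.ofReal (4 * (2 * π * ‖ξ‖) ^ 2) * ‖𝓕 (fun x => ((f x : ℝ) : ℂ)) ξ‖ₑ ^ 2 *
            ENNReal.ofReal (t * rexp (-(2 * π * ‖ξ‖ * t))) := by
        refine setLIntegral_mono' measurableSet_Ioi fun t ht => ?_
        obtain ⟨hk1, hk2⟩ := memLp_kernelConv h hf hfc ht
        have e1 : ∫⁻ x, ‖kernelConv κ f x t‖ₑ ^ 2 =
            ∫⁻ x, ‖((kernelConv κ f x t : ℝ) : ℂ)‖ₑ ^ 2 := by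
          simp_rw [← ofReal_norm, Complex.norm_real]
        rw [lintegral_const_mul' _ _ ENNReal.ofReal_ne_top, e1, ← lintegral_enorm_fourier_sq hk1 hk2,
          ← lintegral_const_mul' _ _ ENNReal.ofReal_ne_top]
        refine lintegral_mono_ae ?_
        filter_upwards [ae_ne_zero hd] with ξ hξ
        rw [fourier_kernelConv h (hf.integrable_of_hasCompactSupport hfc) ht, enorm_mul, mul_pow]
        have e2 : ENNReal.ofReal t * ‖kernelFourier κ t ξ‖ₑ ^ 2 ≤
            ENNReal.ofReal (4 * (2 * π * ‖ξ‖) ^ 2) *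
              ENNReal.ofReal (t * rexp (-(2 * π * ‖ξ‖ * t))) := by
          rw [← ofReal_norm, ← ENNReal.ofReal_pow (norm_nonneg _),
            ← ENNReal.ofReal_mul (le_of_lt ht), ← ENNReal.ofReal_mul (by positivity)]
          refine ENNReal.ofReal_le_ofReal ?_
          have := mul_le_mul_of_nonneg_left (hb.sq_le hξ ht) (le_of_lt ht)
          linarith
        calc _ = ENNReal.ofReal t * ‖kernelFourier κ t ξ‖ₑ ^ 2 *
              ‖𝓕 (fun x => ((f x : ℝ) : ℂ)) ξ‖ₑ ^ 2 := by ring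
          _ ≤ ENNReal.ofReal (4 * (2 * π * ‖ξ‖) ^ 2) *
              ENNReal.ofReal (t * rexp (-(2 * π * ‖ξ‖ * t))) *
              ‖𝓕 (fun x => ((f x : ℝ) : ℂ)) ξ‖ₑ ^ 2 := by gcongr
          _ = _ := by ring
    _ = ∫⁻ ξ : Eucl d, ∫⁻ t in Set.Ioi (0 : ℝ),
          ENNReal.ofReal (4 * (2 * π * ‖ξ‖) ^ 2) * ‖𝓕 (fun x => ((f x : ℝ) : ℂ)) ξ‖ₑ ^ 2 *
            ENNReal.ofReal (t * rexp (-(2 * π * ‖ξ‖ * t))) := by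
        rw [lintegral_lintegral_swap (by fun_prop)]
    _ = ∫⁻ ξ : Eucl d, 4 * ‖𝓕 (fun x => ((f x : ℝ) : ℂ)) ξ‖ₑ ^ 2 := by
        refine lintegral_congr_ae ?_
        filter_upwards [ae_ne_zero hd] with ξ hξ
        have hρ : 0 < 2 * π * ‖ξ‖ := by have := norm_pos_iff.2 hξ; positivity
        rw [lintegral_const_mul _ (by fun_prop), lintegral_id_mul_exp hρ, mul_right_comm,
          ← ENNReal.ofReal_mul (by positivity), mul_assoc 4, mul_inv_cancel₀ (by positivity)]
        simp
    _ = _ := by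
        rw [lintegral_const_mul' _ _ (by norm_num), lintegral_enorm_fourier_sq hfi hf2,
          ENNReal.mul_rpow_of_nonneg _ _ zero_le_two]
        have e3 := lintegral_enorm_rpow_eq_eLpNorm_rpow volume f two_pos
        rw [ENNReal.ofReal_ofNat] at e3
        rw [← e3]
        congr 1
        · rw [ENNReal.rpow_two]
          norm_num
        · refine lintegral_congr fun x => ?_
          rw [ENNReal.rpow_two, ← ofReal_norm, ← ofReal_norm, Complex.norm_real]

theorem exists_lintegral_squareFn_rpow_le_of_fourier (h : IsHomKernel 1 κ) (hd : d ≠ 0)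
    (hb : HasPoissonFourierBound κ) {p : ℝ} (hp : 1 < p) :
    ∃ C : ℝ≥0, ∀ f : Eucl d → ℝ, MemLp f (ENNReal.ofReal p) →
      ∫⁻ x, squareFn κ f x ^ p ≤ (C * eLpNorm f (ENNReal.ofReal p) volume) ^ p :=
  exists_lintegral_squareFn_rpow_le h hd
    (fun _ hf hfc => lintegral_squareFn_sq_le h hd hb hf hfc) hp

end SquareFnL2

/-! ### The bilinear pairing of two square functions -/

section Pairing

variable {d : ℕ} {κ κ' : Eucl d × ℝ → ℝ} {f g h : Eucl d → ℝ} {p q : ℝ} {C C' : ℝ≥0}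

/-- The `L^p` bound of the square function of `κ`, with constant `C`. -/
def SquareFnBound (κ : Eucl d × ℝ → ℝ) (p : ℝ) (C : ℝ≥0) : Prop :=
  ∀ f : Eucl d → ℝ, MemLp f (ENNReal.ofReal p) →
    ∫⁻ x, squareFn κ f x ^ p ≤ (C * eLpNorm f (ENNReal.ofReal p) volume) ^ p

theorem lintegral_id_mul_mul_le {a b : ℝ → ℝ≥0∞} (ha : AEMeasurable a (volume.restrict (Set.Ioi 0)))
    (hb : AEMeasurable b (volume.restrict (Set.Ioi 0))) :
    ∫⁻ t in Set.Ioi (0 : ℝ), ENNReal.ofReal t * (a t * b t) ≤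
      (∫⁻ t in Set.Ioi (0 : ℝ), ENNReal.ofReal t * a t ^ 2) ^ (1 / 2 : ℝ) *
        (∫⁻ t in Set.Ioi (0 : ℝ), ENNReal.ofReal t * b t ^ 2) ^ (1 / 2 : ℝ) := by
  have hm : Measurable fun t : ℝ => ENNReal.ofReal t ^ (1 / 2 : ℝ) := by fun_prop
  have hsq (t : ℝ) : ENNReal.ofReal t ^ (1 / 2 : ℝ) * ENNReal.ofReal t ^ (1 / 2 : ℝ) =
      ENNReal.ofReal t := by
    rw [← ENNReal.rpow_add_of_nonneg _ _ (by norm_num) (by norm_num)]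
    norm_num
  have key := ENNReal.lintegral_mul_le_Lp_mul_Lq (volume.restrict (Set.Ioi (0 : ℝ)))
    Real.HolderConjugate.two_two (hm.aemeasurable.mul ha) (hm.aemeasurable.mul hb)
  simp only [Pi.mul_apply, ENNReal.rpow_two, mul_pow] at key
  have e (t : ℝ) : (ENNReal.ofReal t ^ (1 / 2 : ℝ)) ^ 2 = ENNReal.ofReal t := by rw [sq, hsq]
  simp only [e] at key
  refine le_trans (le_of_eq (lintegral_congr fun t => ?_)) key
  rw [← hsq t]
  simp only [hsq]
  calc _ = ENNReal.ofReal t ^ (1 / 2 : ℝ) * ENNReal.ofReal t ^ (1 / 2 : ℝ) * (a t * b t) := by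
        rw [hsq]
    _ = _ := by ring

theorem lintegral_mul_squareFn_le (hpq : p.HolderConjugate q) (hκ : SquareFnBound κ q C)
    (hh : MemLp h (ENNReal.ofReal q)) (hm : Measurable κ) {G : Eucl d → ℝ≥0∞} (hG : AEMeasurable G) :
    ∫⁻ x, G x * squareFn κ h x ≤
      (∫⁻ x, G x ^ p) ^ (1 / p) * (C * eLpNorm h (ENNReal.ofReal q) volume) := by
  refine (ENNReal.lintegral_mul_le_Lp_mul_Lq volume hpq hG
    (measurable_squareFn hm hh.1).aemeasurable).trans ?_
  gcongr
  rw [one_div, ENNReal.rpow_inv_le_iff hpq.symm.pos]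
  exact hκ h hh

theorem lintegral_squareFn_mul_squareFn_le (hpq : p.HolderConjugate q) (hκ : SquareFnBound κ p C)
    (hκ' : SquareFnBound κ' q C') (hm : Measurable κ) (hm' : Measurable κ')
    (hf : MemLp f (ENNReal.ofReal p)) (hh : MemLp h (ENNReal.ofReal q)) :
    ∫⁻ x, squareFn κ f x * squareFn κ' h x ≤ (C * eLpNorm f (ENNReal.ofReal p) volume) *
      (C' * eLpNorm h (ENNReal.ofReal q) volume) := by
  refine (lintegral_mul_squareFn_le hpq hκ' hh hm' (measurable_squareFn hm hf.1).aemeasurable).trans ?_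
  gcongr
  rw [one_div, ENNReal.rpow_inv_le_iff hpq.pos]
  exact hκ f hf

/-- The measure `dx dt` on the upper half space. -/
abbrev halfSpaceMeasure (d : ℕ) : Measure (Eucl d × ℝ) :=
  (volume : Measure (Eucl d)).prod (volume.restrict (Set.Ioi 0))

theorem ae_halfSpaceMeasure_pos : ∀ᵐ z ∂halfSpaceMeasure d, 0 < z.2 :=
  (Measure.quasiMeasurePreserving_snd (μ := (volume : Measure (Eucl d)))
    (ν := volume.restrict (Set.Ioi (0 : ℝ)))).ae (ae_restrict_mem measurableSet_Ioi)

/-- The integrand of the pairing `∫∫ t (κ_t * f)(κ'_t * h) dx dt`. -/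
def pairingIntegrand (κ κ' : Eucl d × ℝ → ℝ) (f h : Eucl d → ℝ) (z : Eucl d × ℝ) : ℝ :=
  z.2 * (kernelConv κ f z.1 z.2 * kernelConv κ' h z.1 z.2)

/-- The pairing `∫∫ t (κ_t * f)(κ'_t * h) dx dt`. -/
def pairing (κ κ' : Eucl d × ℝ → ℝ) (f h : Eucl d → ℝ) : ℝ :=
  ∫ z, pairingIntegrand κ κ' f h z ∂halfSpaceMeasure d

theorem measurable_pairingIntegrand (hm : Measurable κ) (hm' : Measurable κ')
    (hf : AEStronglyMeasurable f volume) (hh : AEStronglyMeasurable h volume) :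
    Measurable (pairingIntegrand κ κ' f h) :=
  measurable_snd.mul ((measurable_kernelConv hm hf).mul (measurable_kernelConv hm' hh))

/-- Cauchy–Schwarz in `t` for the measure `t dt` bounds the inner integral by a product of two
square functions; Hölder in `x` finishes. -/
theorem lintegral_pairingIntegrand_le (hpq : p.HolderConjugate q) (hκ : SquareFnBound κ p C)
    (hκ' : SquareFnBound κ' q C') (hm : Measurable κ) (hm' : Measurable κ')
    (hf : MemLp f (ENNReal.ofReal p)) (hh : MemLp h (ENNReal.ofReal q)) :
    ∫⁻ z, ‖pairingIntegrand κ κ' f h z‖ₑ ∂halfSpaceMeasure d ≤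
      (C * eLpNorm f (ENNReal.ofReal p) volume) * (C' * eLpNorm h (ENNReal.ofReal q) volume) := by
  have hmf := measurable_kernelConv hm hf.1
  have hmh := measurable_kernelConv hm' hh.1
  rw [lintegral_prod _ (measurable_pairingIntegrand hm hm' hf.1 hh.1).enorm.aemeasurable]
  refine le_trans (lintegral_mono fun x => ?_)
    (lintegral_squareFn_mul_squareFn_le hpq hκ hκ' hm hm' hf hh)
  refine le_trans (le_of_eq ?_) (lintegral_id_mul_mul_le
    (a := fun t => ‖kernelConv κ f x t‖ₑ) (b := fun t => ‖kernelConv κ' h x t‖ₑ)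
    (hmf.comp measurable_prodMk_left).enorm.aemeasurable
    (hmh.comp measurable_prodMk_left).enorm.aemeasurable)
  refine setLIntegral_congr_fun measurableSet_Ioi fun t ht => ?_
  simp only [pairingIntegrand, enorm_mul]
  rw [Real.enorm_of_nonneg (le_of_lt ht)]

theorem integrable_pairingIntegrand (hpq : p.HolderConjugate q) (hκ : SquareFnBound κ p C)
    (hκ' : SquareFnBound κ' q C') (hm : Measurable κ) (hm' : Measurable κ')
    (hf : MemLp f (ENNReal.ofReal p)) (hh : MemLp h (ENNReal.ofReal q)) :
    Integrable (pairingIntegrand κ κ' f h) (halfSpaceMeasure d) := by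
  refine ⟨(measurable_pairingIntegrand hm hm' hf.1 hh.1).aestronglyMeasurable,
    (lintegral_pairingIntegrand_le hpq hκ hκ' hm hm' hf hh).trans_lt ?_⟩
  exact ENNReal.mul_lt_top (ENNReal.mul_lt_top ENNReal.coe_lt_top hf.2)
    (ENNReal.mul_lt_top ENNReal.coe_lt_top hh.2)

theorem enorm_pairing_le (hpq : p.HolderConjugate q) (hκ : SquareFnBound κ p C)
    (hκ' : SquareFnBound κ' q C') (hm : Measurable κ) (hm' : Measurable κ')
    (hf : MemLp f (ENNReal.ofReal p)) (hh : MemLp h (ENNReal.ofReal q)) :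
    ‖pairing κ κ' f h‖ₑ ≤ (C * eLpNorm f (ENNReal.ofReal p) volume) *
      (C' * eLpNorm h (ENNReal.ofReal q) volume) :=
  (enorm_integral_le_lintegral_enorm _).trans (lintegral_pairingIntegrand_le hpq hκ hκ' hm hm' hf hh)

theorem kernelConv_sub_right (hκ : IsHomKernel 1 κ) (hp : 1 < p) (hf : MemLp f (ENNReal.ofReal p))
    (hg : MemLp g (ENNReal.ofReal p)) (x : Eucl d) {t : ℝ} (ht : 0 < t) :
    kernelConv κ (f - g) x t = kernelConv κ f x t - kernelConv κ g x t := by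
  simp only [kernelConv_eq_integral_sub, smul_eq_mul, Pi.sub_apply, mul_sub]
  exact integral_sub (hκ.integrable_mul_sub one_ne_zero hp hf x ht)
    (hκ.integrable_mul_sub one_ne_zero hp hg x ht)

theorem pairing_sub_left (hpq : p.HolderConjugate q) (hκ : SquareFnBound κ p C)
    (hκ' : SquareFnBound κ' q C') (hm : IsHomKernel 1 κ) (hm' : IsHomKernel 1 κ')
    (hf : MemLp f (ENNReal.ofReal p)) (hg : MemLp g (ENNReal.ofReal p))
    (hh : MemLp h (ENNReal.ofReal q)) :
    pairing κ κ' (f - g) h = pairing κ κ' f h - pairing κ κ' g h := by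
  rw [pairing, pairing, pairing, ← integral_sub
    (integrable_pairingIntegrand hpq hκ hκ' hm.measurable hm'.measurable hf hh)
    (integrable_pairingIntegrand hpq hκ hκ' hm.measurable hm'.measurable hg hh)]
  refine integral_congr_ae ?_
  filter_upwards [ae_halfSpaceMeasure_pos] with z hz
  rw [pairingIntegrand, kernelConv_sub_right hm hpq.lt hf hg z.1 hz, pairingIntegrand,
    pairingIntegrand]
  ring

theorem pairing_comm (κ κ' : Eucl d × ℝ → ℝ) (f h : Eucl d → ℝ) :
    pairing κ κ' f h = pairing κ' κ h f :=
  integral_congr_ae (.of_forall fun z => by simp only [pairingIntegrand]; ring)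

/-- If `D f ≠ 0`, approximate `f` in `C_c` to within `‖D f‖ / (2 (M + 1))`. The approximant is
annihilated, so `‖D f‖` would be at most half of itself. -/
theorem eq_zero_of_forall_compactSupport {D : (Eucl d → ℝ) → ℝ} {M : ℝ≥0∞}
    (hM : M ≠ ∞)
    (hb : ∀ f, MemLp f (ENNReal.ofReal p) volume →
      ‖D f‖ₑ ≤ M * eLpNorm f (ENNReal.ofReal p) volume)
    (hsub : ∀ f g, MemLp f (ENNReal.ofReal p) volume → MemLp g (ENNReal.ofReal p) volume →
      D (f - g) = D f - D g)
    (h0 : ∀ f, Continuous f → HasCompactSupport f → D f = 0)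
    (hf : MemLp f (ENNReal.ofReal p) volume) : D f = 0 := by
  by_contra hne
  have hpos : ‖D f‖ₑ / (M + 1) ≠ 0 :=
    ENNReal.div_ne_zero.2 ⟨by simpa using hne, ENNReal.add_ne_top.2 ⟨hM, ENNReal.one_ne_top⟩⟩
  have hpos2 : ‖D f‖ₑ / (M + 1) / 2 ≠ 0 := ENNReal.div_ne_zero.2 ⟨hpos, by norm_num⟩
  obtain ⟨g, hgc, hfg, hg, hgp⟩ := hf.exists_hasCompactSupport_eLpNorm_sub_le
    ENNReal.ofReal_ne_top hpos2
  have h1 : D f = D (f - g) := by rw [hsub f g hf hgp, h0 g hg hgc, sub_zero]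
  have h2 : ‖D f‖ₑ ≤ (M + 1) * (‖D f‖ₑ / (M + 1) / 2) := by
    conv_lhs => rw [h1]
    refine (hb _ (hf.sub hgp)).trans ?_
    gcongr
    exact le_self_add
  rw [div_eq_mul_inv (_ / _), ← mul_assoc, ENNReal.mul_div_cancel (by simp)
    (ENNReal.add_ne_top.2 ⟨hM, ENNReal.one_ne_top⟩), ← div_eq_mul_inv] at h2
  exact absurd h2 (not_le.2 (ENNReal.half_lt_self (by simpa using hne) enorm_ne_top))

theorem enorm_integral_mul_le (hpq : p.HolderConjugate q) (hf : MemLp f (ENNReal.ofReal p))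
    (hh : MemLp h (ENNReal.ofReal q)) : ‖∫ x, f x * h x‖ₑ ≤
      eLpNorm f (ENNReal.ofReal p) volume * eLpNorm h (ENNReal.ofReal q) volume := by
  rw [← ENNReal.rpow_rpow_inv hpq.pos.ne' (eLpNorm f _ _),
    ← ENNReal.rpow_rpow_inv hpq.symm.pos.ne' (eLpNorm h _ _),
    ← lintegral_enorm_rpow_eq_eLpNorm_rpow _ _ hpq.pos,
    ← lintegral_enorm_rpow_eq_eLpNorm_rpow _ _ hpq.symm.pos, ← one_div, ← one_div]
  refine (enorm_integral_le_lintegral_enorm _).trans ?_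
  simp only [enorm_mul]
  exact ENNReal.lintegral_mul_le_Lp_mul_Lq volume hpq hf.1.enorm hh.1.enorm

/-- An identity `∫∫ t (κ_t * f)(κ'_t * h) dx dt = c ∫ f h` extends from `C_c` to `L^p × L^q`. -/
theorem pairing_eq_of_forall_compactSupport (hpq : p.HolderConjugate q)
    (hκ : SquareFnBound κ p C) (hκ' : SquareFnBound κ' q C') (hm : IsHomKernel 1 κ)
    (hm' : IsHomKernel 1 κ') {c : ℝ}
    (h0 : ∀ f h : Eucl d → ℝ, Continuous f → HasCompactSupport f → Continuous h →
      HasCompactSupport h → pairing κ κ' f h = c * ∫ x, f x * h x)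
    (hf : MemLp f (ENNReal.ofReal p)) (hh : MemLp h (ENNReal.ofReal q)) :
    pairing κ κ' f h = c * ∫ x, f x * h x := by
  have hint {f h : Eucl d → ℝ} (hf : MemLp f (ENNReal.ofReal p)) (hh : MemLp h (ENNReal.ofReal q)) :
      Integrable fun x => f x * h x := by
    have := hpq.ennrealOfReal
    exact hf.integrable_mul hh
  have hbound {f h : Eucl d → ℝ} (hf : MemLp f (ENNReal.ofReal p))
      (hh : MemLp h (ENNReal.ofReal q)) : ‖pairing κ κ' f h - c * ∫ x, f x * h x‖ₑ ≤
      (C * C' + ‖c‖ₑ) * (eLpNorm f (ENNReal.ofReal p) volume *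
        eLpNorm h (ENNReal.ofReal q) volume) := by
    refine (enorm_sub_le).trans ?_
    rw [enorm_mul, add_mul]
    gcongr
    · refine (enorm_pairing_le hpq hκ hκ' hm.measurable hm'.measurable hf hh).trans (le_of_eq ?_)
      ring
    · exact enorm_integral_mul_le hpq hf hh
  have hK : (C * C' + ‖c‖ₑ : ℝ≥0∞) ≠ ∞ := by finiteness
  -- Density is used in one variable at a time, `h` staying in `C_c` at first.
  have h1 {f h : Eucl d → ℝ} (hf : MemLp f (ENNReal.ofReal p)) (hh : Continuous h)
      (hhc : HasCompactSupport h) : pairing κ κ' f h - c * ∫ x, f x * h x = 0 := by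
    have hhq : MemLp h (ENNReal.ofReal q) := hh.memLp_of_hasCompactSupport hhc
    refine eq_zero_of_forall_compactSupport (D := fun f => pairing κ κ' f h - c * ∫ x, f x * h x)
      (M := (C * C' + ‖c‖ₑ) * eLpNorm h (ENNReal.ofReal q) volume)
      (ENNReal.mul_ne_top hK hhq.2.ne) (fun f hf => ?_) (fun f g hf hg => ?_)
      (fun f hf hfc => sub_eq_zero.2 (h0 f h hf hfc hh hhc)) hf
    · exact (hbound hf hhq).trans (le_of_eq (by ring))
    · have e : ∫ x, (f - g) x * h x = (∫ x, f x * h x) - ∫ x, g x * h x := by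
        rw [← integral_sub (hint hf hhq) (hint hg hhq)]
        simp only [Pi.sub_apply, sub_mul]
      simp only [pairing_sub_left hpq hκ hκ' hm hm' hf hg hhq, e]
      ring
  refine sub_eq_zero.1 (eq_zero_of_forall_compactSupport
    (D := fun h => pairing κ κ' f h - c * ∫ x, f x * h x)
    (M := (C * C' + ‖c‖ₑ) * eLpNorm f (ENNReal.ofReal p) volume)
    (ENNReal.mul_ne_top hK hf.2.ne) (fun h hh => ?_) (fun g h hg hh => ?_)
    (fun h hh hhc => h1 hf hh hhc) hh)
  · exact (hbound hf hh).trans (le_of_eq (by ring))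
  · have e : ∫ x, f x * (g - h) x = (∫ x, f x * g x) - ∫ x, f x * h x := by
      rw [← integral_sub (hint hf hg) (hint hf hh)]
      simp only [Pi.sub_apply, mul_sub]
    simp only [pairing_comm κ κ', e, pairing_sub_left hpq.symm hκ' hκ hm' hm hg hh hf]
    ring

end Pairing

/-! ### The pairing of the tangential kernels with the Poisson kernel -/

section PairingIdentity

open FourierTransform Real

variable {d : ℕ} {f h : Eucl d → ℝ}

theorem integral_sq_mul_exp {a : ℝ} (ha : 0 < a) :
    IntegrableOn (fun t => t ^ 2 * rexp (-(a * t))) (Set.Ioi 0) ∧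
      ∫ t in Set.Ioi (0 : ℝ), t ^ 2 * rexp (-(a * t)) = 2 * (a ^ 3)⁻¹ := by
  constructor
  · have := integrableOn_rpow_mul_exp_neg_mul_rpow (p := 1) (s := 2) (by norm_num) one_pos ha
    simpa using this
  · have := Real.integral_rpow_mul_exp_neg_mul_Ioi (a := 3) three_pos ha
    rw [show (3 : ℝ) = 2 + 1 by norm_num, Real.Gamma_add_one two_ne_zero, Real.Gamma_two] at this
    norm_num at this
    rw [this, mul_comm]

/-- The cancellation behind the lower bound: the two moments give `(δ + θ) / 4` and `θ / 4`, so `θ`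
drops out of the difference. -/
theorem integral_pairing_weight {ρ : ℝ} (hρ : 0 < ρ) (δ θ : ℝ) :
    ∫ t in Set.Ioi (0 : ℝ), t * (ρ ^ 2 * (δ + (1 - ρ * t) * θ) * rexp (-(2 * ρ * t))) = δ / 4 := by
  have h1 := integral_id_mul_exp (a := 2 * ρ) (by positivity)
  have h2 := integral_sq_mul_exp (a := 2 * ρ) (by positivity)
  have e (t : ℝ) : t * (ρ ^ 2 * (δ + (1 - ρ * t) * θ) * rexp (-(2 * ρ * t))) =
      ρ ^ 2 * (δ + θ) * (t * rexp (-(2 * ρ * t))) - ρ ^ 3 * θ * (t ^ 2 * rexp (-(2 * ρ * t))) := by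
    ring
  simp_rw [e]
  rw [integral_sub (h1.1.const_mul _) (h2.1.const_mul _), integral_const_mul, integral_const_mul,
    h1.2, h2.2]
  field_simp
  ring

/-- Half of the decay of `exp (-(2 * ρ * t))` absorbs the factor `2 + ρ * t`. The remaining bound
has integral `4`, which justifies Fubini. -/
theorem abs_pairing_weight_le {ρ δ θ t : ℝ} (hρ : 0 < ρ) (ht : 0 < t) (hδ : |δ| ≤ 1) (hθ : |θ| ≤ 1) :
    |t * (ρ ^ 2 * (δ + (1 - ρ * t) * θ) * rexp (-(2 * ρ * t)))| ≤
      4 * ρ ^ 2 * (t * rexp (-(ρ * t))) := by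
  have hs : 0 ≤ ρ * t := by positivity
  have h1 : |1 - ρ * t| ≤ 1 + ρ * t := abs_le.2 ⟨by linarith, by linarith⟩
  have h2 : |δ + (1 - ρ * t) * θ| ≤ 2 + ρ * t := by
    refine (abs_add_le _ _).trans ?_
    rw [abs_mul]
    have := mul_le_mul h1 hθ (abs_nonneg _) (by linarith)
    linarith
  have h3 : 2 + ρ * t ≤ 4 * rexp (ρ * t) := by
    have := Real.add_one_le_exp (ρ * t)
    linarith
  have h4 : rexp (ρ * t) * rexp (-(2 * ρ * t)) = rexp (-(ρ * t)) := by
    rw [← Real.exp_add]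
    ring_nf
  rw [abs_mul, abs_mul, abs_mul, abs_of_pos ht, abs_of_pos (by positivity : 0 < ρ ^ 2),
    abs_of_pos (Real.exp_pos _)]
  calc t * (ρ ^ 2 * |δ + (1 - ρ * t) * θ| * rexp (-(2 * ρ * t)))
      ≤ t * (ρ ^ 2 * (4 * rexp (ρ * t)) * rexp (-(2 * ρ * t))) := by
        gcongr
        exact h2.trans h3
    _ = 4 * ρ ^ 2 * (t * (rexp (ρ * t) * rexp (-(2 * ρ * t)))) := by ring
    _ = _ := by rw [h4]

theorem memLp_fourier {f : Eucl d → ℂ} (h1 : Integrable f) (h2 : MemLp f 2 volume) :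
    MemLp (𝓕 f) 2 volume :=
  (Lp.memLp _).ae_eq (MemLp.coeFn_fourier_toLp h1 h2)

theorem integrable_fourier_mul_conj {f g : Eucl d → ℂ} (hf1 : Integrable f) (hf2 : MemLp f 2 volume)
    (hg1 : Integrable g) (hg2 : MemLp g 2 volume) :
    Integrable fun ξ => 𝓕 f ξ * (starRingEnd ℂ) (𝓕 g ξ) :=
  (memLp_fourier hf1 hf2).integrable_mul (memLp_fourier hg1 hg2).star

theorem integral_kernelConv_mul_kernelConv {κ κ' : Eucl d × ℝ → ℝ} (hκ : IsHomKernel 1 κ)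
    (hκ' : IsHomKernel 1 κ') (hf : Continuous f) (hfc : HasCompactSupport f) (hh : Continuous h)
    (hhc : HasCompactSupport h) {t : ℝ} (ht : 0 < t) :
    ((∫ x, kernelConv κ f x t * kernelConv κ' h x t : ℝ) : ℂ) =
      ∫ ξ, kernelFourier κ t ξ * (starRingEnd ℂ) (kernelFourier κ' t ξ) *
        (𝓕 (fun x => ((f x : ℝ) : ℂ)) ξ * (starRingEnd ℂ) (𝓕 (fun x => ((h x : ℝ) : ℂ)) ξ)) := by
  obtain ⟨hf1, hf2⟩ := memLp_kernelConv hκ hf hfc ht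
  obtain ⟨hh1, hh2⟩ := memLp_kernelConv hκ' hh hhc ht
  have key := integral_fourier_mul_conj hf1 hf2 hh1 hh2
  rw [← integral_complex_ofReal]
  simp only [Complex.conj_ofReal, ← Complex.ofReal_mul] at key
  rw [← key]
  refine integral_congr_ae (.of_forall fun ξ => ?_)
  simp only [fourier_kernelConv hκ (hf.integrable_of_hasCompactSupport hfc) ht,
    fourier_kernelConv hκ' (hh.integrable_of_hasCompactSupport hhc) ht, map_mul]
  ring

theorem integrable_mul_of_abs_le {F : Eucl d → ℂ} (hF : Integrable F) (hd : d ≠ 0)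
    {w : Eucl d × ℝ → ℝ} (hw : Measurable w)
    (hle : ∀ ξ : Eucl d, ξ ≠ 0 → ∀ t : ℝ, 0 < t →
      |w (ξ, t)| ≤ 4 * (2 * π * ‖ξ‖) ^ 2 * (t * rexp (-(2 * π * ‖ξ‖ * t)))) :
    Integrable (fun z : Eucl d × ℝ => (w z : ℂ) * F z.1) (halfSpaceMeasure d) := by
  have hm : AEStronglyMeasurable (fun z : Eucl d × ℝ => (w z : ℂ) * F z.1) (halfSpaceMeasure d) :=
    (Complex.measurable_ofReal.comp hw).aestronglyMeasurable.mul hF.1.comp_fst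
  refine ⟨hm, ?_⟩
  rw [HasFiniteIntegral, lintegral_prod _ hm.enorm]
  refine lt_of_le_of_lt (lintegral_mono_ae (g := fun ξ => 4 * ‖F ξ‖ₑ) ?_) ?_
  · filter_upwards [ae_ne_zero hd] with ξ hξ
    have hρ : 0 < 2 * π * ‖ξ‖ := by have := norm_pos_iff.2 hξ; positivity
    calc ∫⁻ t in Set.Ioi (0 : ℝ), ‖(w (ξ, t) : ℂ) * F ξ‖ₑ
        ≤ ∫⁻ t in Set.Ioi (0 : ℝ), ENNReal.ofReal (4 * (2 * π * ‖ξ‖) ^ 2) * ‖F ξ‖ₑ *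
            ENNReal.ofReal (t * rexp (-(2 * π * ‖ξ‖ * t))) := by
          refine setLIntegral_mono' measurableSet_Ioi fun t ht => ?_
          rw [enorm_mul, mul_right_comm, ← ENNReal.ofReal_mul (by positivity), ← ofReal_norm,
            Complex.norm_real]
          gcongr
          exact hle ξ hξ t ht
      _ = 4 * ‖F ξ‖ₑ := by
          rw [lintegral_const_mul _ (by fun_prop), lintegral_id_mul_exp hρ, mul_right_comm,
            ← ENNReal.ofReal_mul (by positivity), mul_assoc 4, mul_inv_cancel₀ (by positivity)]
          simp
  · rw [lintegral_const_mul' _ _ (by norm_num)]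
    exact ENNReal.mul_lt_top (by norm_num) hF.2

/-- Parseval in `x` at each height leaves the product of the two multipliers, which is the weight of
`integral_pairing_weight` with `ρ = 2π‖ξ‖`, `δ = δ_ij` and `θ = ξ_i ξ_j / ‖ξ‖²`. After Fubini the
integral in `t` is the constant `δ_ij / 4`, and Parseval is undone. -/
theorem pairing_tangentialKernel_scalarPoissonKernel (hd : d ≠ 0) (i j : Fin d)
    (hf : Continuous f) (hfc : HasCompactSupport f) (hh : Continuous h)
    (hhc : HasCompactSupport h) :
    pairing (timeDeriv (tangentialKernel i j)) (timeDeriv scalarPoissonKernel) f h =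
      (if i = j then 1 else 0) / 4 * ∫ x, f x * h x := by
  set κ := timeDeriv (tangentialKernel i j) with hκdef
  set κ' := timeDeriv (scalarPoissonKernel (d := d)) with hκdef'
  have hκ : IsHomKernel 1 κ := (isHomKernel_tangentialKernel i j).timeDeriv
  have hκ' : IsHomKernel 1 κ' := isHomKernel_scalarPoissonKernel.timeDeriv
  obtain ⟨C, hC⟩ := exists_lintegral_squareFn_rpow_le_of_fourier hκ hd
    (hasPoissonFourierBound_rowKernel (.inl i) j) one_lt_two
  obtain ⟨C', hC'⟩ := exists_lintegral_squareFn_rpow_le_of_fourier hκ' hd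
    hasPoissonFourierBound_scalarPoissonKernel one_lt_two
  have hfi : Integrable fun x => ((f x : ℝ) : ℂ) := (hf.integrable_of_hasCompactSupport hfc).ofReal
  have hf2 : MemLp (fun x => ((f x : ℝ) : ℂ)) 2 volume := (hf.memLp_of_hasCompactSupport hfc).ofReal
  have hhi : Integrable fun x => ((h x : ℝ) : ℂ) := (hh.integrable_of_hasCompactSupport hhc).ofReal
  have hh2 : MemLp (fun x => ((h x : ℝ) : ℂ)) 2 volume := (hh.memLp_of_hasCompactSupport hhc).ofReal
  set F : Eucl d → ℂ := fun ξ =>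
    𝓕 (fun x => ((f x : ℝ) : ℂ)) ξ * (starRingEnd ℂ) (𝓕 (fun x => ((h x : ℝ) : ℂ)) ξ) with hF
  have hFi : Integrable F := integrable_fourier_mul_conj hfi hf2 hhi hh2
  set w : Eucl d × ℝ → ℝ := fun z => z.2 * ((2 * π * ‖z.1‖) ^ 2 * ((if i = j then 1 else 0) +
    (1 - 2 * π * ‖z.1‖ * z.2) * (z.1 i * z.1 j / ‖z.1‖ ^ 2)) *
      rexp (-(2 * (2 * π * ‖z.1‖) * z.2))) with hw
  have hint : Integrable (fun z : Eucl d × ℝ => (w z : ℂ) * F z.1) (halfSpaceMeasure d) := by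
    refine integrable_mul_of_abs_le hFi hd (by fun_prop) fun ξ hξ t ht => ?_
    have hpos := norm_pos_iff.2 hξ
    refine abs_pairing_weight_le (by positivity) ht (by split_ifs <;> simp) ?_
    rw [abs_div, abs_mul, abs_of_nonneg (sq_nonneg ‖ξ‖), div_le_one (by positivity), sq]
    exact mul_le_mul (PiLp.norm_apply_le ξ i) (PiLp.norm_apply_le ξ j) (abs_nonneg _) (norm_nonneg _)
  have h1 : pairing κ κ' f h = ∫ t in Set.Ioi (0 : ℝ), t *
      ∫ x, kernelConv κ f x t * kernelConv κ' h x t := by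
    rw [pairing, integral_prod_symm _ (integrable_pairingIntegrand Real.HolderConjugate.two_two hC hC'
      hκ.measurable hκ'.measurable (hf.memLp_of_hasCompactSupport hfc)
      (hh.memLp_of_hasCompactSupport hhc))]
    simp only [pairingIntegrand, integral_const_mul]
  have h2 : ((pairing κ κ' f h : ℝ) : ℂ) =
      ∫ t in Set.Ioi (0 : ℝ), ∫ ξ, (w (ξ, t) : ℂ) * F ξ := by
    rw [h1, ← integral_complex_ofReal]
    refine setIntegral_congr_fun measurableSet_Ioi fun t ht => ?_
    simp only [Complex.ofReal_mul]
    rw [integral_kernelConv_mul_kernelConv hκ hκ' hf hfc hh hhc ht, ← integral_const_mul]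
    refine integral_congr_ae ?_
    filter_upwards [ae_ne_zero hd] with ξ hξ
    simp only [hκdef, hκdef', kernelFourier_timeDeriv_tangentialKernel i j hξ ht,
      kernelFourier_timeDeriv_scalarPoissonKernel hξ ht, Complex.conj_ofReal, hw]
    rw [← mul_assoc, ← Complex.ofReal_mul, ← Complex.ofReal_mul]
    congr 2
    rw [show -(2 * (2 * π * ‖ξ‖) * t) = -(2 * π * ‖ξ‖ * t) + -(2 * π * ‖ξ‖ * t) by ring, Real.exp_add]
    ring
  have h3 : ∫ x, F x = ((∫ x, f x * h x : ℝ) : ℂ) := by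
    rw [hF, integral_fourier_mul_conj hfi hf2 hhi hh2, ← integral_complex_ofReal]
    simp
  rw [← integral_integral_swap hint] at h2
  have h4 : ∫ ξ, ∫ t in Set.Ioi (0 : ℝ), (w (ξ, t) : ℂ) * F ξ =
      ∫ ξ, (((if i = j then 1 else 0) / 4 : ℝ) : ℂ) * F ξ := by
    refine integral_congr_ae ?_
    filter_upwards [ae_ne_zero hd] with ξ hξ
    have hpos := norm_pos_iff.2 hξ
    rw [integral_mul_const, integral_complex_ofReal]
    simp only [hw]
    rw [integral_pairing_weight (by positivity)]
  rw [h4, integral_const_mul, h3, ← Complex.ofReal_mul] at h2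
  exact Complex.ofReal_injective h2

end PairingIdentity

/-! ### The two bounds of the Littlewood–Paley function -/

section LittlewoodPaley

variable {d : ℕ} {f : Eucl d → Eucl d} {p q : ℝ}

theorem eLpNorm_ennreal {α : Type*} [MeasurableSpace α] {μ : Measure α} (G : α → ℝ≥0∞)
    (hp : 0 < p) : eLpNorm G (ENNReal.ofReal p) μ = (∫⁻ x, G x ^ p ∂μ) ^ (1 / p) := by
  rw [eLpNorm_eq_lintegral_rpow_enorm_toReal (by simpa using hp) ENNReal.ofReal_ne_top,
    ENNReal.toReal_ofReal hp.le]
  simp only [enorm_eq_self]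

/-- The measure `t dt` on the half line. -/
def idMeasure : Measure ℝ :=
  (volume.restrict (Set.Ioi 0)).withDensity ENNReal.ofReal

/-- Square functions become `L²` norms for `t dt`, so that Minkowski's inequality is at hand. -/
theorem eLpNorm_idMeasure {E : Type*} [NormedAddCommGroup E] (a : ℝ → E) :
    eLpNorm a 2 idMeasure =
      (∫⁻ t in Set.Ioi (0 : ℝ), ENNReal.ofReal t * ‖a t‖ₑ ^ 2) ^ (1 / 2 : ℝ) := by
  rw [eLpNorm_eq_lintegral_rpow_enorm_toReal two_ne_zero ENNReal.ofNat_ne_top, idMeasure,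
    lintegral_withDensity_eq_lintegral_mul_non_measurable _ ENNReal.measurable_ofReal
      (.of_forall fun _ => ENNReal.ofReal_lt_top)]
  simp

theorem eucl_eq_sum_single {ι : Type*} [Fintype ι] [DecidableEq ι] (v : EuclideanSpace ℝ ι) :
    v = ∑ i, EuclideanSpace.single i (v i) := by
  ext k
  simp [Finset.sum_apply]

theorem eLpNorm_eucl_le_sum {α ι : Type*} [Fintype ι] [MeasurableSpace α] {μ : Measure α}
    {F : α → EuclideanSpace ℝ ι} (hF : AEStronglyMeasurable F μ) {s : ℝ≥0∞} (hs : 1 ≤ s) :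
    eLpNorm F s μ ≤ ∑ i, eLpNorm (fun x => F x i) s μ := by
  classical
  have hi (i : ι) : AEStronglyMeasurable (fun x => F x i) μ :=
    (EuclideanSpace.proj (𝕜 := ℝ) i).continuous.comp_aestronglyMeasurable hF
  have h1 (i : ι) : eLpNorm (fun x => EuclideanSpace.single i (F x i)) s μ =
      eLpNorm (fun x => F x i) s μ := eLpNorm_congr_norm_ae (.of_forall fun x => by simp)
  have h2 : F = ∑ i, fun x => EuclideanSpace.single i (F x i) := by
    ext1 x
    rw [Finset.sum_apply]
    exact eucl_eq_sum_single (F x)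
  conv_lhs => rw [h2]
  refine (eLpNorm_sum_le (fun i _ => ?_) hs).trans (le_of_eq (Finset.sum_congr rfl fun i _ => h1 i))
  have : Continuous fun a : ℝ => EuclideanSpace.single i a :=
    (PiLp.continuous_toLp 2 _).comp (continuous_single (A := fun _ : ι => ℝ) i)
  exact this.comp_aestronglyMeasurable (hi i)

/-- The derivative `∂_t U`, as a function of `(x, t)`. -/
def timeDerivField (f : Eucl d → Eucl d) (x : Eucl d) (t : ℝ) : EuclideanSpace ℝ (Fin d ⊕ Unit) :=
  WithLp.toLp 2 fun i => ∑ j, kernelConv (timeDeriv (rowKernel i j)) (fun y => f y j) x t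

theorem measurable_timeDerivField (hf : MemLp f (ENNReal.ofReal p)) :
    Measurable fun z : Eucl d × ℝ => timeDerivField f z.1 z.2 := by
  refine (PiLp.continuous_toLp 2 _).measurable.comp (measurable_pi_iff.2 fun i => ?_)
  exact Finset.measurable_fun_sum _ fun j _ =>
    measurable_kernelConv (isHomKernel_rowKernel i j).timeDeriv.measurable (MemLp.apply_eucl hf j).1

theorem littlewoodPaleyG_eq (hp : 1 < p) (hf : MemLp f (ENNReal.ofReal p)) (x : Eucl d) :
    littlewoodPaleyG f x = (∫⁻ t in Set.Ioi (0 : ℝ),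
      ENNReal.ofReal t * ‖timeDerivField f x t‖ₑ ^ 2) ^ (1 / 2 : ℝ) := by
  rw [littlewoodPaleyG]
  congr 1
  refine setLIntegral_congr_fun measurableSet_Ioi fun t ht => ?_
  simp only [(hasDerivAt_poissonTypeIntegral hp hf x ht).deriv]
  rfl

theorem measurable_littlewoodPaleyG (hp : 1 < p) (hf : MemLp f (ENNReal.ofReal p)) :
    Measurable (littlewoodPaleyG f) := by
  have hm := measurable_timeDerivField hf
  have : littlewoodPaleyG f = fun x => (∫⁻ t in Set.Ioi (0 : ℝ),
      ENNReal.ofReal t * ‖timeDerivField f x t‖ₑ ^ 2) ^ (1 / 2 : ℝ) :=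
    funext fun x => littlewoodPaleyG_eq hp hf x
  rw [this]
  refine Measurable.pow_const (Measurable.lintegral_prod_right (f := fun x t =>
    ENNReal.ofReal t * ‖timeDerivField f x t‖ₑ ^ 2) ?_) _
  exact (ENNReal.measurable_ofReal.comp measurable_snd).mul (hm.enorm.pow_const 2)

theorem littlewoodPaleyG_le_sum (hp : 1 < p) (hf : MemLp f (ENNReal.ofReal p)) (x : Eucl d) :
    littlewoodPaleyG f x ≤
      ∑ i, ∑ j, squareFn (timeDeriv (rowKernel i j)) (fun y => f y j) x := by
  have hk (i : Fin d ⊕ Unit) (j : Fin d) : AEStronglyMeasurable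
      (fun t => kernelConv (timeDeriv (rowKernel i j)) (fun y => f y j) x t) idMeasure :=
    ((measurable_kernelConv (isHomKernel_rowKernel i j).timeDeriv.measurable
      (MemLp.apply_eucl hf j).1).comp measurable_prodMk_left).aestronglyMeasurable
  rw [littlewoodPaleyG_eq hp hf, ← eLpNorm_idMeasure]
  refine (eLpNorm_eucl_le_sum (F := fun t => timeDerivField f x t)
    ((measurable_timeDerivField hf).comp measurable_prodMk_left).aestronglyMeasurable
    one_le_two).trans (Finset.sum_le_sum fun i _ => ?_)
  have e : (fun t => timeDerivField f x t i) =
      ∑ j, fun t => kernelConv (timeDeriv (rowKernel i j)) (fun y => f y j) x t := by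
    ext t
    rw [Finset.sum_apply, timeDerivField]
  simp only [squareFn, ← eLpNorm_idMeasure]
  rw [e]
  exact eLpNorm_sum_le (fun j _ => hk i j) one_le_two

theorem eLpNorm_apply_eucl_le (f : Eucl d → Eucl d) (j : Fin d) (s : ℝ≥0∞) :
    eLpNorm (fun x => f x j) s volume ≤ eLpNorm f s volume :=
  eLpNorm_mono fun x => PiLp.norm_apply_le (f x) j

/-- The `L^p` bound of the Littlewood–Paley function. -/
theorem exists_eLpNorm_littlewoodPaleyG_le (hd : d ≠ 0) (hp : 1 < p) :
    ∃ C : ℝ≥0, ∀ f : Eucl d → Eucl d, MemLp f (ENNReal.ofReal p) →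
      eLpNorm (littlewoodPaleyG f) (ENNReal.ofReal p) volume ≤
        C * eLpNorm f (ENNReal.ofReal p) volume := by
  have hp0 : 0 < p := by linarith
  choose C hC using fun (i : Fin d ⊕ Unit) (j : Fin d) =>
    exists_lintegral_squareFn_rpow_le_of_fourier (isHomKernel_rowKernel i j).timeDeriv hd
      (hasPoissonFourierBound_rowKernel i j) hp
  refine ⟨∑ i, ∑ j, C i j, fun f hf => ?_⟩
  have hm (i : Fin d ⊕ Unit) (j : Fin d) : AEStronglyMeasurable
      (squareFn (timeDeriv (rowKernel i j)) (fun y => f y j)) volume :=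
    (measurable_squareFn (isHomKernel_rowKernel i j).timeDeriv.measurable
      (MemLp.apply_eucl hf j).1).aestronglyMeasurable
  have h1 : (1 : ℝ≥0∞) ≤ ENNReal.ofReal p := by simpa using hp.le
  calc eLpNorm (littlewoodPaleyG f) (ENNReal.ofReal p) volume
      ≤ eLpNorm (∑ i, ∑ j, squareFn (timeDeriv (rowKernel i j)) (fun y => f y j))
          (ENNReal.ofReal p) volume := by
        refine eLpNorm_mono_enorm fun x => ?_
        simp only [enorm_eq_self, Finset.sum_apply]
        exact littlewoodPaleyG_le_sum hp hf x
    _ ≤ ∑ i, ∑ j, eLpNorm (squareFn (timeDeriv (rowKernel i j)) (fun y => f y j))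
          (ENNReal.ofReal p) volume := by
        refine (eLpNorm_sum_le (fun i _ => ?_) h1).trans (Finset.sum_le_sum fun i _ =>
          eLpNorm_sum_le (fun j _ => hm i j) h1)
        exact Finset.aestronglyMeasurable_sum _ fun j _ => hm i j
    _ ≤ ∑ i, ∑ j, (C i j : ℝ≥0∞) * eLpNorm f (ENNReal.ofReal p) volume := by
        refine Finset.sum_le_sum fun i _ => Finset.sum_le_sum fun j _ => ?_
        rw [eLpNorm_ennreal _ hp0, one_div, ENNReal.rpow_inv_le_iff hp0]
        refine (hC i j _ (MemLp.apply_eucl hf j)).trans ?_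
        gcongr
        exact eLpNorm_apply_eucl_le f j _
    _ = _ := by
        push_cast
        simp only [Finset.sum_mul]

/-- The sum over `j` stays inside the integral: there it is the `i`-th component of `∂_t U`, bounded
by `|∂_t U|`. Only so does the Littlewood–Paley function of the whole field appear, and not the
square functions of separate entries. -/
theorem enorm_sum_pairing_le (hpq : p.HolderConjugate q) {κ' : Eucl d × ℝ → ℝ} {C' : ℝ≥0}
    (hκ' : SquareFnBound κ' q C') (hm' : Measurable κ') {h : Eucl d → ℝ}
    (hh : MemLp h (ENNReal.ofReal q)) (hf : MemLp f (ENNReal.ofReal p)) (i : Fin d ⊕ Unit)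
    (hint : ∀ j, Integrable (pairingIntegrand (timeDeriv (rowKernel i j)) κ' (fun y => f y j) h)
      (halfSpaceMeasure d)) :
    ‖∑ j, pairing (timeDeriv (rowKernel i j)) κ' (fun y => f y j) h‖ₑ ≤
      eLpNorm (littlewoodPaleyG f) (ENNReal.ofReal p) volume *
        (C' * eLpNorm h (ENNReal.ofReal q) volume) := by
  have hmf := measurable_timeDerivField hf
  have hmh := measurable_kernelConv hm' hh.1
  have e : ∑ j, pairing (timeDeriv (rowKernel i j)) κ' (fun y => f y j) h =
      ∫ z, z.2 * (timeDerivField f z.1 z.2 i * kernelConv κ' h z.1 z.2) ∂halfSpaceMeasure d := by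
    simp only [pairing]
    rw [← integral_finsetSum _ fun j _ => hint j]
    refine integral_congr_ae (.of_forall fun z => ?_)
    simp only [pairingIntegrand, timeDerivField, Finset.sum_mul, Finset.mul_sum]
  have hmi : Measurable fun z : Eucl d × ℝ => timeDerivField f z.1 z.2 i :=
    (EuclideanSpace.proj (𝕜 := ℝ) i).continuous.measurable.comp hmf
  rw [e]
  refine (enorm_integral_le_lintegral_enorm _).trans ?_
  rw [lintegral_prod _ (by fun_prop), eLpNorm_ennreal _ hpq.pos]
  refine le_trans (lintegral_mono fun x => ?_) (lintegral_mul_squareFn_le hpq hκ' hh hm'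
    (measurable_littlewoodPaleyG hpq.lt hf).aemeasurable)
  rw [littlewoodPaleyG_eq hpq.lt hf, squareFn]
  refine le_trans ?_ (lintegral_id_mul_mul_le (a := fun t => ‖timeDerivField f x t‖ₑ)
    (b := fun t => ‖kernelConv κ' h x t‖ₑ)
    (hmf.comp measurable_prodMk_left).enorm.aemeasurable
    (hmh.comp measurable_prodMk_left).enorm.aemeasurable)
  refine setLIntegral_mono' measurableSet_Ioi fun t ht => ?_
  rw [enorm_mul, enorm_mul, Real.enorm_of_nonneg (le_of_lt ht)]
  gcongr
  exact enorm_le_iff_norm_le.2 (PiLp.norm_apply_le (timeDerivField f x t) i)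

/-- The reverse `L^p` bound of the Littlewood–Paley function. -/
theorem exists_eLpNorm_le_littlewoodPaleyG (hd : d ≠ 0) (hp : 1 < p) :
    ∃ C : ℝ≥0, ∀ f : Eucl d → Eucl d, MemLp f (ENNReal.ofReal p) →
      eLpNorm f (ENNReal.ofReal p) volume ≤
        C * eLpNorm (littlewoodPaleyG f) (ENNReal.ofReal p) volume := by
  have hpq := Real.HolderConjugate.conjExponent hp
  set q := p.conjExponent
  have hκ' : IsHomKernel 1 (timeDeriv (scalarPoissonKernel (d := d))) :=
    isHomKernel_scalarPoissonKernel.timeDeriv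
  obtain ⟨C', hC'⟩ := exists_lintegral_squareFn_rpow_le_of_fourier hκ' hd
    hasPoissonFourierBound_scalarPoissonKernel hpq.symm.lt
  choose C hC using fun (i : Fin d ⊕ Unit) (j : Fin d) =>
    exists_lintegral_squareFn_rpow_le_of_fourier (isHomKernel_rowKernel i j).timeDeriv hd
      (hasPoissonFourierBound_rowKernel i j) hp
  refine ⟨d * (4 * C'), fun f hf => ?_⟩
  have hcomp (i : Fin d) : eLpNorm (fun x => f x i) (ENNReal.ofReal p) volume ≤
      4 * C' * eLpNorm (littlewoodPaleyG f) (ENNReal.ofReal p) volume := by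
    have hfi := MemLp.apply_eucl hf i
    rw [eLpNorm_congr_ae hfi.1.ae_eq_mk]
    refine eLpNorm_le_of_forall_integral_inner_le hfi.1.stronglyMeasurable_mk hpq
      fun g hg1 hgtop _ => ?_
    have hg : MemLp g (ENNReal.ofReal q) :=
      memLp_of_integrable_of_memLp_top hg1 hgtop hpq.symm.lt.le
    have h1 (j : Fin d) : pairing (timeDeriv (rowKernel (.inl i) j)) (timeDeriv scalarPoissonKernel)
        (fun y => f y j) g = (if i = j then 1 else 0) / 4 * ∫ x, f x j * g x :=
      pairing_eq_of_forall_compactSupport hpq (hC (.inl i) j) hC'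
        (isHomKernel_rowKernel (.inl i) j).timeDeriv hκ'
        (fun _ _ hu huc hv hvc => pairing_tangentialKernel_scalarPoissonKernel hd i j hu huc hv hvc)
        (MemLp.apply_eucl hf j) hg
    -- Among the pairings only `j = i` survives; the factor `4` undoes the `1 / 4`.
    have h2 : ∫ x, inner ℝ (g x) (hfi.1.mk _ x) = 4 * ∑ j, pairing (timeDeriv (rowKernel (.inl i) j))
        (timeDeriv scalarPoissonKernel) (fun y => f y j) g := by
      simp only [h1]
      rw [Finset.sum_eq_single i (fun j _ hj => by simp [hj.symm]) (by simp)]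
      rw [if_pos rfl, ← mul_assoc]
      rw [show (4 : ℝ) * (1 / 4) = 1 by norm_num, one_mul]
      refine integral_congr_ae ?_
      filter_upwards [hfi.1.ae_eq_mk] with x hx
      rw [← hx]
      rfl
    rw [h2]
    refine (Real.ofReal_le_enorm _).trans ?_
    rw [enorm_mul]
    have h4 : ‖(4 : ℝ)‖ₑ = 4 := by
      rw [Real.enorm_of_nonneg (by norm_num)]
      norm_num
    rw [h4]
    refine (mul_le_mul_right (enorm_sum_pairing_le hpq hC' hκ'.measurable hg hf (.inl i) fun j =>
      integrable_pairingIntegrand hpq (hC (.inl i) j) hC'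
        (isHomKernel_rowKernel (.inl i) j).timeDeriv.measurable hκ'.measurable
        (MemLp.apply_eucl hf j) hg) 4).trans (le_of_eq ?_)
    ring
  have h1 : (1 : ℝ≥0∞) ≤ ENNReal.ofReal p := by simpa using hp.le
  refine (eLpNorm_eucl_le_sum hf.1 h1).trans ((Finset.sum_le_sum fun i _ => hcomp i).trans
    (le_of_eq ?_))
  simp only [Finset.sum_const, Finset.card_univ, Fintype.card_fin, nsmul_eq_mul]
  push_cast
  ring

end LittlewoodPaley

end
-- Assembly of the theorem.
theorem mainTheorem6 (d : ℕ) (hd : 2 ≤ d) (p : ℝ≥0∞) (hp1 : 1 < p) (hp : p < ∞) :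
    ∃ C₁ C₂ : ℝ≥0, 0 < C₁ ∧ 0 < C₂ ∧
      ∀ f : EuclideanSpace ℝ (Fin d) → EuclideanSpace ℝ (Fin d), MemLp f p volume →
        (∀ x, ∀ t : ℝ, 0 < t →
          (∀ i j, ConvolutionExistsAt (fun y => matrixPoissonKernel t y i j)
            (fun y => extendByZero f y j) x (ContinuousLinearMap.mul ℝ ℝ) volume) ∧
          DifferentiableAt ℝ (fun s => poissonTypeIntegral f x s) t) ∧
        MemLp (littlewoodPaleyG f) p volume ∧
        C₁ * eLpNorm (littlewoodPaleyG f) p volume ≤ eLpNorm f p volume ∧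
        eLpNorm f p volume ≤ C₂ * eLpNorm (littlewoodPaleyG f) p volume := by
  obtain ⟨r, rfl⟩ : ∃ r : ℝ, p = ENNReal.ofReal r := ⟨_, (ENNReal.ofReal_toReal hp.ne).symm⟩
  have hr : 1 < r := ENNReal.one_lt_ofReal.1 hp1
  have hd0 : d ≠ 0 := by omega
  obtain ⟨A, hA⟩ := exists_eLpNorm_littlewoodPaleyG_le hd0 hr
  obtain ⟨B, hB⟩ := exists_eLpNorm_le_littlewoodPaleyG hd0 hr
  -- The bounds `A` and `B` might be zero; adding `1` makes both constants positive and the inverse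
  -- meaningful.
  refine ⟨(A + 1)⁻¹, B + 1, by positivity, by positivity, fun f hf => ⟨fun x t ht => ⟨fun i j =>
    convolutionExistsAt_matrixPoissonKernel hr hf x ht i j,
    (hasDerivAt_poissonTypeIntegral hr hf x ht).differentiableAt⟩, ⟨?_, ?_⟩, ?_, ?_⟩⟩
  · exact (measurable_littlewoodPaleyG hr hf).aestronglyMeasurable
  · exact (hA f hf).trans_lt (ENNReal.mul_lt_top ENNReal.coe_lt_top hf.2)
  · rw [ENNReal.coe_inv (by positivity), mul_comm, ← div_eq_mul_inv]
    refine ENNReal.div_le_of_le_mul' ((hA f hf).trans ?_)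
    gcongr
    exact le_self_add
  · refine (hB f hf).trans ?_
    gcongr
    exact le_self_add
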